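/- Let $P\subset\mathbb R^d$ be a parallelohedron, i.e. a full-dimensional convex polytope for which there is a face-to-face tiling of $\mathbb R^d$ by translates of $P$; fix such a tiling containing $P$ itself. For a facet $F$ of $P$, its facet vector $\mathbf t(F)$ is the vector such that $P+\mathbf t(F)$ is the tile adjacent to $P$ along $F$, i.e. $P\cap(P+\mathbf t(F))=F$. Two facets of $P$ are antipodal if the central symmetry of $P$ takes one to the other. For a $(d-2)$-dimensional face $E$ of $P$, the belt of $E$ is the set of all facets of $P$ parallel to $E$. The Venkov graph $G_P$ has as vertices the unordered pairs of antipodal facets of $P$; two distinct vertices $\{F_1,F_1'\}$ and $\{F_2,F_2'\}$ are joined by a red edge if and only if $F_1,F_1',F_2,F_2'$ all belong to one and the same belt consisting of exactly $6$ facets. Let $\Lambda\subset\mathbb R^d$ be the lattice (additive subgroup) generated by all facet vectors of $P$, and for a set $A$ of vertices of $G_P$ let $\Lambda(A)\subset\Lambda$ be the sublattice generated by the facet vectors of the facets in the pairs belonging to $A$. Suppose that the vertex set of $G_P$ is a disjoint union $A_1\sqcup A_2$ and that no red edge joins a vertex of $A_1$ to a vertex of $A_2$. Then $$\Lambda=\Lambda(A_1)\oplus\Lambda(A_2),$$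 that is, $\Lambda=\Lambda(A_1)+\Lambda(A_2)$ and $\Lambda(A_1)\cap\Lambda(A_2)=\{0\}$. -/

import Mathlib

open scoped Pointwise

noncomputable section

/-- The space `ℝ^d`. -/
abbrev RSpace (d : ℕ) : Type := EuclideanSpace ℝ (Fin d)

/-- A convex polytope of full dimension in `ℝ^d`. -/
def IsConvexPolytope {d : ℕ} (P : Set (RSpace d)) : Prop :=
  (∃ S : Set (RSpace d), S.Finite ∧ P = convexHull ℝ S) ∧ (interior P).Nonempty

/-- The translates `t + P`, `t ∈ T`, form a face-to-face tiling of `ℝ^d`: they cover the space,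
different translates have disjoint interiors, and the intersection of any two of them is
a (possibly empty) face of each. The faces of a polytope are its exposed subsets. -/
structure IsFaceToFaceTiling {d : ℕ} (P : Set (RSpace d)) (T : Set (RSpace d)) : Prop where
  cover : ⋃ t ∈ T, (t +ᵥ P) = Set.univ
  disjoint_interior :
    ∀ s ∈ T, ∀ t ∈ T, s ≠ t → Disjoint (interior (s +ᵥ P)) (interior (t +ᵥ P))
  face_to_face :
    ∀ s ∈ T, ∀ t ∈ T,
      IsExposed ℝ (s +ᵥ P) ((s +ᵥ P) ∩ (t +ᵥ P)) ∧ IsExposed ℝ (t +ᵥ P) ((s +ᵥ P) ∩ (t +ᵥ P))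

/-- A parallelohedron of dimension `d`: a convex polytope whose translates can tile `ℝ^d`
face-to-face. -/
def IsParallelohedron {d : ℕ} (P : Set (RSpace d)) : Prop :=
  IsConvexPolytope P ∧ ∃ T : Set (RSpace d), IsFaceToFaceTiling P T

/-- `F` is a nonempty face of `P` of dimension `d - k`. -/
def IsFaceOfCodim {d : ℕ} (k : ℕ) (P F : Set (RSpace d)) : Prop :=
  IsExposed ℝ P F ∧ F.Nonempty ∧ Module.finrank ℝ (vectorSpan ℝ F) + k = d

/-- Facets (hyperfaces) are the faces of dimension `d - 1`. -/
def IsFacet {d : ℕ} (P F : Set (RSpace d)) : Prop := IsFaceOfCodim 1 P F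

/-- Ridges are the faces of dimension `d - 2`. -/
def IsRidge {d : ℕ} (P E : Set (RSpace d)) : Prop := IsFaceOfCodim 2 P E

/-- The belt of `P` determined by `E` (a ridge of `P`): all facets of `P` parallel to `E`. -/
def belt {d : ℕ} (P E : Set (RSpace d)) : Set (Set (RSpace d)) :=
  {F | IsFacet P F ∧ vectorSpan ℝ E ≤ vectorSpan ℝ F}

/-- `F` and `F'` are antipodal facets of `P`: the central symmetry of `P` takes `F` to `F'`. -/
def AreAntipodal {d : ℕ} (P F F' : Set (RSpace d)) : Prop :=
  IsFacet P F ∧ IsFacet P F' ∧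
    ∃ c : RSpace d, AffineEquiv.pointReflection ℝ c '' P = P ∧
      AffineEquiv.pointReflection ℝ c '' F = F'

/-- The vertices of the Venkov graph of `P`: unordered pairs of antipodal facets of `P`. -/
def VenkovVertex {d : ℕ} (P : Set (RSpace d)) : Type :=
  {v : Sym2 (Set (RSpace d)) // ∃ F F', AreAntipodal P F F' ∧ v = s(F, F')}

/-- The red Venkov graph of `P`: two different vertices are joined by a red edge when the four
facets of the two pairs belong to one and the same belt consisting of six facets. -/
def redVenkovGraph {d : ℕ} (P : Set (RSpace d)) : SimpleGraph (VenkovVertex P) where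
  Adj v w := v ≠ w ∧ ∃ E, IsRidge P E ∧ (belt P E).ncard = 6 ∧
    (∀ F ∈ v.1, F ∈ belt P E) ∧ (∀ F ∈ w.1, F ∈ belt P E)
  symm := ⟨fun _ _ ⟨hne, E, hE, h6, hv, hw⟩ => ⟨hne.symm, E, hE, h6, hw, hv⟩⟩
  loopless := ⟨fun _ h => h.1 rfl⟩

/-- `t` is the facet vector of the facet `F` of `P`, in the tiling by the translates of `P` by the
vectors of `T` (where `0 ∈ T`): `t + P` is the tile adjacent to `P` along `F`. -/
def IsFacetVector {d : ℕ} (P T F : Set (RSpace d)) (t : RSpace d) : Prop :=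
  IsFacet P F ∧ t ∈ T ∧ P ∩ (t +ᵥ P) = F

/-- The lattice `Λ` generated by all facet vectors of `P`. -/
def facetLattice {d : ℕ} (P T : Set (RSpace d)) : Submodule ℤ (RSpace d) :=
  Submodule.span ℤ {t | ∃ F, IsFacetVector P T F t}

/-- The sublattice `Λ(A)` generated by the facet vectors that correspond to the vertices in `A`. -/
def facetSublattice {d : ℕ} (P T : Set (RSpace d)) (A : Set (VenkovVertex P)) :
    Submodule ℤ (RSpace d) :=
  Submodule.span ℤ {t | ∃ v ∈ A, ∃ F ∈ v.1, IsFacetVector P T F t}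

end

open scoped Topology ENNReal
open MeasureTheory Module

/-! Only the triviality of the intersection needs work. Give a facet vector `v` the increment `a v =
v` if its vertex lies in `A₁`, and `a v = 0` if it lies in `A₂`. Suppose a function `Φ` on the tiles
satisfies `Φ (t + v) = Φ t + a v` for all tiles `t` and facet vectors `v`. Then a vector `x` in both
sublattices has `Φ x = Φ 0 + x` and `Φ x = Φ 0`, so `x = 0`.

Such a `Φ` is a potential for a cochain on the adjacency graph of the tiles. Since cells of
codimension at least three do not disconnect or obstruct generic segments and triangles, a global
potential exists as soon as one exists at each point outside them (`exists_potential`). The only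
real condition is therefore that the increments close up around each ridge (`exists_isPot_local`).
If the tiles at the ridge are pairwise neighbours, any three of them give a belt of six facets
(`exists_belt`); without red edges between the classes the three facet vectors lie in one class,
where `a` is the identity or zero. If two tiles at the ridge are not neighbours, there are only
these two, or four tiles forming a parallelogram (`exists_isPot_of_not_isNbr`), and opposite
increments cancel.

The ridge analysis uses that the translation vectors form a group (`add_mem`, `sub_mem`) and that
tiles are centrally symmetric (`exists_symm`, Minkowski's theorem). For the latter, the lattice
translates of half the difference body of the open tile are disjoint, so its volume is at most that
of the tile, while Brunn–Minkowski gives the reverse inequality. The equality case, analysed through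
the distribution of each linear functional (`exists_symmetric_of_transport`), forces symmetry about
the centroid. -/

/-- A face-to-face tiling by translates of a compact convex set with nonempty interior. -/
structure ConvexTiling {d : ℕ} (P T : Set (RSpace d)) : Prop where
  convex : Convex ℝ P
  compact : IsCompact P
  int_nonempty : (interior P).Nonempty
  tiling : IsFaceToFaceTiling P T

/-! ### Tiles and cells at a point -/

/-- The translation vectors of the tiles that contain `x`. -/
def tilesAt {d : ℕ} (P T : Set (RSpace d)) (x : RSpace d) : Set (RSpace d) :=
  {t | t ∈ T ∧ x - t ∈ P}

/-- The intersection of all tiles that contain `x`. -/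
def cellAt {d : ℕ} (P T : Set (RSpace d)) (x : RSpace d) : Set (RSpace d) :=
  {y | ∀ t ∈ tilesAt P T x, y - t ∈ P}

/-- The points whose cell has codimension at least `k`. -/
def skel {d : ℕ} (P T : Set (RSpace d)) (k : ℕ) : Set (RSpace d) :=
  {x | finrank ℝ (vectorSpan ℝ (cellAt P T x)) + k ≤ d}

/-- `x` is an algebraic relative interior point of `G`. -/
def RelInt {d : ℕ} (G : Set (RSpace d)) (x : RSpace d) : Prop :=
  x ∈ G ∧ ∀ y ∈ G, ∃ ε : ℝ, 0 < ε ∧ x + ε • (x - y) ∈ G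

lemma mem_vadd_iff_sub_mem {d : ℕ} {P : Set (RSpace d)} {t x : RSpace d} :
    x ∈ t +ᵥ P ↔ x - t ∈ P := by
  rw [Set.mem_vadd_set_iff_neg_vadd_mem, vadd_eq_add, neg_add_eq_sub]

lemma mem_cellAt_self {d : ℕ} {P T : Set (RSpace d)} (x : RSpace d) : x ∈ cellAt P T x :=
  fun _ ht => ht.2

namespace ConvexTiling

variable {d : ℕ} {P T : Set (RSpace d)}

lemma exists_mem (h : ConvexTiling P T) (x : RSpace d) : ∃ t ∈ T, x - t ∈ P := by
  have : x ∈ ⋃ t ∈ T, (t +ᵥ P) := by rw [h.tiling.cover]; trivial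
  obtain ⟨t, ht, hx⟩ := Set.mem_iUnion₂.1 this
  exact ⟨t, ht, mem_vadd_iff_sub_mem.1 hx⟩

lemma tilesAt_nonempty (h : ConvexTiling P T) (x : RSpace d) : (tilesAt P T x).Nonempty :=
  let ⟨t, ht, hx⟩ := h.exists_mem x
  ⟨t, ht, hx⟩

lemma closure_interior (h : ConvexTiling P T) : closure (interior P) = P := by
  rw [h.convex.closure_interior_eq_closure_of_nonempty_interior h.int_nonempty,
    h.compact.isClosed.closure_eq]

/-- The tiling axiom only separates interiors; as `P` is the closure of its interior, an interior
point of one tile lying in another tile can be moved into both interiors. -/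
lemma eq_of_mem_interior (h : ConvexTiling P T) {s t x : RSpace d} (hs : s ∈ T) (ht : t ∈ T)
    (hxs : x - s ∈ interior P) (hxt : x - t ∈ P) : s = t := by
  by_contra hst
  have hd := h.tiling.disjoint_interior s hs t ht hst
  rw [← h.closure_interior, mem_closure_iff] at hxt
  obtain ⟨z, hz1, hz2⟩ := hxt ((fun z => z + t - s) ⁻¹' interior P)
    (isOpen_interior.preimage (by fun_prop)) (by simpa using hxs)
  rw [interior_vadd, interior_vadd] at hd
  have h1 : z + t ∈ s +ᵥ interior P := mem_vadd_iff_sub_mem.2 hz1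
  have h2 : z + t ∈ t +ᵥ interior P := mem_vadd_iff_sub_mem.2 (by simpa using hz2)
  exact Set.disjoint_left.1 hd h1 h2

lemma exists_face (h : ConvexTiling P T) {s t : RSpace d} (hs : s ∈ T) (ht : t ∈ T)
    {w : RSpace d} (hws : w - s ∈ P) (hwt : w - t ∈ P) :
    ∃ l : StrongDual ℝ (RSpace d), ∀ x, x - s ∈ P ∧ x - t ∈ P ↔
      x - s ∈ P ∧ ∀ y, y - s ∈ P → l y ≤ l x := by
  obtain ⟨l, hl⟩ := (h.tiling.face_to_face s hs t ht).1
    ⟨w, mem_vadd_iff_sub_mem.2 hws, mem_vadd_iff_sub_mem.2 hwt⟩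
  refine ⟨l, fun x => ?_⟩
  have := Set.ext_iff.1 hl x
  simpa only [Set.mem_inter_iff, mem_vadd_iff_sub_mem, Set.mem_ofPred_eq] using this

/-- The tiles meet in an exposed face of `s + P`. Its functional is maximal at `x`, and prolonging
the segment from `y` through `x` inside `G` shows that it takes the same value at `y`; so `y` lies
in that face. -/
lemma mem_of_relInt (h : ConvexTiling P T) {s t : RSpace d} (hs : s ∈ T) (ht : t ∈ T)
    {G : Set (RSpace d)} (hG : ∀ y ∈ G, y - s ∈ P) {x : RSpace d} (hx : RelInt G x)
    (hxt : x - t ∈ P) {y : RSpace d} (hy : y ∈ G) : y - t ∈ P := by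
  obtain ⟨l, hl⟩ := h.exists_face hs ht (hG x hx.1) hxt
  have hmax := ((hl x).1 ⟨hG x hx.1, hxt⟩).2
  obtain ⟨ε, hε, hz⟩ := hx.2 y hy
  have h1 := hmax _ (hG _ hz)
  simp only [map_add, map_smul, map_sub, smul_eq_mul] at h1
  have h2 : l x ≤ l y := by nlinarith
  exact ((hl y).2 ⟨hG y hy, fun z hz => (hmax z hz).trans h2⟩).2

/-- A ball of radius `r` inside `P` keeps distinct translation vectors at distance at least `r`, and
the vectors in question form a bounded set. -/
lemma finite_tiles (h : ConvexTiling P T) {B : Set (RSpace d)} (hB : Bornology.IsBounded B) :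
    {t | t ∈ T ∧ ∃ x ∈ B, x - t ∈ P}.Finite := by
  obtain ⟨c, hc⟩ := h.int_nonempty
  obtain ⟨r, hr, hball⟩ := Metric.isOpen_iff.1 isOpen_interior c hc
  have hsep : ∀ s ∈ T, ∀ t ∈ T, dist s t < r → s = t := by
    intro s hs t ht hst
    refine h.eq_of_mem_interior (x := c + t) hs ht (hball ?_) ?_
    · rw [Metric.mem_ball, dist_eq_norm, show c + t - s - c = t - s by abel, ← dist_eq_norm,
        dist_comm]
      exact hst
    · simpa using interior_subset hc
  set S := {t | t ∈ T ∧ ∃ x ∈ B, x - t ∈ P}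
  have hS : Bornology.IsBounded S := by
    refine (hB.sub h.compact.isBounded).subset ?_
    rintro t ⟨-, x, hx, hxt⟩
    exact ⟨x, hx, x - t, hxt, by simp⟩
  obtain ⟨F, hF, hcov⟩ := Metric.totallyBounded_iff.1
    (hS.isCompact_closure.totallyBounded.subset subset_closure) (r / 2) (by positivity)
  have : S = ⋃ y ∈ F, (S ∩ Metric.ball y (r / 2)) := by
    rw [← Set.inter_iUnion₂]
    exact (Set.inter_eq_left.2 hcov).symm
  rw [this]
  refine hF.biUnion fun y _ => Set.Subsingleton.finite ?_
  rintro s ⟨hs, hsy⟩ t ⟨ht, hty⟩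
  refine hsep s hs.1 t ht.1 ?_
  rw [Metric.mem_ball] at hsy hty
  linarith [dist_triangle_right s t y]

lemma tilesAt_finite (h : ConvexTiling P T) (x : RSpace d) : (tilesAt P T x).Finite :=
  (h.finite_tiles (B := {x}) Bornology.isBounded_singleton).subset fun _ ht => ⟨ht.1, x, rfl, ht.2⟩

lemma countable (h : ConvexTiling P T) : T.Countable := by
  have : T ⊆ ⋃ n : ℕ, {t | t ∈ T ∧ ∃ x ∈ Metric.ball (0 : RSpace d) n, x - t ∈ P} := by
    intro t ht
    obtain ⟨c, hc⟩ := h.int_nonempty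
    obtain ⟨n, hn⟩ := exists_nat_gt ‖c + t‖
    exact Set.mem_iUnion.2 ⟨n, ht, c + t, by simpa using hn, by simpa using interior_subset hc⟩
  exact (Set.countable_iUnion fun n => (h.finite_tiles Metric.isBounded_ball).countable).mono this

/-- Tiles are closed and locally finite. This semicontinuity is what lets local data at a point
control a whole neighbourhood. -/
lemma eventually_tilesAt_subset (h : ConvexTiling P T) (x : RSpace d) :
    ∀ᶠ y in 𝓝 x, tilesAt P T y ⊆ tilesAt P T x := by
  have hfin := h.finite_tiles (B := Metric.ball x 1) Metric.isBounded_ball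
  have h1 : ∀ᶠ y in 𝓝 x, ∀ t ∈ {t | t ∈ T ∧ ∃ x' ∈ Metric.ball x 1, x' - t ∈ P},
      y - t ∈ P → x - t ∈ P := by
    rw [Filter.eventually_all_finite hfin]
    intro t _
    by_cases hxt : x - t ∈ P
    · exact Filter.Eventually.of_forall fun _ _ => hxt
    · have : IsOpen ((fun y => y - t) ⁻¹' Pᶜ) :=
        h.compact.isClosed.isOpen_compl.preimage (by fun_prop)
      filter_upwards [this.mem_nhds hxt] with y hy hy'
      exact absurd hy' hy
  filter_upwards [h1, Metric.ball_mem_nhds x one_pos] with y hy hyx t ht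
  exact ⟨ht.1, hy t ⟨ht.1, y, hyx, ht.2⟩ ht.2⟩

lemma cellAt_convex (h : ConvexTiling P T) (x : RSpace d) : Convex ℝ (cellAt P T x) := by
  have : cellAt P T x = ⋂ t ∈ tilesAt P T x, (t +ᵥ P) := by
    ext y; simp [cellAt, mem_vadd_iff_sub_mem]
  rw [this]
  exact convex_iInter₂ fun _ _ => h.convex.vadd _

/-- Labels that are constant on the tiles at each point of a preconnected set are constant on all
tiles that meet the set. -/
lemma const_of_isPreconnected (h : ConvexTiling P T) {K : Set (RSpace d)} (hK : IsPreconnected K)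
    {α : Type*} (f : RSpace d → α)
    (hf : ∀ x ∈ K, ∀ s ∈ tilesAt P T x, ∀ t ∈ tilesAt P T x, f s = f t)
    {x y : RSpace d} (hx : x ∈ K) (hy : y ∈ K) {s t : RSpace d} (hs : s ∈ tilesAt P T x)
    (ht : t ∈ tilesAt P T y) : f s = f t := by
  refine hK.induction₂ (fun x y => ∀ s ∈ tilesAt P T x, ∀ t ∈ tilesAt P T y, f s = f t)
    ?_ ?_ ?_ hx hy s hs t ht
  · intro x hx
    filter_upwards [nhdsWithin_le_nhds (h.eventually_tilesAt_subset x)] with y hy s hs t ht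
    exact hf x hx s hs t (hy ht)
  · intro x y z _ _ _ h1 h2 s hs t ht
    obtain ⟨r, hr⟩ := h.tilesAt_nonempty y
    exact (h1 s hs r hr).trans (h2 r hr t ht)
  · intro x y _ _ h1 s hs t ht
    exact (h1 t ht s hs).symm

end ConvexTiling

/-! ### Relative interior points -/

lemma Convex.exists_relInt {d : ℕ} {G : Set (RSpace d)} (hG : Convex ℝ G) (hne : G.Nonempty) :
    ∃ y, RelInt G y := by
  obtain ⟨y, hy⟩ := hne.intrinsicInterior hG
  refine ⟨y, intrinsicInterior_subset hy, fun z hz => ?_⟩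
  obtain ⟨y', hy', rfl⟩ := mem_intrinsicInterior.1 hy
  have hz' : z ∈ affineSpan ℝ G := subset_affineSpan ℝ G hz
  let φ : ℝ → affineSpan ℝ G := fun s =>
    ⟨s • ((y' : RSpace d) - z) + y', AffineSubspace.vadd_mem_of_mem_direction
      (Submodule.smul_mem _ _ (AffineSubspace.vsub_mem_direction y'.2 hz')) y'.2⟩
  have hφ : Continuous φ := Continuous.subtype_mk (by fun_prop) _
  have h0 : φ 0 = y' := Subtype.ext (by simp [φ])
  have : ∀ᶠ s in 𝓝 (0 : ℝ), φ s ∈ interior ((↑) ⁻¹' G : Set (affineSpan ℝ G)) :=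
    hφ.continuousAt.eventually (by rw [h0]; exact isOpen_interior.mem_nhds hy')
  obtain ⟨ε, hε, hball⟩ := Metric.eventually_nhds_iff.1 this
  refine ⟨ε / 2, by positivity, ?_⟩
  have h1 := interior_subset (hball (y := ε / 2) (by
    rw [Real.dist_eq, sub_zero, abs_of_pos (by positivity)]; linarith))
  rw [add_comm]
  exact h1

lemma RelInt.combo {d : ℕ} {G : Set (RSpace d)} (hG : Convex ℝ G) {x y : RSpace d}
    (hx : x ∈ G) (hy : RelInt G y) {δ : ℝ} (h0 : 0 < δ) (h1 : δ ≤ 1) :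
    RelInt G ((1 - δ) • x + δ • y) := by
  refine ⟨hG hx hy.1 (by linarith) h0.le (by ring), fun z hz => ?_⟩
  obtain ⟨η, hη, hw⟩ := hy.2 z hz
  -- The prolonged point is a convex combination of `x`, `y + η • (y - z)` and `y`. Weight `ε / η`
  -- on the second produces the term `-ε • z`; `ε` is chosen so that the weight left for `y` is
  -- nonnegative.
  obtain ⟨ε, hε, hle⟩ : ∃ ε : ℝ, 0 < ε ∧ ε * (1 + η) / η ≤ δ :=
    ⟨δ * η / (1 + η), by positivity, by field_simp; exact le_rfl⟩
  refine ⟨ε, hε, ?_⟩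
  have hγ : 0 ≤ (1 + ε) * δ - ε * (1 + η) / η := by nlinarith
  have hβ : 0 ≤ ε / η := by positivity
  have hα : 0 ≤ (1 + ε) * (1 - δ) := mul_nonneg (by linarith) (by linarith)
  have hsum : (1 + ε) * (1 - δ) + ε / η + ((1 + ε) * δ - ε * (1 + η) / η) = 1 := by
    field_simp; ring
  have key := hG.sum_mem (t := Finset.univ) (w := ![(1 + ε) * (1 - δ), ε / η,
      (1 + ε) * δ - ε * (1 + η) / η]) (z := ![x, y + η • (y - z), y])
    (by intro i _; fin_cases i; exacts [hα, hβ, hγ]) (by simpa [Fin.sum_univ_three] using hsum)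
    (by intro i _; fin_cases i <;> simp [hx, hw, hy.1])
  convert key using 1
  simp only [Fin.sum_univ_three, Matrix.cons_val]
  match_scalars <;> field_simp
  ring

/-- The admissible directions contain all `y - x` and are closed under sums by convexity and under
negative multiples by relative interiority. -/
lemma RelInt.exists_add_smul_mem {d : ℕ} {G : Set (RSpace d)} (hG : Convex ℝ G) {x : RSpace d}
    (hx : RelInt G x) {v : RSpace d} (hv : v ∈ vectorSpan ℝ G) :
    ∃ ε : ℝ, 0 < ε ∧ x + ε • v ∈ G := by
  rw [vectorSpan_eq_span_vsub_set_right ℝ hx.1] at hv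
  induction hv using Submodule.span_induction with
  | mem v hv =>
    obtain ⟨y, hy, rfl⟩ := hv
    exact ⟨1, one_pos, by simpa using hy⟩
  | zero => exact ⟨1, one_pos, by simpa using hx.1⟩
  | add u v _ _ hu hv =>
    obtain ⟨a, ha, hu⟩ := hu
    obtain ⟨b, hb, hv⟩ := hv
    refine ⟨a * b / (a + b), by positivity, ?_⟩
    have := hG hu hv (a := b / (a + b)) (b := a / (a + b)) (by positivity) (by positivity)
      (by field_simp; ring)
    convert this using 1
    match_scalars <;> field_simp
    ring
  | smul c v _ hv =>
    obtain ⟨a, ha, hv⟩ := hv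
    rcases lt_trichotomy c 0 with hc | rfl | hc
    · obtain ⟨η, hη, hz⟩ := hx.2 _ hv
      refine ⟨η * a / (-c), div_pos (by positivity) (by linarith), ?_⟩
      convert hz using 1
      match_scalars
      · ring
      · have := hc.ne
        field_simp
    · exact ⟨1, one_pos, by simpa using hx.1⟩
    · refine ⟨a / c, by positivity, ?_⟩
      rw [smul_smul, div_mul_cancel₀ _ hc.ne']
      exact hv

/-! ### Generic segments avoid skeleta -/

namespace ConvexTiling

variable {d : ℕ} {P T : Set (RSpace d)}

/-- A small move from `x` towards a relative interior point of its cell gains no tile by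
semicontinuity and loses none since it stays in the cell. -/
lemma exists_relInt_tilesAt_eq (h : ConvexTiling P T) (x : RSpace d) :
    ∃ y, tilesAt P T y = tilesAt P T x ∧ RelInt (cellAt P T x) y := by
  obtain ⟨y₀, hy₀⟩ := (h.cellAt_convex x).exists_relInt ⟨x, mem_cellAt_self x⟩
  have hcont : Continuous fun δ : ℝ => (1 - δ) • x + δ • y₀ := by fun_prop
  have hev : ∀ᶠ δ in 𝓝 (0 : ℝ), tilesAt P T ((1 - δ) • x + δ • y₀) ⊆ tilesAt P T x :=
    (hcont.tendsto' 0 x (by simp)).eventually (h.eventually_tilesAt_subset x)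
  obtain ⟨ε, hε, hball⟩ := Metric.eventually_nhds_iff.1 hev
  have hm : 0 < min (ε / 2) 1 := by positivity
  have hr := RelInt.combo (h.cellAt_convex x) (mem_cellAt_self x) hy₀ hm (min_le_right _ _)
  refine ⟨_, Set.Subset.antisymm (hball ?_) fun t ht => ⟨ht.1, hr.1 t ht⟩, hr⟩
  rw [Real.dist_eq, sub_zero, abs_of_pos hm]
  exact (min_le_left _ _).trans_lt (by linarith)

/-- For almost every `y`, the segments from `y` to the points of a set of small dimension that
avoids a skeleton also avoid this skeleton. -/
lemma ae_segment_notMem_skel (h : ConvexTiling P T) {K : Set (RSpace d)} {k : ℕ}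
    (hK : finrank ℝ (vectorSpan ℝ K) + 1 < k) (hdis : ∀ q ∈ K, q ∉ skel P T k) :
    ∀ᵐ y : RSpace d, ∀ q ∈ K, ∀ z ∈ segment ℝ q y, z ∉ skel P T k := by
  rcases K.eq_empty_or_nonempty with rfl | ⟨q₀, hq₀⟩
  · simp
  have hcount := Set.countable_ofPred_finite_subset h.countable
  have key : ∀ᵐ y : RSpace d, ∀ τ ∈ {τ : Set (RSpace d) | τ.Finite ∧ τ ⊆ T},
      finrank ℝ (vectorSpan ℝ {x : RSpace d | ∀ t ∈ τ, x - t ∈ P}) + k ≤ d →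
      ∀ q ∈ K, ∀ z ∈ segment ℝ q y, (∀ t ∈ τ, z - t ∈ P) → z = q := by
    rw [ae_ball_iff hcount]
    intro τ _
    set D := {x : RSpace d | ∀ t ∈ τ, x - t ∈ P} with hD
    by_cases hdim : finrank ℝ (vectorSpan ℝ D) + k ≤ d
    swap
    · exact Filter.Eventually.of_forall fun _ h => absurd h hdim
    rcases D.eq_empty_or_nonempty with hDe | ⟨a₀, ha₀⟩
    · refine Filter.Eventually.of_forall fun y _ q _ z _ hz => ?_
      have : z ∈ D := hz
      rw [hDe] at this
      exact absurd this (Set.notMem_empty _)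
    -- A segment from `K` to `y` that meets `D` away from its starting point puts `y` into the
    -- affine subspace `q₀ + W`. Its dimension is at most `(d - k) + dim K + 1 < d`, so it is a null
    -- set, and only countably many `τ` occur.
    set W := vectorSpan ℝ D ⊔ vectorSpan ℝ K ⊔ Submodule.span ℝ {a₀ - q₀} with hW
    have hWdim : finrank ℝ W < d := by
      have h1 := Submodule.finrank_add_le_finrank_add_finrank (vectorSpan ℝ D ⊔ vectorSpan ℝ K)
        (Submodule.span ℝ {a₀ - q₀})
      have h2 := Submodule.finrank_add_le_finrank_add_finrank (vectorSpan ℝ D) (vectorSpan ℝ K)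
      have h3 : finrank ℝ (Submodule.span ℝ {a₀ - q₀}) ≤ 1 := by
        simpa using finrank_span_le_card (R := ℝ) ({a₀ - q₀} : Set (RSpace d))
      rw [hW]
      omega
    have hA : AffineSubspace.mk' q₀ W ≠ ⊤ := by
      intro hA
      have : W = ⊤ := by rw [← AffineSubspace.direction_mk' q₀ W, hA, AffineSubspace.direction_top]
      rw [this, finrank_top, finrank_euclideanSpace_fin] at hWdim
      exact lt_irrefl _ hWdim
    have hnull := Measure.addHaar_affineSubspace (volume : Measure (RSpace d)) _ hA
    filter_upwards [measure_eq_zero_iff_ae_notMem.1 hnull] with y hy _ q hq z hz hzD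
    obtain ⟨a, b, ha, hb, hab, rfl⟩ := hz
    rcases hb.eq_or_lt with rfl | hb
    · rw [show a = 1 by linarith]; simp
    refine absurd ?_ hy
    rw [SetLike.mem_coe, AffineSubspace.mem_mk', vsub_eq_sub]
    have e1 : a • q + b • y - a₀ ∈ W :=
      Submodule.mem_sup_left (Submodule.mem_sup_left (vsub_mem_vectorSpan ℝ hzD ha₀))
    have e2 : q - q₀ ∈ W :=
      Submodule.mem_sup_left (Submodule.mem_sup_right (vsub_mem_vectorSpan ℝ hq hq₀))
    have e3 : a₀ - q₀ ∈ W := Submodule.mem_sup_right (Submodule.mem_span_singleton_self _)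
    have : y - q₀ = (1 - b⁻¹) • (q - q₀) + b⁻¹ • ((a • q + b • y - a₀) + (a₀ - q₀)) := by
      rw [show a = 1 - b by linarith]
      match_scalars <;> field_simp <;> ring
    rw [this]
    exact W.add_mem (W.smul_mem _ e2) (W.smul_mem _ (W.add_mem e1 e3))
  filter_upwards [key] with y hy q hq z hz hzs
  have := hy (tilesAt P T z) ⟨h.tilesAt_finite z, fun t ht => ht.1⟩ hzs q hq z hz
    fun t ht => ht.2
  rw [this] at hzs
  exact hdis q hq hzs

end ConvexTiling

/-! ### Contacts and facet normals -/

/-- The common part of `P` and `v + P`. -/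
def contact {d : ℕ} (P : Set (RSpace d)) (v : RSpace d) : Set (RSpace d) :=
  {x | x ∈ P ∧ x - v ∈ P}

/-- `v + P` touches `P` along a set of codimension one. -/
def IsNbr {d : ℕ} (P : Set (RSpace d)) (v : RSpace d) : Prop :=
  (contact P v).Nonempty ∧ finrank ℝ (vectorSpan ℝ (contact P v)) + 1 = d

/-- `l` is a normal to the common facet of `P` and `v + P`, directed from `P` to `v + P`. -/
structure IsNormal {d : ℕ} (P : Set (RSpace d)) (v : RSpace d)
    (l : StrongDual ℝ (RSpace d)) : Prop where
  ne_zero : l ≠ 0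
  ker : vectorSpan ℝ (contact P v) = LinearMap.ker l.toLinearMap
  isMax : ∀ x, x ∈ contact P v ↔ x ∈ P ∧ ∀ y ∈ P, l y ≤ l x
  isMin : ∀ x, x ∈ contact P v ↔ x - v ∈ P ∧ ∀ y ∈ P, l (x - v) ≤ l y

section

variable {d : ℕ} {P T : Set (RSpace d)}

lemma inter_vadd_eq_contact (v : RSpace d) : P ∩ (v +ᵥ P) = contact P v := by
  ext x
  simp only [contact, Set.mem_inter_iff, mem_vadd_iff_sub_mem, Set.mem_ofPred_eq]

lemma mem_contact_neg {v x : RSpace d} : x ∈ contact P (-v) ↔ x + v ∈ contact P v := by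
  simp [contact, and_comm]

lemma vectorSpan_preimage_add (S : Set (RSpace d)) (v : RSpace d) :
    vectorSpan ℝ {x | x + v ∈ S} = vectorSpan ℝ S := by
  rw [vectorSpan_def, vectorSpan_def]
  congr 1
  ext z
  constructor
  · rintro ⟨a, ha, b, hb, rfl⟩
    exact ⟨a + v, ha, b + v, hb, by simp⟩
  · rintro ⟨a, ha, b, hb, rfl⟩
    exact ⟨a - v, by simpa using ha, b - v, by simpa using hb, by simp⟩

lemma vectorSpan_contact_neg (v : RSpace d) :
    vectorSpan ℝ (contact P (-v)) = vectorSpan ℝ (contact P v) := by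
  rw [← vectorSpan_preimage_add (contact P v) v]
  congr 1
  ext x
  exact mem_contact_neg

lemma IsNbr.neg {v : RSpace d} (h : IsNbr P v) : IsNbr P (-v) := by
  refine ⟨?_, by rw [vectorSpan_contact_neg]; exact h.2⟩
  obtain ⟨x, hx⟩ := h.1
  exact ⟨x - v, mem_contact_neg.2 (by simpa using hx)⟩

lemma IsNormal.neg {v : RSpace d} {l : StrongDual ℝ (RSpace d)} (h : IsNormal P v l) :
    IsNormal P (-v) (-l) := by
  refine ⟨neg_ne_zero.2 h.ne_zero, ?_, fun x => ?_, fun x => ?_⟩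
  · rw [vectorSpan_contact_neg, h.ker]
    ext x; simp
  · rw [mem_contact_neg, h.isMin]; simp
  · rw [mem_contact_neg, h.isMax]; simp

lemma finrank_ker_add_one {l : StrongDual ℝ (RSpace d)} (hl : l ≠ 0) :
    finrank ℝ (LinearMap.ker l.toLinearMap) + 1 = d := by
  have := Module.Dual.finrank_ker_add_one_of_ne_zero (f := l.toLinearMap)
    (fun h => hl (ContinuousLinearMap.coe_injective h))
  rwa [finrank_euclideanSpace_fin] at this

lemma exists_eq_smul_of_ker_le {l l' : StrongDual ℝ (RSpace d)} (hl : l ≠ 0)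
    (h : LinearMap.ker l.toLinearMap ≤ LinearMap.ker l'.toLinearMap) : ∃ κ : ℝ, l' = κ • l := by
  obtain ⟨e, he⟩ : ∃ e, l e ≠ 0 := by
    by_contra! hc
    exact hl (ContinuousLinearMap.ext hc)
  refine ⟨l' e / l e, ContinuousLinearMap.ext fun x => ?_⟩
  have : x - (l x / l e) • e ∈ LinearMap.ker l'.toLinearMap :=
    h (by simp [LinearMap.mem_ker, he])
  simp only [LinearMap.mem_ker, ContinuousLinearMap.coe_coe, map_sub, map_smul, smul_eq_mul] at this
  simp only [smul_apply, smul_eq_mul]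
  field_simp at this ⊢
  linarith

/-- Iterating a nonzero translation leaves every bounded set. This is how two neighbours or two
centres of symmetry are identified. -/
lemma eq_zero_of_add_mem {S : Set (RSpace d)} (hS : Bornology.IsBounded S) (hne : S.Nonempty)
    {w : RSpace d} (h : ∀ y ∈ S, y + w ∈ S) : w = 0 := by
  obtain ⟨y, hy⟩ := hne
  have hn : ∀ n : ℕ, y + (n : ℝ) • w ∈ S := by
    intro n
    induction n with
    | zero => simpa using hy
    | succ n ih =>
      have := h _ ih
      rw [Nat.cast_add_one, add_smul, one_smul, ← add_assoc]
      exact this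
  obtain ⟨C, hC⟩ := Metric.isBounded_iff.1 hS
  by_contra hw
  have hw' : 0 < ‖w‖ := norm_pos_iff.2 hw
  obtain ⟨n, hn'⟩ := exists_nat_gt (C / ‖w‖)
  have := hC (hn n) hy
  rw [dist_eq_norm, add_sub_cancel_left, norm_smul, Real.norm_natCast] at this
  rw [div_lt_iff₀ hw'] at hn'
  linarith

end

namespace ConvexTiling

variable {d : ℕ} {P T : Set (RSpace d)}

lemma exists_lt (h : ConvexTiling P T) {l : StrongDual ℝ (RSpace d)} (hl : l ≠ 0) :
    ∃ y ∈ P, ∃ z ∈ P, l y < l z := by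
  obtain ⟨e, he⟩ : ∃ e, 0 < l e := by
    by_contra! hc
    refine hl (ContinuousLinearMap.ext fun x => le_antisymm (hc x) ?_)
    simpa using hc (-x)
  obtain ⟨c, hc⟩ := h.int_nonempty
  have hcont : Continuous fun s : ℝ => c + s • e := by fun_prop
  have := (hcont.tendsto' 0 c (by simp)).eventually (isOpen_interior.mem_nhds hc)
  obtain ⟨ε, hε, hball⟩ := Metric.eventually_nhds_iff.1 this
  have h1 := hball (y := ε / 2) (by
    rw [Real.dist_eq, sub_zero, abs_of_pos (by positivity)]; linarith)
  refine ⟨c, interior_subset hc, _, interior_subset h1, ?_⟩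
  have : 0 < ε / 2 * l e := by positivity
  simpa using this

lemma exists_separating (h : ConvexTiling P T) {s v : RSpace d} (hs : s ∈ T) (hv : s + v ∈ T)
    (hne : v ≠ 0) : ∃ (f : StrongDual ℝ (RSpace d)) (u : ℝ), f ≠ 0 ∧ (∀ x ∈ P, f x ≤ u) ∧
      ∀ x, x - v ∈ P → u ≤ f x := by
  have hdis : Disjoint (interior P) (v +ᵥ P) := by
    rw [Set.disjoint_left]
    intro x hx hxv
    rw [mem_vadd_iff_sub_mem] at hxv
    refine hne ?_
    have := h.eq_of_mem_interior (x := x + s) hs hv (by simpa using hx)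
      (by rwa [show x + s - (s + v) = x - v by abel])
    simpa using this
  obtain ⟨f, u, h1, h2⟩ := geometric_hahn_banach_open h.convex.interior isOpen_interior
    (h.convex.vadd v) hdis
  have hle : ∀ x ∈ P, f x ≤ u := by
    intro x hx
    rw [← h.closure_interior] at hx
    exact closure_minimal (fun y hy => (h1 y hy).le)
      (isClosed_le f.continuous continuous_const) hx
  refine ⟨f, u, ?_, hle, fun x hx => h2 x (mem_vadd_iff_sub_mem.2 hx)⟩
  rintro rfl
  obtain ⟨c, hc⟩ := h.int_nonempty
  have h3 := h1 c hc
  have h4 := h2 (c + v) (mem_vadd_iff_sub_mem.2 (by simpa using interior_subset hc))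
  simp only [zero_apply] at h3 h4
  linarith

lemma vectorSpan_contact_le (f : StrongDual ℝ (RSpace d)) {u : ℝ} {v : RSpace d}
    (h1 : ∀ x ∈ P, f x ≤ u) (h2 : ∀ x, x - v ∈ P → u ≤ f x) :
    vectorSpan ℝ (contact P v) ≤ LinearMap.ker f.toLinearMap := by
  rw [vectorSpan_def, Submodule.span_le]
  rintro _ ⟨a, ha, b, hb, rfl⟩
  have e1 := le_antisymm (h1 a ha.1) (h2 a ha.2)
  have e2 := le_antisymm (h1 b hb.1) (h2 b hb.2)
  simp [LinearMap.mem_ker, e1, e2]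

lemma isNbr_ne_zero (h : ConvexTiling P T) {v : RSpace d} (hv : IsNbr P v) : v ≠ 0 := by
  rintro rfl
  have h2 := hv.2
  have : contact P 0 = P := by ext x; simp [contact]
  rw [this] at h2
  have h3 := (h.convex.interior_nonempty_iff_affineSpan_eq_top).1 h.int_nonempty
  have h4 : vectorSpan ℝ P = ⊤ := by
    rw [← direction_affineSpan, h3, AffineSubspace.direction_top]
  rw [h4, finrank_top, finrank_euclideanSpace_fin] at h2
  omega

/-- Face-to-face gives some exposing functional `l`, separation gives `f`. Both are constant on a
set spanning the hyperplane `ker f`, so `l = κ • f`; if `κ ≤ 0`, points with a smaller value of `f`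
would belong to the contact too. -/
lemma mem_contact_iff_isMax (h : ConvexTiling P T) {s v : RSpace d} (hs : s ∈ T) (hvT : s + v ∈ T)
    (hv : (contact P v).Nonempty) (f : StrongDual ℝ (RSpace d)) {u : ℝ} (hf : f ≠ 0)
    (h1 : ∀ x ∈ P, f x ≤ u) (h2 : ∀ x ∈ contact P v, f x = u)
    (hker : LinearMap.ker f.toLinearMap ≤ vectorSpan ℝ (contact P v)) (x : RSpace d) :
    x ∈ contact P v ↔ x ∈ P ∧ ∀ y ∈ P, f y ≤ f x := by
  obtain ⟨w, hw⟩ := hv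
  obtain ⟨l, hl⟩ := h.exists_face (w := w + s) hs hvT (by simpa using hw.1)
    (by rw [show w + s - (s + v) = w - v by abel]; exact hw.2)
  have hl' : ∀ x, x ∈ contact P v ↔ x ∈ P ∧ ∀ y ∈ P, l y ≤ l x := by
    intro x
    have := hl (x + s)
    rw [add_sub_cancel_right, show x + s - (s + v) = x - v by abel] at this
    rw [contact, Set.mem_ofPred_eq, this]
    refine and_congr_right fun _ => ⟨fun hx y hy => ?_, fun hx y hy => ?_⟩
    · simpa using hx (y + s) (by simpa using hy)
    · simpa using hx (y - s) hy
  have hkl : vectorSpan ℝ (contact P v) ≤ LinearMap.ker l.toLinearMap := by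
    rw [vectorSpan_def, Submodule.span_le]
    rintro _ ⟨a, ha, b, hb, rfl⟩
    have e1 := ((hl' a).1 ha).2 b hb.1
    have e2 := ((hl' b).1 hb).2 a ha.1
    simp [LinearMap.mem_ker, le_antisymm e1 e2]
  obtain ⟨κ, rfl⟩ := exists_eq_smul_of_ker_le hf (hker.trans hkl)
  obtain ⟨y, hy, z, hz, hyz⟩ := h.exists_lt hf
  have hlt : f y < u := hyz.trans_le (h1 z hz)
  have hκ : 0 < κ := by
    by_contra! hκ
    have e1 := ((hl' w).1 hw).2
    have e2 : y ∈ contact P v := (hl' y).2 ⟨hy, fun p hp => (e1 p hp).trans (by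
      simp only [smul_apply, smul_eq_mul, h2 w hw]
      nlinarith)⟩
    exact hlt.ne (h2 y e2)
  rw [hl']
  simp [hκ]

lemma exists_isNormal (h : ConvexTiling P T) {s v : RSpace d} (hs : s ∈ T) (hvT : s + v ∈ T)
    (hv : IsNbr P v) : ∃ l, IsNormal P v l := by
  obtain ⟨f, u, hf, h1, h2⟩ := h.exists_separating hs hvT (h.isNbr_ne_zero hv)
  have hle := vectorSpan_contact_le f h1 h2
  have heq : vectorSpan ℝ (contact P v) = LinearMap.ker f.toLinearMap :=
    Submodule.eq_of_le_of_finrank_eq hle (by have := finrank_ker_add_one hf; have := hv.2; omega)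
  have hu : ∀ x ∈ contact P v, f x = u := fun x hx => le_antisymm (h1 x hx.1) (h2 x hx.2)
  refine ⟨f, hf, heq, h.mem_contact_iff_isMax hs hvT hv.1 f hf h1 hu heq.ge, fun x => ?_⟩
  -- Minimality on the far side is maximality for the reversed pair: `P` seen from `v + P`, with
  -- normal `-f`.
  have := h.mem_contact_iff_isMax (v := -v) hvT (by simpa using hs) hv.neg.1 (-f)
    (u := -u + f v) (neg_ne_zero.2 hf) (fun x hx => ?_) (fun x hx => ?_) ?_ (x - v)
  · rw [mem_contact_neg, sub_add_cancel] at this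
    rw [this]
    simp only [neg_apply, neg_le_neg_iff]
  · have := h2 (x + v) (by simpa using hx)
    simp only [neg_apply, map_add] at this ⊢
    linarith
  · have := hu _ (mem_contact_neg.1 hx)
    simp only [neg_apply, map_add] at this ⊢
    linarith
  · rw [vectorSpan_contact_neg, heq]
    intro x; simp

end ConvexTiling

section

variable {d : ℕ} {P T : Set (RSpace d)}

/-- The normal determines the contact, as its maximal face, and its minimal face `M`. The contact
equals both `v + M` and `v' + M`, so the bounded set `M` is invariant under `v - v'`. -/
lemma IsNormal.eq_of_pos_smul (h : ConvexTiling P T) {v v' : RSpace d}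
    {l : StrongDual ℝ (RSpace d)} {κ : ℝ} (hκ : 0 < κ) (hl : IsNormal P v l)
    (hl' : IsNormal P v' (κ • l)) (hne : (contact P v).Nonempty) : v = v' := by
  have hc : contact P v = contact P v' := by
    ext x
    rw [hl.isMax, hl'.isMax]
    simp [hκ]
  have hmin : ∀ x, x - v ∈ P ∧ (∀ y ∈ P, l (x - v) ≤ l y) ↔
      x - v' ∈ P ∧ (∀ y ∈ P, l (x - v') ≤ l y) := by
    intro x
    rw [← hl.isMin, hc, hl'.isMin]
    simp [hκ]
  have := eq_zero_of_add_mem (S := {y | y ∈ P ∧ ∀ z ∈ P, l y ≤ l z}) (w := v - v')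
    (h.compact.isBounded.subset fun y hy => hy.1) ?_ ?_
  · exact sub_eq_zero.1 this
  · obtain ⟨x, hx⟩ := hne
    exact ⟨x - v, (hl.isMin x).1 hx⟩
  · intro y hy
    have := (hmin (y + v)).1 (by simpa using hy)
    rwa [add_sub_assoc] at this

/-- Neighbouring tiles along parallel facets that share a point are the same. -/
lemma IsNormal.eq_of_ker_eq (h : ConvexTiling P T) {v v' x : RSpace d}
    {l l' : StrongDual ℝ (RSpace d)} (hl : IsNormal P v l) (hl' : IsNormal P v' l')
    (hker : LinearMap.ker l.toLinearMap ≤ LinearMap.ker l'.toLinearMap)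
    (hx : x ∈ contact P v) (hx' : x ∈ contact P v') : v = v' := by
  obtain ⟨κ, rfl⟩ := exists_eq_smul_of_ker_le hl.ne_zero hker
  refine IsNormal.eq_of_pos_smul h ?_ hl hl' ⟨x, hx⟩
  by_contra! hκ
  have hκ' : κ < 0 := lt_of_le_of_ne hκ fun h0 => hl'.ne_zero (by simp [h0])
  obtain ⟨y, hy, z, hz, hyz⟩ := h.exists_lt hl.ne_zero
  have e1 := ((hl.isMax x).1 hx).2 z hz
  have e2 := ((hl'.isMax x).1 hx').2 y hy
  simp only [smul_apply, smul_eq_mul] at e2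
  nlinarith

lemma IsFacet.exists_normal (h : ConvexTiling P T) {F : Set (RSpace d)} (hF : IsFacet P F) :
    ∃ l : StrongDual ℝ (RSpace d), l ≠ 0 ∧ vectorSpan ℝ F = LinearMap.ker l.toLinearMap ∧
      ∀ x, x ∈ F ↔ x ∈ P ∧ ∀ y ∈ P, l y ≤ l x := by
  obtain ⟨hexp, hne, hdim⟩ := hF
  obtain ⟨l, hl⟩ := hexp hne
  have hl' : ∀ x, x ∈ F ↔ x ∈ P ∧ ∀ y ∈ P, l y ≤ l x := fun x => Set.ext_iff.1 hl x
  have hl0 : l ≠ 0 := by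
    rintro rfl
    have : F = P := by ext x; simp [hl']
    rw [this] at hdim
    have h3 := (h.convex.interior_nonempty_iff_affineSpan_eq_top).1 h.int_nonempty
    have h4 : vectorSpan ℝ P = ⊤ := by
      rw [← direction_affineSpan, h3, AffineSubspace.direction_top]
    rw [h4, finrank_top, finrank_euclideanSpace_fin] at hdim
    omega
  refine ⟨l, hl0, Submodule.eq_of_le_of_finrank_eq ?_ ?_, hl'⟩
  · rw [vectorSpan_def, Submodule.span_le]
    rintro _ ⟨a, ha, b, hb, rfl⟩
    have e1 := ((hl' a).1 ha).2 b ((hl' b).1 hb).1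
    have e2 := ((hl' b).1 hb).2 a ((hl' a).1 ha).1
    simp [LinearMap.mem_ker, le_antisymm e1 e2]
  · have := finrank_ker_add_one hl0; omega

lemma IsNbr.isFacet {v : RSpace d} {l : StrongDual ℝ (RSpace d)} (hv : IsNbr P v)
    (hl : IsNormal P v l) : IsFacet P (contact P v) :=
  ⟨fun _ => ⟨l, Set.ext hl.isMax⟩, hv.1, hv.2⟩

/-- Along each facet of each tile there is a neighbouring tile. -/
lemma IsFacet.exists_nbr (h : ConvexTiling P T) {F : Set (RSpace d)} (hF : IsFacet P F)
    {s : RSpace d} (hs : s ∈ T) : ∃ v, s + v ∈ T ∧ IsNbr P v ∧ contact P v = F := by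
  obtain ⟨l, hl0, hker, hl⟩ := hF.exists_normal h
  have hconv : Convex ℝ F := hF.1.convex h.convex
  obtain ⟨x, hx⟩ := hconv.exists_relInt hF.2.1
  obtain ⟨e, he⟩ : ∃ e, 0 < l e := by
    by_contra! hc
    refine hl0 (ContinuousLinearMap.ext fun x => le_antisymm (hc x) ?_)
    simpa using hc (-x)
  -- Step out of `s + P` through a relative interior point of the facet. A tile found just outside
  -- still contains that point, hence the whole facet, and is not `s + P` because `l` exceeds its
  -- maximum there.
  have hcont : Continuous fun r : ℝ => s + x + r • e := by fun_prop
  have := (hcont.tendsto' 0 (s + x) (by simp)).eventually (h.eventually_tilesAt_subset (s + x))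
  obtain ⟨ε, hε, hball⟩ := Metric.eventually_nhds_iff.1 this
  have h1 := hball (y := ε / 2) (by
    rw [Real.dist_eq, sub_zero, abs_of_pos (by positivity)]; linarith)
  obtain ⟨t, htT, ht⟩ := h.exists_mem (s + x + (ε / 2) • e)
  have hxt : s + x - t ∈ P := (h1 ⟨htT, ht⟩).2
  have hst : t - s ≠ 0 := by
    intro h0
    rw [sub_eq_zero] at h0
    subst h0
    have := ((hl x).1 hx.1).2 _ ht
    have h2 : 0 < ε / 2 * l e := by positivity
    simp only [map_sub, map_add, map_smul, smul_eq_mul] at this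
    linarith
  have hst' : s + (t - s) ∈ T := by simpa using htT
  have hsub : F ⊆ contact P (t - s) := by
    intro y hy
    refine ⟨((hl y).1 hy).1, ?_⟩
    have := h.mem_of_relInt (G := {z | z - s ∈ F}) (x := s + x) (y := s + y) hs htT
      (fun z hz => ((hl _).1 hz).1) ⟨by simpa using hx.1, fun z hz => ?_⟩ hxt (by simpa using hy)
    · convert this using 1; abel
    · obtain ⟨η, hη, hz'⟩ := hx.2 _ hz
      refine ⟨η, hη, ?_⟩
      simp only [Set.mem_ofPred_eq]
      convert hz' using 1
      rw [show s + x - z = x - (z - s) by abel]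
      abel
  obtain ⟨f, u, hf, hf1, hf2⟩ := h.exists_separating hs hst' hst
  have hle := Submodule.finrank_mono (ConvexTiling.vectorSpan_contact_le f hf1 hf2)
  have hge := Submodule.finrank_mono (vectorSpan_mono ℝ hsub)
  have hk := finrank_ker_add_one hf
  have hd := hF.2.2
  have hnbr : IsNbr P (t - s) := ⟨⟨x, hsub hx.1⟩, by omega⟩
  refine ⟨t - s, hst', hnbr, ?_⟩
  obtain ⟨l', hl'⟩ := h.exists_isNormal hs hst' hnbr
  have hkk : LinearMap.ker l'.toLinearMap = LinearMap.ker l.toLinearMap := by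
    rw [← hker, ← hl'.ker]
    exact (Submodule.eq_of_le_of_finrank_eq (vectorSpan_mono ℝ hsub) (by omega)).symm
  obtain ⟨κ, rfl⟩ := exists_eq_smul_of_ker_le hl0 hkk.ge
  have hκ : 0 < κ := by
    by_contra! hκ
    have hκ' : κ < 0 := lt_of_le_of_ne hκ fun h0 => hl'.ne_zero (by simp [h0])
    obtain ⟨y, hy, z, hz, hyz⟩ := h.exists_lt hl0
    have e1 := ((hl x).1 hx.1).2 z hz
    have e2 := ((hl'.isMax x).1 (hsub hx.1)).2 y hy
    simp only [smul_apply, smul_eq_mul] at e2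
    nlinarith
  ext y
  rw [hl'.isMax, hl]
  simp [hκ]

end

namespace ConvexTiling

variable {d : ℕ} {P T : Set (RSpace d)}

/-- The neighbour of `r + P` across the same facet has a parallel normal and the same contact, so it
has the same facet vector: adjacency looks alike at every tile. -/
lemma add_mem_of_isNbr (h : ConvexTiling P T) {s v r : RSpace d} (hs : s ∈ T) (hvT : s + v ∈ T)
    (hv : IsNbr P v) (hr : r ∈ T) : r + v ∈ T := by
  obtain ⟨l, hl⟩ := h.exists_isNormal hs hvT hv
  obtain ⟨v', hv'T, hv', hc⟩ := (hv.isFacet hl).exists_nbr h hr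
  obtain ⟨l', hl'⟩ := h.exists_isNormal hr hv'T hv'
  obtain ⟨x, hx⟩ := hv.1
  have : v = v' := hl.eq_of_ker_eq h hl' (by rw [← hl.ker, ← hl'.ker, hc]) hx (hc ▸ hx)
  rwa [this]

end ConvexTiling

/-! ### Connectivity through facets and the translation group -/

namespace ConvexTiling

variable {d : ℕ} {P T : Set (RSpace d)}

lemma vectorSpan_cellAt_le {x s t : RSpace d} (hs : s ∈ tilesAt P T x) (ht : t ∈ tilesAt P T x) :
    vectorSpan ℝ (cellAt P T x) ≤ vectorSpan ℝ (contact P (t - s)) := by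
  rw [← vectorSpan_preimage_add (contact P (t - s)) (-s)]
  refine vectorSpan_mono ℝ fun y hy => ⟨?_, ?_⟩
  · simpa [← sub_eq_add_neg] using hy s hs
  · rw [show y + -s - (t - s) = y - t by abel]
    exact hy t ht

lemma finrank_contact_lt (h : ConvexTiling P T) {s t : RSpace d} (hs : s ∈ T) (ht : t ∈ T)
    (hst : s ≠ t) : finrank ℝ (vectorSpan ℝ (contact P (t - s))) + 1 ≤ d := by
  obtain ⟨f, u, hf, hf1, hf2⟩ := h.exists_separating (v := t - s) hs (by simpa using ht)
    (sub_ne_zero.2 hst.symm)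
  have hle := Submodule.finrank_mono (vectorSpan_contact_le f hf1 hf2)
  have hk := finrank_ker_add_one hf
  omega

lemma mem_contact_of_mem_tilesAt {x s t : RSpace d} (hs : s ∈ tilesAt P T x)
    (ht : t ∈ tilesAt P T x) : x - s ∈ contact P (t - s) :=
  ⟨hs.2, by simpa using ht.2⟩

lemma isNbr_of_notMem_skel (h : ConvexTiling P T) {x s t : RSpace d} (hx : x ∉ skel P T 2)
    (hs : s ∈ tilesAt P T x) (ht : t ∈ tilesAt P T x) (hst : s ≠ t) : IsNbr P (t - s) := by
  refine ⟨⟨_, mem_contact_of_mem_tilesAt hs ht⟩, ?_⟩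
  have h1 := Submodule.finrank_mono (vectorSpan_cellAt_le hs ht)
  have h2 := h.finrank_contact_lt hs.1 ht.1 hst
  have h3 : ¬ finrank ℝ (vectorSpan ℝ (cellAt P T x)) + 2 ≤ d := hx
  omega

lemma tilesAt_of_mem_interior (h : ConvexTiling P T) {x s : RSpace d} (hs : s ∈ T)
    (hx : x - s ∈ interior P) : tilesAt P T x = {s} := by
  ext t
  refine ⟨fun ht => (h.eq_of_mem_interior hs ht.1 hx ht.2).symm, ?_⟩
  rintro rfl
  exact ⟨hs, interior_subset hx⟩

lemma vectorSpan_eq_top (h : ConvexTiling P T) : vectorSpan ℝ P = ⊤ := by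
  rw [← direction_affineSpan, (h.convex.interior_nonempty_iff_affineSpan_eq_top).1 h.int_nonempty,
    AffineSubspace.direction_top]

lemma notMem_skel_of_mem_interior (h : ConvexTiling P T) {x s : RSpace d} (hs : s ∈ T)
    (hx : x - s ∈ interior P) {k : ℕ} (hk : 0 < k) : x ∉ skel P T k := by
  have : cellAt P T x = {y | y + -s ∈ P} := by
    ext y
    simp [cellAt, h.tilesAt_of_mem_interior hs hx, sub_eq_add_neg]
  rw [skel, Set.mem_ofPred_eq, this, vectorSpan_preimage_add, h.vectorSpan_eq_top, finrank_top,
    finrank_euclideanSpace_fin]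
  omega

lemma isOpen_interior_tile (s : RSpace d) : IsOpen {x | x - s ∈ interior P} :=
  isOpen_interior.preimage (by fun_prop : Continuous fun x : RSpace d => x - s)

lemma exists_mem_interior_of_isOpen (h : ConvexTiling P T) {x s : RSpace d} (hx : x - s ∈ P)
    {U : Set (RSpace d)} (hU : IsOpen U) (hxU : x ∈ U) : ∃ y ∈ U, y - s ∈ interior P := by
  rw [← h.closure_interior, mem_closure_iff] at hx
  obtain ⟨z, hz1, hz2⟩ := hx ((fun z => z + s) ⁻¹' U) (hU.preimage (by fun_prop)) (by simpa)
  exact ⟨z + s, hz1, by simpa using hz2⟩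

/-- The tiles at a point are connected by adjacency along facets. -/
lemma const_on_tilesAt (h : ConvexTiling P T) (x : RSpace d) {α : Type*} (f : RSpace d → α)
    (hf : ∀ s ∈ tilesAt P T x, ∀ t ∈ tilesAt P T x, IsNbr P (t - s) → f s = f t)
    {s t : RSpace d} (hs : s ∈ tilesAt P T x) (ht : t ∈ tilesAt P T x) : f s = f t := by
  obtain ⟨ε, hε, hball⟩ := Metric.eventually_nhds_iff_ball.1 (h.eventually_tilesAt_subset x)
  obtain ⟨y, hyU, hy⟩ := h.exists_mem_interior_of_isOpen hs.2 Metric.isOpen_ball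
    (Metric.mem_ball_self hε)
  obtain ⟨z', hz'U, hz'⟩ := h.exists_mem_interior_of_isOpen ht.2 Metric.isOpen_ball
    (Metric.mem_ball_self hε)
  -- A generic segment between interior points of the two tiles, close to `x`, avoids codimension
  -- two; it changes tiles only across facets, and all tiles it meets contain `x`.
  have hae := h.ae_segment_notMem_skel (K := {y}) (k := 2) (by simp)
    (by rintro q rfl; exact h.notMem_skel_of_mem_interior hs.1 hy two_pos)
  obtain ⟨z, hz, hzP⟩ := (Measure.dense_of_ae hae).exists_mem_open
    (Metric.isOpen_ball.inter (isOpen_interior_tile (P := P) t)) ⟨z', hz'U, hz'⟩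
  refine h.const_of_isPreconnected (convex_segment y z).isPreconnected f ?_
    (left_mem_segment ℝ y z) (right_mem_segment ℝ y z) (s := s) (t := t)
    ⟨hs.1, interior_subset hy⟩ ⟨ht.1, interior_subset hzP.2⟩
  intro w hw a ha b hb
  have hwx := hball w ((convex_ball x ε).segment_subset hyU hzP.1 hw)
  rcases eq_or_ne a b with rfl | hab
  · rfl
  · exact hf a (hwx ha) b (hwx hb) (h.isNbr_of_notMem_skel (hz y rfl w hw) ha hb hab)

lemma const_on_tiles (h : ConvexTiling P T) {K : Set (RSpace d)} (hK : IsPreconnected K)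
    {α : Type*} (f : RSpace d → α)
    (hf : ∀ x ∈ K, ∀ s ∈ tilesAt P T x, ∀ t ∈ tilesAt P T x, IsNbr P (t - s) → f s = f t)
    {x y : RSpace d} (hx : x ∈ K) (hy : y ∈ K) {s t : RSpace d} (hs : s ∈ tilesAt P T x)
    (ht : t ∈ tilesAt P T y) : f s = f t :=
  h.const_of_isPreconnected hK f
    (fun x hx _ hs _ ht => h.const_on_tilesAt x f (hf x hx) hs ht) hx hy hs ht

lemma const_of_isNbr (h : ConvexTiling P T) {α : Type*} (f : RSpace d → α)
    (hf : ∀ s ∈ T, ∀ t ∈ T, IsNbr P (t - s) → f s = f t) {s t : RSpace d} (hs : s ∈ T)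
    (ht : t ∈ T) : f s = f t := by
  obtain ⟨c, hc⟩ := h.int_nonempty
  have hc' := interior_subset hc
  exact h.const_on_tiles isPreconnected_univ f (fun x _ s hs t ht => hf s hs.1 t ht.1)
    (Set.mem_univ (c + s)) (Set.mem_univ (c + t)) ⟨hs, by simpa⟩ ⟨ht, by simpa⟩

/-- Whether translation by `t` preserves `T` does not change when `t` passes to a neighbour, and it
does for `t = 0`. -/
lemma add_mem (h : ConvexTiling P T) (h0 : (0 : RSpace d) ∈ T) {r t : RSpace d} (hr : r ∈ T)
    (ht : t ∈ T) : r + t ∈ T := by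
  have := h.const_of_isNbr (fun t => ∀ r ∈ T, r + t ∈ T) (fun s hs t ht hst => ?_) h0 ht
  · exact (this ▸ (fun r hr => by simpa using hr) : ∀ r ∈ T, r + t ∈ T) r hr
  · refine propext ⟨fun hQ r hr => ?_, fun hQ r hr => ?_⟩
    · have := h.add_mem_of_isNbr hs (by simpa using ht) hst (hQ r hr)
      rwa [show r + s + (t - s) = r + t by abel] at this
    · have := h.add_mem_of_isNbr ht (by simpa using hs) hst.neg (hQ r hr)
      rwa [show r + t + -(t - s) = r + s by abel] at this

lemma sub_mem (h : ConvexTiling P T) (h0 : (0 : RSpace d) ∈ T) {r t : RSpace d} (hr : r ∈ T)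
    (ht : t ∈ T) : r - t ∈ T := by
  have := h.const_of_isNbr (fun t => ∀ r ∈ T, r - t ∈ T) (fun s hs t ht hst => ?_) h0 ht
  · exact (this ▸ (fun r hr => by simpa using hr) : ∀ r ∈ T, r - t ∈ T) r hr
  · refine propext ⟨fun hQ r hr => ?_, fun hQ r hr => ?_⟩
    · have := h.add_mem_of_isNbr ht (by simpa using hs) hst.neg (hQ r hr)
      rwa [show r - s + -(t - s) = r - t by abel] at this
    · have := h.add_mem_of_isNbr hs (by simpa using ht) hst (hQ r hr)
      rwa [show r - t + (t - s) = r - s by abel] at this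

/-- The translation vectors of the tiling as a group. -/
def translations (h : ConvexTiling P T) (h0 : (0 : RSpace d) ∈ T) : AddSubgroup (RSpace d) where
  carrier := T
  zero_mem' := h0
  add_mem' := h.add_mem h0
  neg_mem' := fun ht => by simpa using h.sub_mem h0 h0 ht

end ConvexTiling

/-! ### Potentials: uniqueness, gluing and global existence -/

/-- `p` is a potential for the increments `a` along the facets of the tiling that meet `K`. -/
def IsPot {d : ℕ} (P T : Set (RSpace d)) (a : RSpace d → RSpace d) (K : Set (RSpace d))
    (p : RSpace d → RSpace d) : Prop :=
  ∀ x ∈ K, ∀ s ∈ tilesAt P T x, ∀ t ∈ tilesAt P T x, IsNbr P (t - s) → p t - p s = a (t - s)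

lemma IsPot.mono {d : ℕ} {P T : Set (RSpace d)} {a p : RSpace d → RSpace d}
    {K K' : Set (RSpace d)} (hp : IsPot P T a K p) (hK : K' ⊆ K) : IsPot P T a K' p :=
  fun x hx => hp x (hK hx)

namespace ConvexTiling

variable {d : ℕ} {P T : Set (RSpace d)} {a : RSpace d → RSpace d}

/-- The difference of two potentials does not change across facets, so it is constant over a
connected set. -/
lemma isPot_unique (h : ConvexTiling P T) {K : Set (RSpace d)} (hK : IsPreconnected K)
    {p q : RSpace d → RSpace d} (hp : IsPot P T a K p) (hq : IsPot P T a K q) {x y : RSpace d}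
    (hx : x ∈ K) (hy : y ∈ K) {s t : RSpace d} (hs : s ∈ tilesAt P T x)
    (ht : t ∈ tilesAt P T y) : p t - p s = q t - q s := by
  have := h.const_on_tiles hK (fun r => p r - q r) (fun x hx s hs t ht hst => by
    have h1 := hp x hx s hs t ht hst
    rw [← hq x hx s hs t ht hst] at h1
    rw [sub_eq_sub_iff_add_eq_add] at h1 ⊢
    rw [add_comm (p s), ← h1, add_comm]) hx hy hs ht
  rw [sub_eq_sub_iff_add_eq_add] at this ⊢
  rw [add_comm (p t), add_comm (q t), add_comm (q s), this]

/-- The slice `f = c` of `K` is convex, hence connected, so there the two potentials differ by one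
constant. A tile meeting both halves of `K` meets the slice, by convexity of the tile and of `K`;
after a shift by that constant the potentials agree on it. -/
lemma exists_isPot_glue (h : ConvexTiling P T) {K : Set (RSpace d)} (hK : Convex ℝ K)
    (f : StrongDual ℝ (RSpace d)) (c : ℝ) (h1 : ∃ p, IsPot P T a (K ∩ {x | f x ≤ c}) p)
    (h2 : ∃ p, IsPot P T a (K ∩ {x | c ≤ f x}) p) : ∃ p, IsPot P T a K p := by
  classical
  obtain ⟨p, hp⟩ := h1
  obtain ⟨q, hq⟩ := h2
  have hmid : ∀ x y, f x ≤ c → c ≤ f y → ∃ z ∈ segment ℝ x y, f z = c := by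
    intro x y hx hy
    have := intermediate_value_Icc (zero_le_one' ℝ) (f := fun r => f (AffineMap.lineMap x y r))
      (by fun_prop)
    obtain ⟨r, hr, hrc⟩ := this (show c ∈ _ by simpa using ⟨hx, hy⟩)
    exact ⟨_, by rw [segment_eq_image_lineMap]; exact ⟨r, hr, rfl⟩, hrc⟩
  by_cases hne : ∃ w ∈ K, f w = c
  swap
  · by_cases hlow : ∃ x ∈ K, f x ≤ c
    · obtain ⟨x, hx, hxc⟩ := hlow
      refine ⟨p, hp.mono fun y hy => ⟨hy, ?_⟩⟩
      by_contra hyc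
      obtain ⟨z, hz, hzc⟩ := hmid x y hxc (not_le.1 hyc).le
      exact hne ⟨z, hK.segment_subset hx hy hz, hzc⟩
    · refine ⟨q, hq.mono fun y hy => ⟨hy, ?_⟩⟩
      by_contra hyc
      exact hlow ⟨y, hy, (not_le.1 hyc).le⟩
  obtain ⟨w, hw, hwc⟩ := hne
  obtain ⟨s₀, hs₀⟩ := h.tilesAt_nonempty w
  have hcommon : ∀ t x y, x ∈ K → f x ≤ c → t ∈ tilesAt P T x → y ∈ K → c ≤ f y →
      t ∈ tilesAt P T y → p t = q t + (p s₀ - q s₀) := by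
    intro t x y hx hxc htx hy hyc hty
    obtain ⟨z, hz, hzc⟩ := hmid x y hxc hyc
    have hzt : t ∈ tilesAt P T z := by
      refine ⟨htx.1, ?_⟩
      have hconv : Convex ℝ (t +ᵥ P) := h.convex.vadd t
      exact mem_vadd_iff_sub_mem.1 (hconv.segment_subset (mem_vadd_iff_sub_mem.2 htx.2)
        (mem_vadd_iff_sub_mem.2 hty.2) hz)
    have hslice : Convex ℝ (K ∩ {x | f x = c}) :=
      hK.inter (convex_hyperplane f.toLinearMap.isLinear c)
    have := h.isPot_unique hslice.isPreconnected
      (hp.mono fun x hx => ⟨hx.1, hx.2.le⟩) (hq.mono fun x hx => ⟨hx.1, hx.2.ge⟩)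
      ⟨hw, hwc⟩ ⟨hK.segment_subset hx hy hz, hzc⟩ hs₀ hzt
    rw [sub_eq_iff_eq_add] at this
    rw [this]; abel
  refine ⟨fun t => if ∃ x ∈ K, f x ≤ c ∧ t ∈ tilesAt P T x then p t else q t + (p s₀ - q s₀), ?_⟩
  have hval : ∀ t x, x ∈ K → c ≤ f x → t ∈ tilesAt P T x →
      (if ∃ x ∈ K, f x ≤ c ∧ t ∈ tilesAt P T x then p t else q t + (p s₀ - q s₀)) =
        q t + (p s₀ - q s₀) := by
    intro t x hx hxc ht
    split_ifs with hif
    · obtain ⟨x', hx', hx'c, ht'⟩ := hif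
      exact hcommon t x' x hx' hx'c ht' hx hxc ht
    · rfl
  intro x hx s hs t ht hst
  rcases le_total (f x) c with hxc | hxc
  · simp only
    rw [if_pos ⟨x, hx, hxc, ht⟩, if_pos ⟨x, hx, hxc, hs⟩]
    exact hp x ⟨hx, hxc⟩ s hs t ht hst
  · simp only
    rw [hval t x hx hxc ht, hval s x hx hxc hs, add_sub_add_right_eq_sub]
    exact hq x ⟨hx, hxc⟩ s hs t ht hst

/-- Induction on the set of coordinates in which `K'` may be wide: each new coordinate is cut into
slabs of width `η`, which are glued one after another. -/
lemma exists_isPot_of_small (h : ConvexTiling P T) {K : Set (RSpace d)}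
    (hb : Bornology.IsBounded K) {η : ℝ} (hη : 0 < η)
    (hsmall : ∀ K' ⊆ K, Convex ℝ K' → (∀ i, ∀ x ∈ K', ∀ y ∈ K', |x i - y i| ≤ η) →
      ∃ p, IsPot P T a K' p) (hK : Convex ℝ K) : ∃ p, IsPot P T a K p := by
  obtain ⟨M, hM⟩ := hb.exists_norm_le
  suffices H : ∀ I : Finset (Fin d), ∀ K' ⊆ K, Convex ℝ K' →
      (∀ i ∉ I, ∀ x ∈ K', ∀ y ∈ K', |x i - y i| ≤ η) → ∃ p, IsPot P T a K' p from
    H Finset.univ K subset_rfl hK (by simp)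
  intro I
  induction I using Finset.induction_on with
  | empty => exact fun K' hK' hc hw => hsmall K' hK' hc fun i => hw i (by simp)
  | insert i I _ ih =>
    intro K' hK' hc hw
    have hcoord : ∀ x ∈ K', |x i| ≤ M := fun x hx =>
      (Real.norm_eq_abs _ ▸ PiLp.norm_apply_le x i).trans (hM x (hK' hx))
    let f : StrongDual ℝ (RSpace d) := EuclideanSpace.proj i
    have hf : ∀ x, f x = x i := fun x => rfl
    have hslab : ∀ c, ∃ p, IsPot P T a (K' ∩ {x | c ≤ f x ∧ f x ≤ c + η}) p := by
      intro c
      refine ih _ (Set.inter_subset_left.trans hK') (hc.inter ?_) ?_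
      · exact (convex_halfSpace_ge f.toLinearMap.isLinear c).inter
          (convex_halfSpace_le f.toLinearMap.isLinear (c + η))
      · intro j hj x hx y hy
        rcases eq_or_ne j i with rfl | hji
        · obtain ⟨_, hx1, hx2⟩ := hx
          obtain ⟨_, hy1, hy2⟩ := hy
          rw [hf] at *
          rw [abs_le]; constructor <;> linarith
        · exact hw j (by simp [hji, hj]) x hx.1 y hy.1
    have hn : ∀ n : ℕ, ∃ p, IsPot P T a (K' ∩ {x | f x ≤ -M + n * η}) p := by
      intro n
      induction n with
      | zero =>
        obtain ⟨p, hp⟩ := hslab (-M)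
        refine ⟨p, hp.mono fun x hx => ⟨hx.1, ?_, ?_⟩⟩
        · exact (abs_le.1 (hcoord x hx.1)).1
        · have : f x ≤ -M + (0 : ℕ) * η := hx.2
          push_cast at this
          linarith
      | succ n ihn =>
        refine h.exists_isPot_glue (hc.inter (convex_halfSpace_le f.toLinearMap.isLinear _)) f
          (-M + n * η) ?_ ?_
        · obtain ⟨p, hp⟩ := ihn
          exact ⟨p, hp.mono fun x hx => ⟨hx.1.1, hx.2⟩⟩
        · obtain ⟨p, hp⟩ := hslab (-M + n * η)
          refine ⟨p, hp.mono fun x hx => ⟨hx.1.1, hx.2, ?_⟩⟩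
          have : f x ≤ -M + (n + 1 : ℕ) * η := hx.1.2
          push_cast at this
          linarith
    obtain ⟨n, hn'⟩ := exists_nat_gt (2 * M / η)
    obtain ⟨p, hp⟩ := hn n
    refine ⟨p, hp.mono fun x hx => ⟨hx, ?_⟩⟩
    rw [div_lt_iff₀ hη] at hn'
    have := (abs_le.1 (hcoord x hx)).2
    change f x ≤ _
    rw [hf]
    linarith

/-- Potentials exist on a compact convex set if they exist locally. -/
lemma exists_isPot_of_isCompact (h : ConvexTiling P T) {K : Set (RSpace d)} (hK : IsCompact K)
    (hconv : Convex ℝ K) (hloc : ∀ x ∈ K, ∃ p, IsPot P T a {x} p) : ∃ p, IsPot P T a K p := by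
  have hloc' : ∀ x : K, ∃ U : Set (RSpace d), IsOpen U ∧ (x : RSpace d) ∈ U ∧
      ∃ p, IsPot P T a U p := by
    rintro ⟨x, hx⟩
    obtain ⟨ε, hε, hball⟩ := Metric.eventually_nhds_iff_ball.1 (h.eventually_tilesAt_subset x)
    obtain ⟨p, hp⟩ := hloc x hx
    exact ⟨Metric.ball x ε, Metric.isOpen_ball, Metric.mem_ball_self hε, p,
      fun y hy s hs t ht => hp x rfl s (hball y hy hs) t (hball y hy ht)⟩
  choose U hUo hUx hUp using hloc'
  obtain ⟨δ, hδ, hleb⟩ := lebesgue_number_lemma_of_metric hK hUo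
    fun x hx => Set.mem_iUnion.2 ⟨⟨x, hx⟩, hUx _⟩
  -- Coordinate widths `δ / (d + 1)` bound distances by `√d * δ / (d + 1) < δ`; the `+ 1` also
  -- covers `d = 0`.
  refine h.exists_isPot_of_small hK.isBounded (η := δ / (d + 1)) (by positivity) ?_ hconv
  intro K' hK' _ hw
  rcases K'.eq_empty_or_nonempty with rfl | ⟨x, hx⟩
  · exact ⟨0, fun x hx => absurd hx (Set.notMem_empty x)⟩
  obtain ⟨i, hi⟩ := hleb x (hK' hx)
  obtain ⟨p, hp⟩ := hUp i
  refine ⟨p, hp.mono fun y hy => hi ?_⟩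
  rw [Metric.mem_ball, EuclideanSpace.dist_eq, Real.sqrt_lt' hδ]
  calc ∑ j, dist (y j) (x j) ^ 2 ≤ ∑ _j : Fin d, (δ / (d + 1)) ^ 2 :=
        Finset.sum_le_sum fun j _ => pow_le_pow_left₀ dist_nonneg (hw j y hy x hx) 2
    _ = d * (δ / (d + 1)) ^ 2 := by simp
    _ < δ ^ 2 := by
      rw [div_pow, mul_div_assoc', div_lt_iff₀ (by positivity)]
      have : (0 : ℝ) ≤ d := Nat.cast_nonneg d
      have : 0 < δ ^ 2 := by positivity
      have h2 : (d : ℝ) < (d + 1) ^ 2 := by nlinarith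
      rw [mul_comm]
      exact mul_lt_mul_of_pos_left h2 this

lemma finrank_vectorSpan_segment_le (x y : RSpace d) :
    finrank ℝ (vectorSpan ℝ (segment ℝ x y)) ≤ 1 := by
  rw [← convexHull_pair, ← direction_affineSpan, affineSpan_convexHull, direction_affineSpan]
  exact (collinear_pair ℝ x y).finrank_le_one

/-- Almost every triangle on a side that avoids the `3`-skeleton carries a potential. -/
lemma ae_exists_isPot_triangle (h : ConvexTiling P T)
    (hloc : ∀ x ∉ skel P T 3, ∃ p, IsPot P T a {x} p) {x y : RSpace d}
    (hxy : ∀ q ∈ segment ℝ x y, q ∉ skel P T 3) :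
    ∀ᵐ z : RSpace d, (∀ q ∈ segment ℝ x z, q ∉ skel P T 3) ∧
      ∃ p, IsPot P T a (convexHull ℝ {z, x, y}) p := by
  have hd := finrank_vectorSpan_segment_le x y
  filter_upwards [h.ae_segment_notMem_skel (K := segment ℝ x y) (k := 3) (by omega) hxy]
    with z hz
  refine ⟨hz x (left_mem_segment ℝ x y), ?_⟩
  refine h.exists_isPot_of_isCompact (Set.Finite.isCompact_convexHull ℝ (Set.toFinite _))
    (convex_convexHull ℝ _) fun w hw => hloc w ?_
  rw [convexHull_insert (by simp), convexHull_pair, mem_convexJoin] at hw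
  obtain ⟨z', rfl, q, hq, hw⟩ := hw
  exact hz q hq w (segment_symm ℝ z' q ▸ hw)

lemma contact_convex (h : ConvexTiling P T) (v : RSpace d) : Convex ℝ (contact P v) := by
  rw [← inter_vadd_eq_contact]
  exact h.convex.inter (h.convex.vadd v)

/-- Take a relative interior point of the common facet. A further tile there would contain the whole
facet and so be the neighbour of `s` across it, which is `t`. -/
lemma exists_tilesAt_eq_pair (h : ConvexTiling P T) {s t : RSpace d} (hs : s ∈ T) (ht : t ∈ T)
    (hst : IsNbr P (t - s)) : ∃ w, tilesAt P T w = {s, t} := by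
  obtain ⟨x, hx⟩ := (h.contact_convex (t - s)).exists_relInt hst.1
  have hR : RelInt {y | y - s ∈ contact P (t - s)} (s + x) := by
    refine ⟨by simpa using hx.1, fun y hy => ?_⟩
    obtain ⟨ε, hε, hz⟩ := hx.2 _ hy
    refine ⟨ε, hε, ?_⟩
    rw [Set.mem_ofPred_eq]
    convert hz using 1
    rw [show s + x - y = x - (y - s) by abel]
    abel
  refine ⟨s + x, Set.ext fun r => ⟨fun hr => ?_, ?_⟩⟩
  · by_cases hrs : r = s
    · simp [hrs]
    right
    have hsub : contact P (t - s) ⊆ contact P (r - s) := by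
      intro y hy
      refine ⟨hy.1, ?_⟩
      have := h.mem_of_relInt hs hr.1 (fun z hz => hz.1) hR hr.2 (y := y + s)
        (by simpa using hy)
      rwa [show y - (r - s) = y + s - r by abel]
    have h1 := Submodule.finrank_mono (vectorSpan_mono ℝ hsub)
    have h2 := h.finrank_contact_lt hs hr.1 (Ne.symm hrs)
    have h3 := hst.2
    have hrn : IsNbr P (r - s) := ⟨hst.1.mono hsub, by omega⟩
    obtain ⟨l, hl⟩ := h.exists_isNormal hs (by simpa using ht) hst
    obtain ⟨l', hl'⟩ := h.exists_isNormal hs (by simpa using hr.1) hrn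
    have := hl.eq_of_ker_eq h hl' (by
      rw [← hl.ker, ← hl'.ker]
      exact (Submodule.eq_of_le_of_finrank_eq (vectorSpan_mono ℝ hsub) (by omega)).le)
      hx.1 (hsub hx.1)
    exact (sub_left_injective this).symm
  · rintro (rfl | rfl)
    · exact ⟨hs, by simpa using hx.1.1⟩
    · exact ⟨ht, by have := hx.1.2; rwa [show x - (r - s) = s + x - r by abel] at this⟩

/-- A locally integrable system of increments has a global potential, since the complement of a
set of codimension three is simply connected. -/
theorem exists_potential (h : ConvexTiling P T) (h0 : (0 : RSpace d) ∈ T)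
    (hloc : ∀ x ∉ skel P T 3, ∃ p, IsPot P T a {x} p) :
    ∃ Φ : RSpace d → RSpace d, ∀ s ∈ T, ∀ t ∈ T, IsNbr P (t - s) → Φ t - Φ s = a (t - s) := by
  obtain ⟨x₀, hx₀⟩ := h.int_nonempty
  have hx₀' : x₀ - 0 ∈ interior P := by simpa using hx₀
  have h0x : (0 : RSpace d) ∈ tilesAt P T x₀ := ⟨h0, interior_subset hx₀'⟩
  have hne : ∀ t : RSpace d, ∃ y : RSpace d, y - t ∈ interior P := fun t => ⟨x₀ + t, by simpa⟩
  -- `Φ t` is the increase of a potential along a generic segment from a fixed interior point of `P`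
  -- into the interior of `t + P`.
  have hΦ : ∀ t : RSpace d, ∃ c : RSpace d, t ∈ T → ∃ y p, y - t ∈ interior P ∧
      (∀ q ∈ segment ℝ x₀ y, q ∉ skel P T 3) ∧ IsPot P T a (segment ℝ x₀ y) p ∧
      c = p t - p 0 := by
    intro t
    have hae := h.ae_segment_notMem_skel (K := {x₀}) (k := 3)
      (by rw [vectorSpan_singleton, finrank_bot]; norm_num)
      (by rintro q rfl; exact h.notMem_skel_of_mem_interior h0 hx₀' three_pos)
    obtain ⟨y, hy, hyt⟩ := (Measure.dense_of_ae hae).exists_mem_open (isOpen_interior_tile (P := P) t)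
      (hne t)
    have hseg := hy x₀ rfl
    obtain ⟨p, hp⟩ := h.exists_isPot_of_isCompact (a := a) (K := segment ℝ x₀ y)
      (by rw [← convexHull_pair]; exact Set.Finite.isCompact_convexHull ℝ (Set.toFinite _))
      (convex_segment x₀ y) fun w hw => hloc w (hseg w hw)
    exact ⟨p t - p 0, fun _ => ⟨y, p, hyt, hseg, hp, rfl⟩⟩
  choose Φ hΦ using hΦ
  refine ⟨Φ, fun s hs t ht hst => ?_⟩
  obtain ⟨ys, ps, hys, hsegs, hps, hcs⟩ := hΦ s hs
  obtain ⟨yt, pt, hyt, hsegt, hpt, hct⟩ := hΦ t ht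
  obtain ⟨w, hw⟩ := h.exists_tilesAt_eq_pair hs ht hst
  obtain ⟨ε, hε, hball⟩ := Metric.eventually_nhds_iff_ball.1 (h.eventually_tilesAt_subset w)
  have hws : s ∈ tilesAt P T w := by simp [hw]
  have hwt : t ∈ tilesAt P T w := by simp [hw]
  -- The loop from `x₀` through `ys` and `yt` is filled by the triangles `x₀ ys z`, `x₀ z z'` and
  -- `x₀ z' yt`, with `z`, `z'` close to a point `w` lying in the tiles `s` and `t` only. Uniqueness
  -- along shared sides compares the potentials.
  obtain ⟨z, ⟨hz0, q₁, hq₁⟩, hzw, hzs⟩ :=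
    (Measure.dense_of_ae (h.ae_exists_isPot_triangle hloc hsegs)).exists_mem_open
      (Metric.isOpen_ball.inter (isOpen_interior_tile (P := P) s))
      (h.exists_mem_interior_of_isOpen hws.2 Metric.isOpen_ball (Metric.mem_ball_self hε))
  obtain ⟨z', ⟨⟨-, q₂, hq₂⟩, -, q₃, hq₃⟩, hzw', hzt'⟩ :=
    (Measure.dense_of_ae ((h.ae_exists_isPot_triangle hloc hz0).and
      (h.ae_exists_isPot_triangle hloc hsegt))).exists_mem_open
      (Metric.isOpen_ball.inter (isOpen_interior_tile (P := P) t))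
      (h.exists_mem_interior_of_isOpen hwt.2 Metric.isOpen_ball (Metric.mem_ball_self hε))
  have hsub : ∀ {A : Set (RSpace d)} {u v : RSpace d}, u ∈ A → v ∈ A →
      segment ℝ u v ⊆ convexHull ℝ A := fun hu hv =>
    (convex_convexHull ℝ _).segment_subset (subset_convexHull ℝ _ hu) (subset_convexHull ℝ _ hv)
  have huniq : ∀ {p q : RSpace d → RSpace d} {y r : RSpace d}, y - r ∈ interior P → r ∈ T →
      IsPot P T a (segment ℝ x₀ y) p → IsPot P T a (segment ℝ x₀ y) q →
      p r - p 0 = q r - q 0 := fun {p q y r} hy hr hp hq =>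
    h.isPot_unique (convex_segment _ _).isPreconnected hp hq (left_mem_segment ℝ x₀ y)
      (right_mem_segment ℝ x₀ y) h0x ⟨hr, interior_subset hy⟩
  have e1 := huniq hys hs hps (hq₁.mono (hsub (by simp) (by simp)))
  have e2 := huniq hzs hs (hq₁.mono (hsub (by simp) (by simp)))
    (hq₂.mono (hsub (by simp) (by simp)))
  have e3 := huniq hzt' ht (hq₂.mono (hsub (by simp) (by simp)))
    (hq₃.mono (hsub (by simp) (by simp)))
  have e4 := huniq hyt ht hpt (hq₃.mono (hsub (by simp) (by simp)))
  -- Only `s` and `t` occur along the segment from `z` to `z'`. If no point of it were in both, the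
  -- tile would be constant along it, giving `s = t`.
  have e5 : q₂ t - q₂ s = a (t - s) := by
    by_contra hne
    have hseg : segment ℝ z z' ⊆ Metric.ball w ε := (convex_ball w ε).segment_subset hzw hzw'
    have := h.const_of_isPreconnected (convex_segment z z').isPreconnected (fun r => r = s)
      (fun u hu r hr r' hr' => ?_) (left_mem_segment ℝ z z') (right_mem_segment ℝ z z')
      ⟨hs, interior_subset hzs⟩ ⟨ht, interior_subset hzt'⟩
    · have hts : t = s := this ▸ rfl
      exact h.isNbr_ne_zero hst (sub_eq_zero.2 hts)
    · have hboth : ¬ (s ∈ tilesAt P T u ∧ t ∈ tilesAt P T u) := fun hb =>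
        hne (hq₂ u (hsub (by simp) (by simp) hu) s hb.1 t hb.2 hst)
      have h1 := hball u (hseg hu) hr
      have h2 := hball u (hseg hu) hr'
      rw [hw] at h1 h2
      rcases h1 with rfl | rfl <;> rcases h2 with rfl | rfl
      · rfl
      · exact absurd ⟨hr, hr'⟩ hboth
      · exact absurd ⟨hr', hr⟩ hboth
      · rfl
  rw [hcs, hct, e1, e4, ← e3, e2, ← e5]
  abel

end ConvexTiling

/-! ### Prékopa–Leindler and Brunn–Minkowski inequalities -/

lemma volume_add_volume_le_of_midpoint {A B C : Set ℝ} (hA : MeasurableSet A)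
    (hB : MeasurableSet B) (hAne : A.Nonempty) (hBne : B.Nonempty)
    (h : ∀ x ∈ A, ∀ y ∈ B, (x + y) / 2 ∈ C) : volume A + volume B ≤ 2 * volume C := by
  have hvol : ∀ (D : Set ℝ) (m : ℝ), volume ((fun x => (x + m) / 2) ⁻¹' D) = 2 * volume D := by
    intro D m
    have : (fun x => (x + m) / 2) ⁻¹' D = (fun x => x + m) ⁻¹' ((fun x => (2 : ℝ)⁻¹ * x) ⁻¹' D) := by
      ext x; simp [div_eq_inv_mul]
    rw [this, measure_preimage_add_right, Real.volume_preimage_mul_left (by norm_num)]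
    simp
  -- For compact `K` and `L` with `M = max K` and `m = min L`, the sets `(K + m) / 2` and `(M + L) /
  -- 2` lie in `C`, on opposite sides of `(M + m) / 2`.
  have key : ∀ K ⊆ A, IsCompact K → ∀ L ⊆ B, IsCompact L → K.Nonempty → L.Nonempty →
      volume K + volume L ≤ 2 * volume C := by
    intro K hKA hK L hLB hL hKne hLne
    obtain ⟨M, hM, hMmax⟩ := hK.exists_isGreatest hKne
    obtain ⟨m, hm, hmmin⟩ := hL.exists_isLeast hLne
    have h1 : volume K ≤ 2 * volume (C ∩ Set.Iic ((M + m) / 2)) := by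
      rw [← hvol _ m]
      refine measure_mono fun x hx => ⟨h x (hKA hx) m (hLB hm), ?_⟩
      have := hMmax hx
      simp only [Set.mem_Iic]; linarith
    have h2 : volume L ≤ 2 * volume (C ∩ Set.Ici ((M + m) / 2)) := by
      rw [← hvol _ M]
      refine measure_mono fun x hx => ⟨?_, ?_⟩
      · have := h M (hKA hM) x (hLB hx)
        rwa [add_comm] at this
      · have := hmmin hx
        simp only [Set.mem_Ici]; linarith
    have h3 : volume (C ∩ Set.Ici ((M + m) / 2)) = volume (C \ Set.Iic ((M + m) / 2)) := by
      rw [Set.sdiff_eq, Set.compl_Iic]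
      exact measure_congr ((ae_eq_refl C).inter Ioi_ae_eq_Ici.symm)
    calc volume K + volume L ≤ 2 * volume (C ∩ Set.Iic ((M + m) / 2))
          + 2 * volume (C ∩ Set.Ici ((M + m) / 2)) := add_le_add h1 h2
      _ = 2 * volume C := by
        rw [h3, ← mul_add, measure_inter_add_sdiff _ measurableSet_Iic]
  obtain ⟨a, ha⟩ := hAne
  obtain ⟨b, hb⟩ := hBne
  have key' : ∀ K ⊆ A, IsCompact K → ∀ L ⊆ B, IsCompact L →
      volume K + volume L ≤ 2 * volume C := fun K hKA hK L hLB hL =>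
    (add_le_add (measure_mono (Set.subset_insert a K)) (measure_mono (Set.subset_insert b L))).trans
      (key _ (Set.insert_subset ha hKA) (hK.insert a) _ (Set.insert_subset hb hLB) (hL.insert b)
        (Set.insert_nonempty _ _) (Set.insert_nonempty _ _))
  by_cases htop : 2 * volume C = ⊤
  · rw [htop]; exact le_top
  have h1 : ∀ L ⊆ B, IsCompact L → volume A + volume L ≤ 2 * volume C := by
    intro L hLB hL
    have hle : volume L ≤ 2 * volume C :=
      le_add_self.trans (key' ∅ (Set.empty_subset _) isCompact_empty L hLB hL)
    refine add_le_of_le_tsub_right_of_le hle ?_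
    rw [hA.measure_eq_iSup_isCompact]
    exact iSup₂_le fun K hKA => iSup_le fun hK =>
      ENNReal.le_sub_of_add_le_right (ne_top_of_le_ne_top htop hle) (key' K hKA hK L hLB hL)
  have hle : volume A ≤ 2 * volume C :=
    le_self_add.trans (h1 ∅ (Set.empty_subset _) isCompact_empty)
  refine add_le_of_le_tsub_left_of_le hle ?_
  rw [hB.measure_eq_iSup_isCompact]
  exact iSup₂_le fun L hLB => iSup_le fun hL =>
    ENNReal.le_sub_of_add_le_left (ne_top_of_le_ne_top htop hle) (h1 L hLB hL)

lemma ENNReal.mul_le_sq_of_add_le {x y z : ℝ≥0∞} (h : x + y ≤ 2 * z) : x * y ≤ z ^ 2 := by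
  by_cases hz : z = ⊤
  · simp [hz]
  have h2 : 2 * z ≠ ⊤ := ENNReal.mul_ne_top (by norm_num) hz
  lift z to NNReal using hz
  lift x to NNReal using ne_top_of_le_ne_top h2 (le_self_add.trans h)
  lift y to NNReal using ne_top_of_le_ne_top h2 (le_add_self.trans h)
  norm_cast at h ⊢
  rw [← NNReal.coe_le_coe] at h ⊢
  push_cast at h ⊢
  have := mul_self_le_mul_self (by positivity) h
  nlinarith [sq_nonneg ((x : ℝ) - y)]

/-- Layer-cake integration of the inequality for sets. Normalising both suprema to `1` makes the
superlevel sets nonempty for all `t < 1`, as that inequality requires. -/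
lemma lintegral_add_lintegral_le_of_midpoint {f g h : ℝ → ℝ≥0∞} (hf : Measurable f)
    (hg : Measurable g) (hh : Measurable h) (hf1 : ⨆ x, f x = 1) (hg1 : ⨆ x, g x = 1)
    (H : ∀ x y, f x * g y ≤ h ((x + y) / 2) ^ 2) :
    (∫⁻ x, f x) + ∫⁻ x, g x ≤ 2 * ∫⁻ x, h x := by
  have hle : ∀ {f : ℝ → ℝ≥0∞}, ⨆ x, f x = 1 → ∀ x, f x ≤ 1 := fun hf x => hf ▸ le_iSup _ x
  have layer : ∀ {f : ℝ → ℝ≥0∞}, Measurable f → (∀ x, f x ≤ 1) →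
      ∫⁻ x, f x = ∫⁻ t in Set.Ioi (0 : ℝ), volume {x | ENNReal.ofReal t < f x} := by
    intro f hf hf1
    have hfin : ∀ x, f x ≠ ⊤ := fun x => ne_top_of_le_ne_top ENNReal.one_ne_top (hf1 x)
    calc ∫⁻ x, f x = ∫⁻ x, ENNReal.ofReal (f x).toReal := by
          simp_rw [fun x => ENNReal.ofReal_toReal (hfin x)]
      _ = ∫⁻ t in Set.Ioi (0 : ℝ), volume {x | t < (f x).toReal} :=
          lintegral_eq_lintegral_meas_lt _ (Filter.Eventually.of_forall fun x =>
            ENNReal.toReal_nonneg) hf.ennreal_toReal.aemeasurable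
      _ = _ := by
          refine setLIntegral_congr_fun measurableSet_Ioi fun t ht => ?_
          congr 1
          ext x
          exact (ENNReal.ofReal_lt_iff_lt_toReal (le_of_lt ht) (hfin x)).symm
  have hmeas : ∀ f : ℝ → ℝ≥0∞, Measurable fun t : ℝ => volume {x | ENNReal.ofReal t < f x} :=
    fun f => Antitone.measurable fun s t hst =>
      measure_mono fun x hx => (ENNReal.ofReal_le_ofReal hst).trans_lt hx
  -- Truncating `h` at `1` loses nothing for levels below `1` and makes the layer-cake formula
  -- applicable.
  have hh' : ∫⁻ x, min (h x) 1 ≤ ∫⁻ x, h x := lintegral_mono fun x => min_le_left _ _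
  refine le_trans ?_ (mul_le_mul_right hh' 2)
  rw [layer hf (hle hf1), layer hg (hle hg1),
    layer (hh.min measurable_const) (fun x => min_le_right _ _),
    ← lintegral_add_left (hmeas f), ← lintegral_const_mul _ (hmeas _)]
  refine setLIntegral_mono ((hmeas _).const_mul _) fun t (ht : 0 < t) => ?_
  rcases le_or_gt 1 t with h1 | h1
  · have hemp : ∀ {f : ℝ → ℝ≥0∞}, (∀ x, f x ≤ 1) → {x | ENNReal.ofReal t < f x} = ∅ := by
      intro f hf
      refine Set.eq_empty_of_forall_notMem fun x (hx : ENNReal.ofReal t < f x) => ?_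
      have h2 := hx.trans_le (hf x)
      rw [ENNReal.ofReal_lt_one] at h2
      linarith
    rw [hemp (hle hf1), hemp (hle hg1)]
    simp
  · have h1' : ENNReal.ofReal t < 1 := by rwa [ENNReal.ofReal_lt_one]
    have hne : ∀ {f : ℝ → ℝ≥0∞}, ⨆ x, f x = 1 → {x | ENNReal.ofReal t < f x}.Nonempty := by
      intro f hf
      rw [← hf] at h1'
      exact lt_iSup_iff.1 h1'
    refine volume_add_volume_le_of_midpoint (measurableSet_lt measurable_const hf)
      (measurableSet_lt measurable_const hg)
      (hne hf1) (hne hg1) ?_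
    intro x hx y hy
    refine lt_min ?_ h1'
    by_contra! hc
    have h2 := (H x y).trans (pow_le_pow_left' hc 2)
    rw [sq] at h2
    exact absurd h2 (not_le.2 (ENNReal.mul_lt_mul hx hy))

/-- Dividing `f`, `g`, `h` by `a`, `b`, `√(a * b)` reaches the normalised case; the additive
inequality there gives the multiplicative one by AM–GM. -/
lemma lintegral_mul_lintegral_le_of_bounded {f g h : ℝ → ℝ≥0∞} (hf : Measurable f)
    (hg : Measurable g) (hh : Measurable h) (hf1 : ⨆ x, f x ≠ ⊤) (hg1 : ⨆ x, g x ≠ ⊤)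
    (H : ∀ x y, f x * g y ≤ h ((x + y) / 2) ^ 2) :
    (∫⁻ x, f x) * ∫⁻ x, g x ≤ (∫⁻ x, h x) ^ 2 := by
  set a := ⨆ x, f x with ha
  set b := ⨆ x, g x with hb
  by_cases ha0 : a = 0
  · have : ∀ x, f x = 0 := by simpa [ha] using ha0
    simp [this]
  by_cases hb0 : b = 0
  · have : ∀ x, g x = 0 := by simpa [hb] using hb0
    simp [this]
  obtain ⟨c, hc⟩ : ∃ c : ℝ≥0∞, c ^ 2 = a * b :=
    ⟨(a * b) ^ (1 / 2 : ℝ), by rw [← ENNReal.rpow_natCast, ← ENNReal.rpow_mul]; norm_num⟩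
  have hab0 : a * b ≠ 0 := mul_ne_zero ha0 hb0
  have habt : a * b ≠ ⊤ := ENNReal.mul_ne_top hf1 hg1
  have key := lintegral_add_lintegral_le_of_midpoint (f := fun x => a⁻¹ * f x)
    (g := fun x => b⁻¹ * g x) (h := fun x => c⁻¹ * h x) (hf.const_mul _) (hg.const_mul _)
    (hh.const_mul _) (by rw [← ENNReal.mul_iSup, ENNReal.inv_mul_cancel ha0 hf1])
    (by rw [← ENNReal.mul_iSup, ENNReal.inv_mul_cancel hb0 hg1]) (fun x y => by
      rw [mul_pow, ← ENNReal.inv_pow, hc, mul_mul_mul_comm, ENNReal.mul_inv (.inl ha0) (.inl hf1)]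
      exact mul_le_mul_right (H x y) _)
  rw [lintegral_const_mul _ hf, lintegral_const_mul _ hg, lintegral_const_mul _ hh] at key
  have h2 := ENNReal.mul_le_sq_of_add_le key
  rw [mul_pow, ← ENNReal.inv_pow, hc, mul_mul_mul_comm, ← ENNReal.mul_inv (.inl ha0) (.inl hf1)] at h2
  have h3 := mul_le_mul_right h2 (a * b)
  rwa [← mul_assoc, ← mul_assoc (a * b), ENNReal.mul_inv_cancel hab0 habt, one_mul, one_mul] at h3

lemma lintegral_mul_lintegral_le_real {f g h : ℝ → ℝ≥0∞} (hf : Measurable f)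
    (hg : Measurable g) (hh : Measurable h) (H : ∀ x y, f x * g y ≤ h ((x + y) / 2) ^ 2) :
    (∫⁻ x, f x) * ∫⁻ x, g x ≤ (∫⁻ x, h x) ^ 2 := by
  have hlim : ∀ {f : ℝ → ℝ≥0∞}, Measurable f →
      ∫⁻ x, f x = ⨆ n : ℕ, ∫⁻ x, min (f x) n := by
    intro f hf
    rw [← lintegral_iSup (fun n => hf.min measurable_const)
      fun m n hmn x => min_le_min_left _ (Nat.cast_le.2 hmn)]
    congr 1
    ext x
    rw [← inf_iSup_eq, ENNReal.iSup_natCast, inf_top_eq]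
  have hmono : ∀ f : ℝ → ℝ≥0∞, Monotone fun n : ℕ => ∫⁻ x, min (f x) n := fun f m n hmn =>
    lintegral_mono fun x => min_le_min_left _ (Nat.cast_le.2 hmn)
  rw [hlim hf, hlim hg, ENNReal.iSup_mul]
  refine iSup_le fun i => ?_
  rw [ENNReal.mul_iSup]
  refine iSup_le fun j => ?_
  set n := max i j
  refine (mul_le_mul' (hmono f (le_max_left i j)) (hmono g (le_max_right i j))).trans ?_
  have hb : ∀ f : ℝ → ℝ≥0∞, ⨆ x, min (f x) (n : ℝ≥0∞) ≠ ⊤ := fun f =>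
    ne_top_of_le_ne_top (ENNReal.natCast_ne_top n) (iSup_le fun x => min_le_right _ _)
  refine (lintegral_mul_lintegral_le_of_bounded (hf.min measurable_const)
    (hg.min measurable_const) (hh.min (measurable_const (a := (n : ℝ≥0∞)))) (hb f) (hb g)
    fun x y => ?_).trans (pow_le_pow_left' (lintegral_mono fun x => min_le_left _ _) 2)
  rcases le_total (h ((x + y) / 2)) n with hn | hn
  · rw [min_eq_left hn]
    exact (mul_le_mul' (min_le_left _ _) (min_le_left _ _)).trans (H x y)
  · rw [min_eq_right hn, sq]
    exact mul_le_mul' (min_le_right _ _) (min_le_right _ _)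

/-- The Prékopa–Leindler inequality for midpoints. -/
theorem lintegral_mul_lintegral_le_pi (n : ℕ) {f g h : (Fin n → ℝ) → ℝ≥0∞} (hf : Measurable f)
    (hg : Measurable g) (hh : Measurable h)
    (H : ∀ x y, f x * g y ≤ h ((1 / 2 : ℝ) • (x + y)) ^ 2) :
    (∫⁻ x, f x) * ∫⁻ x, g x ≤ (∫⁻ x, h x) ^ 2 := by
  induction n with
  | zero =>
    have hint : ∀ f : (Fin 0 → ℝ) → ℝ≥0∞, ∫⁻ x, f x = f 0 := fun f => by
      rw [lintegral_unique, Measure.volume_pi_eq_dirac 0]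
      simp only [measure_univ, mul_one]
      congr 1
      exact Subsingleton.elim _ _
    rw [hint, hint, hint]
    simpa using H 0 0
  | succ n ih =>
    have hcons : ∀ {f : (Fin (n + 1) → ℝ) → ℝ≥0∞}, Measurable f →
        Measurable fun p : ℝ × (Fin n → ℝ) => f (Fin.cons p.1 p.2) := fun hf =>
      hf.comp (measurable_pi_iff.2 fun i => by
        refine Fin.cases ?_ (fun j => ?_) i
        · exact measurable_fst
        · exact (measurable_pi_apply j).comp measurable_snd)
    have hint : ∀ {f : (Fin (n + 1) → ℝ) → ℝ≥0∞}, Measurable f →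
        ∫⁻ x, f x = ∫⁻ s : ℝ, ∫⁻ y : Fin n → ℝ, f (Fin.cons s y) := by
      intro f hf
      rw [← (volume_preserving_piFinSuccAbove (fun _ : Fin (n + 1) => ℝ) 0).symm.lintegral_comp hf]
      rw [← lintegral_prod _ (hcons hf).aemeasurable]
      refine lintegral_congr fun p => ?_
      rw [← Fin.insertNth_zero']
      rfl
    rw [hint hf, hint hg, hint hh]
    -- The induction hypothesis on slices at `s` and `t` is the midpoint condition for the marginals
    -- in the first coordinate.
    refine lintegral_mul_lintegral_le_real (hcons hf).lintegral_prod_right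
      (hcons hg).lintegral_prod_right (hcons hh).lintegral_prod_right fun s t => ?_
    refine ih ((hcons hf).comp measurable_prodMk_left) ((hcons hg).comp measurable_prodMk_left)
      ((hcons hh).comp measurable_prodMk_left) fun x y => ?_
    refine (H (Fin.cons s x) (Fin.cons t y)).trans_eq ?_
    congr 2
    ext i
    refine Fin.cases ?_ (fun j => ?_) i
    · simp; ring
    · simp [mul_add]

/-- The multiplicative Brunn–Minkowski inequality. -/
theorem volume_mul_volume_le_of_midpoint {d : ℕ} {A B C : Set (RSpace d)} (hA : MeasurableSet A)
    (hB : MeasurableSet B) (hC : MeasurableSet C)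
    (h : ∀ x ∈ A, ∀ y ∈ B, (1 / 2 : ℝ) • (x + y) ∈ C) :
    volume A * volume B ≤ volume C ^ 2 := by
  have hvol : ∀ {D : Set (RSpace d)}, MeasurableSet D → volume D =
      ∫⁻ x : Fin d → ℝ, (WithLp.toLp 2 ⁻¹' D).indicator 1 x := by
    intro D hD
    rw [lintegral_indicator_one ((PiLp.volume_preserving_toLp (Fin d)).measurable hD),
      (PiLp.volume_preserving_toLp (Fin d)).measure_preimage hD.nullMeasurableSet]
  have hm : ∀ {D : Set (RSpace d)}, MeasurableSet D →
      Measurable ((WithLp.toLp 2 ⁻¹' D).indicator (1 : (Fin d → ℝ) → ℝ≥0∞)) := fun hD =>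
    measurable_one.indicator ((PiLp.volume_preserving_toLp (Fin d)).measurable hD)
  rw [hvol hA, hvol hB, hvol hC]
  refine lintegral_mul_lintegral_le_pi d (hm hA) (hm hB) (hm hC) fun x y => ?_
  by_cases hx : WithLp.toLp 2 x ∈ A
  · by_cases hy : WithLp.toLp 2 y ∈ B
    · have hz : (1 / 2 : ℝ) • (x + y) ∈ WithLp.toLp 2 ⁻¹' C := by
        have := h _ hx _ hy
        rwa [← WithLp.toLp_add, ← WithLp.toLp_smul] at this
      rw [Set.indicator_of_mem hz]
      simp [Set.indicator_of_mem, hx, hy]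
    · simp [hy]
  · simp [hx]

/-! ### Distribution functions and the equality case for a body and its reflection -/

section levels

variable {d : ℕ} {f : StrongDual ℝ (RSpace d)} {S : Set (RSpace d)}

lemma volume_level_eq_zero (hf : f ≠ 0) (r : ℝ) : volume {x | f x = r} = 0 := by
  obtain ⟨e, he⟩ : ∃ e, f e ≠ 0 := by
    by_contra! hc
    exact hf (ContinuousLinearMap.ext hc)
  set x₀ := (r / f e) • e with hx₀
  have hA : AffineSubspace.mk' x₀ (LinearMap.ker f.toLinearMap) ≠ ⊤ := by
    intro h
    have h1 : x₀ + e ∈ AffineSubspace.mk' x₀ (LinearMap.ker f.toLinearMap) := by rw [h]; trivial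
    rw [AffineSubspace.mem_mk'] at h1
    simp [he] at h1
  refine measure_mono_null (fun x (hx : f x = r) => ?_)
    (Measure.addHaar_affineSubspace (volume : Measure (RSpace d)) _ hA)
  rw [SetLike.mem_coe, AffineSubspace.mem_mk']
  simp [hx, hx₀, he]

lemma measurableSet_lt_functional (f : StrongDual ℝ (RSpace d)) (r : ℝ) :
    MeasurableSet {x | f x < r} :=
  measurableSet_lt f.continuous.measurable measurable_const

lemma volume_real_gt (hf : f ≠ 0) (hfin : volume S ≠ ⊤) (r : ℝ) :
    volume.real (S ∩ {x | r < f x}) = volume.real S - volume.real (S ∩ {x | f x < r}) := by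
  have h1 := measureReal_inter_add_sdiff (μ := volume) (s := S) (t := {x | f x < r})
    (measurableSet_lt_functional f r) hfin
  have h2 : volume.real (S \ {x | f x < r}) = volume.real (S ∩ {x | r < f x}) := by
    refine measureReal_congr ?_
    have h3 := measure_eq_zero_iff_ae_notMem.1 (volume_level_eq_zero hf r)
    filter_upwards [h3] with x hx
    refine propext (and_congr_right fun _ => ?_)
    change ¬ (f x < r) ↔ r < f x
    rw [not_lt]
    exact ⟨fun h => lt_of_le_of_ne h fun h' => hx h'.symm, le_of_lt⟩
  rw [← h1, h2]; ring

lemma volume_real_lt_mono (hfin : volume S ≠ ⊤) :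
    Monotone fun r => volume.real (S ∩ {x | f x < r}) := fun _ _ hrs =>
  measureReal_mono (Set.inter_subset_inter_right _ fun _ hx => lt_of_lt_of_le hx hrs)
    (measure_ne_top_of_subset Set.inter_subset_left hfin)

lemma volume_real_lt_continuous (hf : f ≠ 0) (hfin : volume S ≠ ⊤) :
    Continuous fun r => volume.real (S ∩ {x | f x < r}) := by
  have hint : (fun r => volume.real (S ∩ {x | f x < r})) =
      fun r => ∫ x in S, {x | f x < r}.indicator (fun _ => (1 : ℝ)) x := by
    ext r
    rw [integral_indicator_const _ (measurableSet_lt_functional f r), smul_eq_mul, mul_one,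
      measureReal_restrict_apply (measurableSet_lt_functional f r), Set.inter_comm]
  rw [hint]
  have : IsFiniteMeasure (volume.restrict S) := ⟨by simpa using hfin.lt_top⟩
  refine continuous_iff_continuousAt.2 fun r => ?_
  refine continuousAt_of_dominated (bound := fun _ => 1) ?_ ?_ (integrable_const 1) ?_
  · exact Filter.Eventually.of_forall fun r =>
      (measurable_const.indicator (measurableSet_lt_functional f r)).aestronglyMeasurable
  · refine Filter.Eventually.of_forall fun r => Filter.Eventually.of_forall fun x => ?_
    by_cases hx : x ∈ {x | f x < r} <;> simp [hx]
  · have h3 := ae_restrict_of_ae (s := S)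
      (measure_eq_zero_iff_ae_notMem.1 (volume_level_eq_zero hf r))
    filter_upwards [h3] with x hx
    rcases lt_or_gt_of_ne (show f x ≠ r from hx) with h | h
    · refine ContinuousAt.congr (f := fun _ => (1 : ℝ)) continuousAt_const ?_
      filter_upwards [lt_mem_nhds h] with r' hr'
      exact (Set.indicator_of_mem (show x ∈ {x | f x < r'} from hr') (fun _ => (1 : ℝ))).symm
    · refine ContinuousAt.congr (f := fun _ => (0 : ℝ)) continuousAt_const ?_
      filter_upwards [gt_mem_nhds h] with r' hr'
      exact (Set.indicator_of_notMem (show x ∉ {x | f x < r'} from not_lt.2 (le_of_lt hr')) (fun _ => (1 : ℝ))).symm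

/-- Mass below `r'` and mass above `r` force, by connectedness, a point of `S` in the open slab
between; the slab is then a nonempty open set of positive volume. -/
lemma volume_real_lt_strict (hf : f ≠ 0) (hopen : IsOpen S) (hconv : Convex ℝ S) (hfin : volume S ≠ ⊤)
    {r r' : ℝ} (hr : r < r') (h0 : 0 < volume.real (S ∩ {x | f x < r'}))
    (h1 : volume.real (S ∩ {x | f x < r}) < volume.real S) :
    volume.real (S ∩ {x | f x < r}) < volume.real (S ∩ {x | f x < r'}) := by
  have hmidopen : IsOpen (S ∩ {x | r < f x ∧ f x < r'}) :=
    hopen.inter ((isOpen_lt continuous_const f.continuous).inter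
      (isOpen_lt f.continuous continuous_const))
  have hmid : (S ∩ {x | r < f x ∧ f x < r'}).Nonempty := by
    obtain ⟨x, hx, hxr⟩ : (S ∩ {x | f x < r'}).Nonempty := by
      by_contra hc
      rw [Set.not_nonempty_iff_eq_empty] at hc
      simp [hc] at h0
    obtain ⟨y, hy, hyr⟩ : (S ∩ {x | r < f x}).Nonempty := by
      by_contra hc
      rw [Set.not_nonempty_iff_eq_empty] at hc
      have := volume_real_gt hf hfin r
      rw [hc, measureReal_empty] at this
      linarith
    change f x < r' at hxr
    change r < f y at hyr
    by_cases hxr' : r < f x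
    · exact ⟨x, hx, hxr', hxr⟩
    by_cases hyr' : f y < r'
    · exact ⟨y, hy, hyr, hyr'⟩
    have := hconv.isPreconnected.image f f.continuous.continuousOn
    obtain ⟨w, hw, hwv⟩ := (this.ordConnected.out ⟨x, hx, rfl⟩ ⟨y, hy, rfl⟩)
      (show (r + r') / 2 ∈ Set.Icc (f x) (f y) by constructor <;> linarith)
    exact ⟨w, hw, by rw [Set.mem_ofPred_eq]; constructor <;> linarith⟩
  have hdisj : Disjoint (S ∩ {x | f x < r}) (S ∩ {x | r < f x ∧ f x < r'}) := by
    rw [Set.disjoint_left]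
    rintro x ⟨_, hx⟩ ⟨_, hx', _⟩
    exact lt_asymm hx hx'
  have hpos : 0 < volume.real (S ∩ {x | r < f x ∧ f x < r'}) :=
    ENNReal.toReal_pos (hmidopen.measure_pos _ hmid).ne'
      (measure_ne_top_of_subset Set.inter_subset_left hfin)
  have hun := measureReal_union (μ := volume) hdisj hmidopen.measurableSet
    (measure_ne_top_of_subset Set.inter_subset_left hfin)
    (measure_ne_top_of_subset Set.inter_subset_left hfin)
  have hle : volume.real (S ∩ {x | f x < r} ∪ S ∩ {x | r < f x ∧ f x < r'}) ≤
      volume.real (S ∩ {x | f x < r'}) := by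
    refine measureReal_mono ?_ (measure_ne_top_of_subset Set.inter_subset_left hfin)
    rintro x (⟨hx, hx'⟩ | ⟨hx, hx'⟩)
    · exact ⟨hx, lt_trans hx' hr⟩
    · exact ⟨hx, hx'.2⟩
  linarith

end levels

/-- The equality case of the one-dimensional transport inequality behind the Brunn–Minkowski
inequality for a body and its reflection: the distribution function `A` is symmetric. -/
lemma exists_symmetric_of_transport {A B : ℝ → ℝ} {m : ℝ} (hm : 0 < m) (hA : Monotone A)
    (hAc : Continuous A) (hAs : ∀ r r', r < r' → 0 < A r' → A r < m → A r < A r')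
    (hA0 : ∃ r, A r = 0) (hAm : ∃ r, A r = m) (hAnn : ∀ r, 0 ≤ A r) (hAle : ∀ r, A r ≤ m)
    (hB : Monotone B) (hBs : ∀ r r', r < r' → 0 < B r' → B r < m → B r < B r') (hBnn : ∀ r, 0 ≤ B r)
    (hBle : ∀ r, B r ≤ m) (h1 : ∀ r q, A r * (m - A q) ≤ B ((r - q) / 2) ^ 2)
    (h2 : ∀ r q, (m - A r) * A q ≤ (m - B ((r - q) / 2)) ^ 2) :
    ∃ C, ∀ r, A r + A (C - r) = m := by
  have hq : ∀ s : ℝ, ∃ r, 0 < s → s < m → A r = s := by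
    intro s
    by_cases hs : 0 < s ∧ s < m
    · obtain ⟨r₀, hr₀⟩ := hA0
      obtain ⟨r₁, hr₁⟩ := hAm
      obtain ⟨r, hr⟩ := mem_range_of_exists_le_of_exists_ge hAc ⟨r₀, hr₀.le.trans hs.1.le⟩
        ⟨r₁, hs.2.le.trans hr₁.ge⟩
      exact ⟨r, fun _ _ => hr⟩
    · exact ⟨0, fun a b => absurd ⟨a, b⟩ hs⟩
  -- `a` is the quantile function of `A` on `(0, m)`; its values elsewhere are irrelevant.
  choose a ha using hq
  have huniq : ∀ x s, 0 < s → s < m → A x = s → x = a s := by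
    intro x s hs0 hsm hx
    have has := ha s hs0 hsm
    rcases lt_trichotomy x (a s) with h | h | h
    · have := hAs _ _ h (by linarith) (by linarith); linarith
    · exact h
    · have := hAs _ _ h (by linarith) (by linarith); linarith
  have hmono : ∀ s t, 0 < s → s < t → t < m → a s < a t := by
    intro s t hs hst ht
    by_contra! hc
    have := hA hc
    rw [ha s hs (hst.trans ht), ha t (hs.trans hst) ht] at this
    linarith
  have hright : ∀ t, 0 < t → t < m → ∀ ε > 0, ∃ η > 0, ∀ t', 0 < t' → t' < m → t' < t + η →
      a t' ≤ a t + ε := by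
    intro t ht htm ε hε
    have hat := ha t ht htm
    have := hAs (a t) (a t + ε) (by linarith)
      ((by linarith : 0 < A (a t)).trans_le (hA (by linarith))) (by linarith)
    refine ⟨A (a t + ε) - t, by linarith, fun t' ht' ht'm hlt => ?_⟩
    by_contra! hc
    have h3 := hA hc.le
    rw [ha t' ht' ht'm] at h3
    linarith
  -- At `r = a s` and `q = a (m - s)` the hypotheses `h1` and `h2` bound `B` from below and above by
  -- `s`, which determines the quantiles of `B`.
  have hBk : ∀ s, 0 < s → s < m → B ((a s - a (m - s)) / 2) = s := by
    intro s hs hsm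
    have e1 := ha s hs hsm
    have e2 := ha (m - s) (by linarith) (by linarith)
    have i1 := h1 (a s) (a (m - s))
    have i2 := h2 (a s) (a (m - s))
    rw [e1, e2] at i1 i2
    have i3 := hBnn ((a s - a (m - s)) / 2)
    have i4 := hBle ((a s - a (m - s)) / 2)
    refine le_antisymm ?_ ?_
    · have := abs_le_of_sq_le_sq' (a := m - s) (b := m - B ((a s - a (m - s)) / 2))
        (by nlinarith) (by linarith)
      linarith [this.2]
    · have := abs_le_of_sq_le_sq' (a := s) (b := B ((a s - a (m - s)) / 2)) (by nlinarith) i3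
      exact this.2
  have hstar : ∀ s₁ s₂ σ, 0 < s₁ → s₁ < m → 0 < s₂ → s₂ < m → 0 < σ → σ < m → s₁ * s₂ = σ ^ 2 →
      a σ - a (m - σ) ≤ a s₁ - a (m - s₂) := by
    intro s₁ s₂ σ h10 h1m h20 h2m h0 hσm hprod
    by_contra! hc
    have i1 := h1 (a s₁) (a (m - s₂))
    rw [ha s₁ h10 h1m, ha (m - s₂) (by linarith) (by linarith)] at i1
    have i2 : σ ≤ B ((a s₁ - a (m - s₂)) / 2) :=
      (abs_le_of_sq_le_sq' (by nlinarith) (hBnn _)).2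
    have i3 := hBk σ h0 hσm
    have hlt : B ((a s₁ - a (m - s₂)) / 2) ≤ B ((a σ - a (m - σ)) / 2) := hB (by linarith)
    have := hBs ((a s₁ - a (m - s₂)) / 2) ((a σ - a (m - σ)) / 2) (by linarith)
      (by rw [i3]; exact h0) (by linarith)
    linarith
  -- Discrete form of `a' (m - s) ≤ a' s`, without differentiability. Along a geometric progression
  -- `X (n + 1) * X (n - 1) = X n ^ 2`, so `hstar` bounds each increment of `a` on the reflected
  -- side by one on the direct side. The sum telescopes, up to an index shift absorbed by
  -- monotonicity and by right semicontinuity (`hright`).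
  have hstep : ∀ s s', 0 < s → s < s' → s' < m → a s + a (m - s) ≤ a s' + a (m - s') := by
    intro s s' hs hss' hs'm
    refine le_of_forall_pos_le_add fun ε hε => ?_
    have hs' : 0 < s' := hs.trans hss'
    obtain ⟨η, hη, hcont⟩ := hright (m - s') (by linarith) (by linarith) ε hε
    set L := Real.log (s' / s) with hL
    have hLpos : 0 < L := Real.log_pos ((one_lt_div hs).2 hss')
    obtain ⟨N, hN⟩ := exists_nat_gt (s' * L / η)
    have hNpos : (0 : ℝ) < N := lt_of_le_of_lt (by positivity) hN
    set δ := L / N with hδ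
    have hδpos : 0 < δ := by positivity
    set X : ℝ → ℝ := fun u => s * Real.exp (u * δ) with hX
    have hXpos : ∀ u, 0 < X u := fun u => by positivity
    have hXmono : ∀ u v, u < v → X u < X v := fun u v huv =>
      mul_lt_mul_of_pos_left (Real.exp_lt_exp.2 (mul_lt_mul_of_pos_right huv hδpos)) hs
    have hX0 : X 0 = s := by simp [hX]
    have hXN : X N = s' := by
      simp only [hX, hδ]
      rw [mul_div_cancel₀ _ hNpos.ne', hL, Real.exp_log (by positivity)]
      field_simp
    have hXle : ∀ u ≤ (N : ℝ), X u < m := by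
      intro u hu
      rcases hu.eq_or_lt with rfl | hu
      · rw [hXN]; exact hs'm
      · exact (hXmono _ _ hu).trans (by rw [hXN]; exact hs'm)
    have htel : ∀ n : ℕ, n ≤ N → a (m - X (-1)) - a (m - X (n - 1)) ≤ a (X n) - a (X 0) := by
      intro n
      induction n with
      | zero => intro _; simp
      | succ n ih =>
        intro hn
        have hn' : (n : ℝ) + 1 ≤ N := by exact_mod_cast hn
        have e1 := ih (by omega)
        have e2 := hstar (X (n + 1)) (X (n - 1)) (X n) (hXpos _) (hXle _ hn') (hXpos _)
          (hXle _ (by linarith)) (hXpos _) (hXle _ (by linarith)) (by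
            simp only [hX]
            rw [mul_mul_mul_comm, ← Real.exp_add, mul_pow, ← Real.exp_nat_mul, sq]
            congr 2
            push_cast
            ring)
        push_cast
        rw [add_sub_cancel_right]
        linarith
    have e1 := htel N le_rfl
    rw [hXN, hX0] at e1
    have e2 : a (m - s) < a (m - X (-1)) := by
      have := hXmono (-1) 0 (by norm_num)
      rw [hX0] at this
      exact hmono _ _ (by linarith) (by linarith) (by linarith [hXpos (-1)])
    have e3 : a (m - X (N - 1)) ≤ a (m - s') + ε := by
      refine hcont _ (by linarith [hXle (N - 1) (by linarith)]) (by linarith [hXpos (N - 1)]) ?_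
      have e4 : X (N - 1) = s' * Real.exp (-δ) := by
        rw [← hXN]
        simp only [hX]
        rw [mul_assoc, ← Real.exp_add]
        congr 2
        ring
      have e5 := Real.add_one_le_exp (-δ)
      have e6 : s' * δ < η := by
        rw [hδ, mul_div_assoc', div_lt_iff₀ hNpos]
        rwa [div_lt_iff₀ hη, mul_comm (N : ℝ)] at hN
      rw [e4]
      nlinarith
    linarith
  -- `s ↦ a s + a (m - s)` is nondecreasing and invariant under `s ↦ m - s`, hence constant.
  have hconst : ∀ s, 0 < s → s < m → a s + a (m - s) = a (m / 2) + a (m / 2) := by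
    have hle : ∀ s s', 0 < s → s < s' → s' < m → a s + a (m - s) = a s' + a (m - s') := by
      intro s s' hs hss' hs'
      refine le_antisymm (hstep s s' hs hss' hs') ?_
      have := hstep (m - s') (m - s) (by linarith) (by linarith) (by linarith)
      rw [sub_sub_cancel, sub_sub_cancel] at this
      linarith
    intro s hs hsm
    have hhalf : m - m / 2 = m / 2 := by ring
    rcases lt_trichotomy s (m / 2) with h | h | h
    · rw [hle s (m / 2) hs h (by linarith), hhalf]
    · rw [h, hhalf]
    · rw [← hle (m / 2) s (by linarith) h hsm, hhalf]
  set C := a (m / 2) + a (m / 2) with hC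
  have hinner : ∀ r, 0 < A r → A r < m → A r + A (C - r) = m := by
    intro r h0 hlt
    have e1 := huniq r _ h0 hlt rfl
    have e2 := hconst _ h0 hlt
    rw [show C - r = a (m - A r) by linarith, ha _ (by linarith) (by linarith)]
    ring
  refine ⟨C, fun r => ?_⟩
  by_cases hr : 0 < A r ∧ A r < m
  · exact hinner r hr.1 hr.2
  by_cases hr' : 0 < A (C - r) ∧ A (C - r) < m
  · have := hinner (C - r) hr'.1 hr'.2
    rw [sub_sub_cancel] at this
    linarith
  -- Now `A r` and `A (C - r)` both lie in `{0, m}`. As `C / 2` is the median `a (m / 2)`, one is at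
  -- least `m / 2` and the other at most `m / 2`.
  have hmid := ha (m / 2) (by linarith) (by linarith)
  have hends : ∀ r, ¬ (0 < A r ∧ A r < m) → A r = 0 ∨ A r = m := by
    intro r hr
    rcases (hAnn r).eq_or_lt with h | h
    · exact .inl h.symm
    · exact .inr (le_antisymm (hAle r) (not_lt.1 fun hlt => hr ⟨h, hlt⟩))
  rcases le_total (a (m / 2)) r with h | h
  · have i1 := hA h
    have i2 := hA (show C - r ≤ a (m / 2) by linarith)
    rcases hends r hr with h3 | h3 <;> rcases hends _ hr' with h4 | h4 <;> linarith
  · have i1 := hA h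
    have i2 := hA (show a (m / 2) ≤ C - r by linarith)
    rcases hends r hr with h3 | h3 <;> rcases hends _ hr' with h4 | h4 <;> linarith

section

variable {d : ℕ} {O : Set (RSpace d)}

/-- Half the difference of a point of `O` with `f < r` and one with `f > q` lies in `K` with `f < (r
- q) / 2`. Brunn–Minkowski for these pieces, and for the complementary ones, is the input of the
transport lemma; for `O` itself it gives equal volumes of `K` and `O`. -/
lemma exists_symmetric_distribution (hO : IsOpen O) (hconv : Convex ℝ O)
    (hb : Bornology.IsBounded O) (hne : O.Nonempty)
    (hvol : volume ((1 / 2 : ℝ) • (O - O)) ≤ volume O) {f : StrongDual ℝ (RSpace d)}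
    (hf : f ≠ 0) : ∃ C, ∀ r, volume.real (O ∩ {x | f x < r}) +
      volume.real (O ∩ {x | f x < C - r}) = volume.real O := by
  have hfin : volume O ≠ ⊤ := hb.measure_lt_top.ne
  set K := (1 / 2 : ℝ) • (O - O) with hK
  have hKfin : volume K ≠ ⊤ := ne_top_of_le_ne_top hfin hvol
  have hKle : volume.real K ≤ volume.real O := ENNReal.toReal_mono hfin hvol
  have hKo : IsOpen K := (hO.sub_left).smul₀ (by norm_num)
  have hKc : Convex ℝ K := (hconv.sub hconv).smul _
  have hmemK : ∀ x ∈ O, ∀ y ∈ O, (1 / 2 : ℝ) • (x - y) ∈ K := fun x hx y hy =>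
    Set.smul_mem_smul_set (Set.sub_mem_sub hx hy)
  have hpos : 0 < volume.real O := ENNReal.toReal_pos (hO.measure_pos _ hne).ne' hfin
  have hsubfin : ∀ {S U : Set (RSpace d)}, volume S ≠ ⊤ → volume (S ∩ U) ≠ ⊤ := fun h =>
    measure_ne_top_of_subset Set.inter_subset_left h
  have hBM : ∀ {A B C : Set (RSpace d)}, MeasurableSet A → MeasurableSet B → MeasurableSet C →
      volume C ≠ ⊤ → (∀ x ∈ A, ∀ y ∈ B, (1 / 2 : ℝ) • (x - y) ∈ C) →
      volume.real A * volume.real B ≤ volume.real C ^ 2 := by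
    intro A B C hA hB hC hCfin h
    have := volume_mul_volume_le_of_midpoint hA hB.neg hC fun x hx y hy => by
      simpa using h x hx (-y) hy
    rw [Measure.measure_neg] at this
    simp only [Measure.real]
    rw [← ENNReal.toReal_mul, ← ENNReal.toReal_pow]
    exact ENNReal.toReal_mono (by simp [hCfin]) this
  have hlt := measurableSet_lt_functional f
  have hgt : ∀ r, MeasurableSet {x | r < f x} := fun r =>
    measurableSet_lt measurable_const f.continuous.measurable
  obtain ⟨M, hM⟩ := hb.exists_norm_le
  have hfM : ∀ x ∈ O, |f x| ≤ ‖f‖ * M := fun x hx =>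
    (f.le_opNorm x).trans (mul_le_mul_of_nonneg_left (hM x hx) (norm_nonneg f))
  have hOm := hO.measurableSet
  have hKm := hKo.measurableSet
  have hKeq : ∀ r, volume.real (K ∩ {x | f x < r}) ≤ volume.real O := fun r =>
    (measureReal_mono Set.inter_subset_left hKfin).trans hKle
  have hOO : volume.real O * volume.real O ≤ volume.real K ^ 2 :=
    hBM hOm hOm hKm hKfin hmemK
  have hKO : volume.real K = volume.real O :=
    le_antisymm hKle (abs_le_of_sq_le_sq' (by nlinarith) measureReal_nonneg).2
  refine exists_symmetric_of_transport (A := fun r => volume.real (O ∩ {x | f x < r}))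
    (B := fun r => volume.real (K ∩ {x | f x < r})) hpos (volume_real_lt_mono hfin)
    (volume_real_lt_continuous hf hfin)
    (fun r r' h h0 h1 => volume_real_lt_strict hf hO hconv hfin h h0 h1)
    ⟨-(‖f‖ * M), ?_⟩ ⟨‖f‖ * M + 1, ?_⟩ (fun _ => measureReal_nonneg)
    (fun r => measureReal_mono Set.inter_subset_left hfin)
    (volume_real_lt_mono hKfin)
    (fun r r' h h0 h1 => volume_real_lt_strict hf hKo hKc hKfin h h0 (by rw [hKO]; exact h1))
    (fun _ => measureReal_nonneg) hKeq (fun r q => ?_) (fun r q => ?_)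
  · have : O ∩ {x | f x < -(‖f‖ * M)} = ∅ := by
      refine Set.eq_empty_of_forall_notMem fun x hx => ?_
      have h1 := (abs_le.1 (hfM x hx.1)).1
      have h2 : f x < -(‖f‖ * M) := hx.2
      linarith
    simp [this]
  · have : O ∩ {x | f x < ‖f‖ * M + 1} = O := by
      refine Set.inter_eq_left.2 fun x hx => ?_
      have h1 := (abs_le.1 (hfM x hx)).2
      change f x < _
      linarith
    simp [this]
  · rw [← volume_real_gt hf hfin q]
    refine hBM (hOm.inter (hlt r)) (hOm.inter (hgt q)) (hKm.inter (hlt _)) (hsubfin hKfin) ?_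
    rintro x ⟨hx, hxr⟩ y ⟨hy, hyq⟩
    refine ⟨hmemK x hx y hy, ?_⟩
    simp only [Set.mem_ofPred_eq, map_smul, map_sub, smul_eq_mul] at *
    linarith
  · rw [← hKO, ← volume_real_gt hf hKfin, hKO, ← volume_real_gt hf hfin r]
    refine hBM (hOm.inter (hgt r)) (hOm.inter (hlt q)) (hKm.inter (hgt _)) (hsubfin hKfin) ?_
    rintro x ⟨hx, hxr⟩ y ⟨hy, hyq⟩
    refine ⟨hmemK x hx y hy, ?_⟩
    simp only [Set.mem_ofPred_eq, map_smul, map_sub, smul_eq_mul] at *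
    linarith

/-- A bounded open convex set whose difference body has at most `2 ^ d` times its volume is, up to
closure, symmetric about its centroid. -/
lemma exists_functional_symmetry (hO : IsOpen O) (hconv : Convex ℝ O)
    (hb : Bornology.IsBounded O) (hne : O.Nonempty)
    (hvol : volume ((1 / 2 : ℝ) • (O - O)) ≤ volume O) :
    ∃ e : RSpace d, ∀ f : StrongDual ℝ (RSpace d), f ≠ 0 → ∀ r,
      volume.real (O ∩ {x | f x < r}) + volume.real (O ∩ {x | f x < f e - r}) =
        volume.real O := by
  have hfin : volume O ≠ ⊤ := hb.measure_lt_top.ne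
  have hpos : 0 < volume.real O := ENNReal.toReal_pos (hO.measure_pos _ hne).ne' hfin
  have hFin : IsFiniteMeasure (volume.restrict O) := ⟨by simpa using hfin.lt_top⟩
  have hint : Integrable (fun x : RSpace d => x) (volume.restrict O) := by
    obtain ⟨M, hM⟩ := hb.exists_norm_le
    exact Integrable.of_bound (by fun_prop) M
      ((ae_restrict_iff' hO.measurableSet).2 (Filter.Eventually.of_forall hM))
  -- Twice the centroid. For each `f`, the functions `f` and `C - f` have the same law on `O`;
  -- comparing means gives `C = f e`, so one point `e` serves all functionals.
  refine ⟨(2 / volume.real O) • ∫ x in O, x, fun f hf r => ?_⟩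
  obtain ⟨C, hC⟩ := exists_symmetric_distribution hO hconv hb hne hvol hf
  have hfint := f.integrable_comp hint
  have hmf : Measurable f := f.continuous.measurable
  have hmC : Measurable fun x => C - f x := by fun_prop
  have hmap : (volume.restrict O).map f = (volume.restrict O).map fun x => C - f x := by
    have : IsFiniteMeasure ((volume.restrict O).map f) := Measure.isFiniteMeasure_map _ _
    refine Measure.ext_of_Ici _ _ fun r => ?_
    rw [Measure.map_apply hmf measurableSet_Ici, Measure.map_apply hmC measurableSet_Ici,
      Measure.restrict_apply (hmf measurableSet_Ici), Measure.restrict_apply (hmC measurableSet_Ici)]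
    have h1 : volume.real (f ⁻¹' Set.Ici r ∩ O) =
        volume.real ((fun x => C - f x) ⁻¹' Set.Ici r ∩ O) := by
      have e1 : volume.real (f ⁻¹' Set.Ici r ∩ O) = volume.real (O ∩ {x | r < f x}) := by
        refine measureReal_congr ?_
        filter_upwards [measure_eq_zero_iff_ae_notMem.1 (volume_level_eq_zero hf r)] with x hx
        refine propext ?_
        change (r ≤ f x ∧ x ∈ O) ↔ (x ∈ O ∧ r < f x)
        rw [and_comm]
        exact and_congr_right fun _ => ⟨fun h => lt_of_le_of_ne h fun h' => hx h'.symm, le_of_lt⟩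
      have e2 : volume.real ((fun x => C - f x) ⁻¹' Set.Ici r ∩ O) =
          volume.real (O ∩ {x | f x < C - r}) := by
        refine measureReal_congr ?_
        filter_upwards [measure_eq_zero_iff_ae_notMem.1 (volume_level_eq_zero hf (C - r))]
          with x hx
        refine propext ?_
        change (r ≤ C - f x ∧ x ∈ O) ↔ (x ∈ O ∧ f x < C - r)
        rw [and_comm]
        refine and_congr_right fun _ => ⟨fun h => lt_of_le_of_ne (by linarith) hx, fun h => ?_⟩
        linarith
      rw [e1, e2, volume_real_gt hf hfin]
      linarith [hC r]
    exact (ENNReal.toReal_eq_toReal_iff' (measure_ne_top_of_subset Set.inter_subset_right hfin)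
      (measure_ne_top_of_subset Set.inter_subset_right hfin)).1 h1
  have hmean : ∫ x in O, f x = ∫ x in O, (C - f x) := by
    have e1 := integral_map (μ := volume.restrict O) hmf.aemeasurable (f := fun t : ℝ => t)
      (by fun_prop)
    have e2 := integral_map (μ := volume.restrict O) hmC.aemeasurable (f := fun t : ℝ => t)
      (by fun_prop)
    rw [← e1, ← e2, hmap]
  rw [integral_sub (integrable_const C) hfint, integral_const, smul_eq_mul,
    measureReal_restrict_apply_univ] at hmean
  have hfe : f ((2 / volume.real O) • ∫ x in O, x) = C := by
    rw [map_smul, ← f.integral_comp_comm hint, smul_eq_mul]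
    field_simp
    linarith
  rw [hfe]
  exact hC r

end

/-! ### Central symmetry of the tiles -/

namespace ConvexTiling

variable {d : ℕ} {P T : Set (RSpace d)}

/-- `P` is a fundamental domain for `T`, so a larger volume would make two translates of the half
difference body meet. But `s + (o₁ - o₂) / 2 = t + (o₃ - o₄) / 2` rearranges to `s + (o₁ + o₄) / 2 =
t + (o₂ + o₃) / 2`, a common interior point of two tiles. -/
lemma volume_half_sub_le (h : ConvexTiling P T) (h0 : (0 : RSpace d) ∈ T) :
    volume ((1 / 2 : ℝ) • (interior P - interior P)) ≤ volume (interior P) := by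
  have hfr : volume (frontier P) = 0 := h.convex.addHaar_frontier volume
  have hPint : volume (interior P) = volume P := by
    refine le_antisymm (measure_mono interior_subset) ?_
    calc volume P ≤ volume (interior P ∪ frontier P) :=
          measure_mono (by rw [← closure_eq_interior_union_frontier]; exact subset_closure)
      _ ≤ _ := (measure_union_le _ _).trans (by rw [hfr, add_zero])
  rw [hPint]
  set L := h.translations h0
  have hL : ∀ g : L, (g : RSpace d) ∈ T := fun g => g.2
  have : Countable L := h.countable.to_subtype
  have fund : IsAddFundamentalDomain L P (volume : Measure (RSpace d)) := by
    refine ⟨h.compact.isClosed.measurableSet.nullMeasurableSet,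
      Filter.Eventually.of_forall fun x => ?_, fun s t hst => ?_⟩
    · obtain ⟨t, ht, hx⟩ := h.exists_mem x
      refine ⟨-(⟨t, ht⟩ : L), ?_⟩
      rw [AddSubgroup.vadd_def, vadd_eq_add]
      simpa [neg_add_eq_sub] using hx
    · refine measure_mono_null (t := (s : RSpace d) +ᵥ frontier P) ?_ ?_
      · rintro x ⟨hxs, hxt⟩
        have hxs' : x - s ∈ P := mem_vadd_iff_sub_mem.1 hxs
        have hxt' : x - t ∈ P := mem_vadd_iff_sub_mem.1 hxt
        refine mem_vadd_iff_sub_mem.2 ⟨subset_closure hxs', fun hint => hst ?_⟩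
        exact Subtype.ext (h.eq_of_mem_interior (hL s) (hL t) hint hxt')
      · rw [measure_vadd]; exact hfr
  have hopen : IsOpen ((1 / 2 : ℝ) • (interior P - interior P)) :=
    (isOpen_interior.sub_left).smul₀ (by norm_num)
  by_contra! hlt
  obtain ⟨s, t, hst, hnd⟩ := exists_pair_mem_lattice_not_disjoint_vadd fund
    hopen.measurableSet.nullMeasurableSet hlt
  obtain ⟨x, hxs, hxt⟩ := Set.not_disjoint_iff.1 hnd
  have hxs' : x - s ∈ (1 / 2 : ℝ) • (interior P - interior P) := mem_vadd_iff_sub_mem.1 hxs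
  have hxt' : x - t ∈ (1 / 2 : ℝ) • (interior P - interior P) := mem_vadd_iff_sub_mem.1 hxt
  obtain ⟨_, ⟨o₁, ho₁, o₂, ho₂, rfl⟩, e1⟩ := hxs'
  obtain ⟨_, ⟨o₃, ho₃, o₄, ho₄, rfl⟩, e2⟩ := hxt'
  have hc : ∀ {u v : RSpace d}, u ∈ interior P → v ∈ interior P →
      (1 / 2 : ℝ) • u + (1 / 2 : ℝ) • v ∈ interior P := fun hu hv =>
    h.convex.interior hu hv (by norm_num) (by norm_num) (by norm_num)
  refine hst (Subtype.ext (h.eq_of_mem_interior (hL s) (hL t)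
    (x := (1 / 2 : ℝ) • o₁ + (1 / 2 : ℝ) • o₄ + s) ?_ ?_))
  · rw [add_sub_cancel_right]; exact hc ho₁ ho₄
  · convert interior_subset (hc ho₂ ho₃) using 1
    have e3 : (s : RSpace d) - t = (1 / 2 : ℝ) • (o₃ - o₄) - (1 / 2 : ℝ) • (o₁ - o₂) := by
      simp only at e1 e2
      rw [e1, e2]; abel
    rw [add_sub_assoc, e3]
    module

/-- Minkowski's theorem: the tiles are centrally symmetric. -/
theorem exists_symm (h : ConvexTiling P T) (h0 : (0 : RSpace d) ∈ T) :
    ∃ e : RSpace d, ∀ x ∈ P, e - x ∈ P := by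
  have hb : Bornology.IsBounded (interior P) := h.compact.isBounded.subset interior_subset
  obtain ⟨e, he⟩ := exists_functional_symmetry isOpen_interior h.convex.interior hb
    h.int_nonempty (h.volume_half_sub_le h0)
  refine ⟨e, fun y hy => ?_⟩
  by_contra hc
  -- If `f < u` on `P` and `u < f (e - y)`, the symmetry relation at level `u` makes the part of the
  -- open tile with `f < f e - u` null, although `y` is a limit of interior points and satisfies
  -- this open condition.
  obtain ⟨f, u, hfu, hu⟩ := geometric_hahn_banach_closed_point h.convex h.compact.isClosed hc
  have hf : f ≠ 0 := by
    rintro rfl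
    have := hfu y hy
    simp only [zero_apply] at this hu
    linarith
  have h1 := he f hf u
  have hall : interior P ∩ {x | f x < u} = interior P :=
    Set.inter_eq_left.2 fun x hx => hfu x (interior_subset hx)
  rw [hall] at h1
  have h2 : f y < f e - u := by rw [map_sub] at hu; linarith
  have hopen : IsOpen {x | f x < f e - u} := isOpen_lt f.continuous continuous_const
  rw [← h.closure_interior, mem_closure_iff] at hy
  obtain ⟨z, hz1, hz2⟩ := hy _ hopen h2
  have := (isOpen_interior.inter hopen).measure_pos volume ⟨z, hz2, hz1⟩
  have h3 := ENNReal.toReal_pos this.ne'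
    (measure_ne_top_of_subset Set.inter_subset_left hb.measure_lt_top.ne)
  simp only [Measure.real] at h1
  linarith

end ConvexTiling

/-! ### Tiles around a ridge -/

section

variable {d : ℕ} {P T : Set (RSpace d)}

/-- `x + u` lies on both tiles `s + P` and `t + P`, outside of the plane `x + W`. -/
def IsEdge {d : ℕ} (P : Set (RSpace d)) (W : Submodule ℝ (RSpace d)) (x s t u : RSpace d) : Prop :=
  u ∉ W ∧ x + u - s ∈ P ∧ x + u - t ∈ P

lemma IsEdge.symm {W : Submodule ℝ (RSpace d)} {x s t u : RSpace d} (h : IsEdge P W x s t u) :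
    IsEdge P W x t s u :=
  ⟨h.1, h.2.2, h.2.1⟩

lemma IsEdge.mem_contact {W : Submodule ℝ (RSpace d)} {x s t u : RSpace d}
    (h : IsEdge P W x s t u) : x - s + u ∈ contact P (t - s) := by
  refine ⟨?_, ?_⟩
  · rw [show x - s + u = x + u - s by abel]; exact h.2.1
  · rw [show x - s + u - (t - s) = x + u - t by abel]; exact h.2.2

lemma ker_eq_sup_span {W : Submodule ℝ (RSpace d)} (hW : finrank ℝ W + 2 = d)
    {l : StrongDual ℝ (RSpace d)} (hl : l ≠ 0) (hWl : W ≤ LinearMap.ker l.toLinearMap)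
    {u : RSpace d} (hu : u ∉ W) (hlu : l u = 0) :
    W ⊔ Submodule.span ℝ {u} = LinearMap.ker l.toLinearMap := by
  refine Submodule.eq_of_le_of_finrank_le (sup_le hWl ?_) ?_
  · rw [Submodule.span_singleton_le_iff_mem]; exact hlu
  · have h1 : W < W ⊔ Submodule.span ℝ {u} := by
      refine lt_of_le_of_ne le_sup_left fun h => hu ?_
      rw [h]
      exact Submodule.mem_sup_right (Submodule.mem_span_singleton_self u)
    have h2 := Submodule.finrank_lt_finrank_of_lt h1
    have h3 := finrank_ker_add_one hl
    omega

/-- Functionals vanishing on the codimension-two space `W` form a plane. The functionals `l` and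
`l'` are, up to scaling, dual to `u'` and `u`, so evaluation at the edges gives the coordinates. -/
lemma eq_add_smul_of_edges {W : Submodule ℝ (RSpace d)} (hW : finrank ℝ W + 2 = d)
    {l l' n : StrongDual ℝ (RSpace d)} (hl : l ≠ 0) (hWl : W ≤ LinearMap.ker l.toLinearMap)
    (hWl' : W ≤ LinearMap.ker l'.toLinearMap) (hWn : W ≤ LinearMap.ker n.toLinearMap)
    {u u' : RSpace d} (hu : u ∉ W) (hlu : l u = 0) (hlu' : l u' ≠ 0) (hl'u : l' u ≠ 0)
    (hl'u' : l' u' = 0) : n = (n u' / l u') • l + (n u / l' u) • l' := by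
  set m := n - ((n u' / l u') • l + (n u / l' u) • l') with hm
  have hmu : m u = 0 := by simp [hm, hlu, hl'u]
  have hmu' : m u' = 0 := by simp [hm, hlu', hl'u']
  have hWm : W ≤ LinearMap.ker m.toLinearMap := by
    intro w hw
    have e1 : l w = 0 := hWl hw
    have e2 : l' w = 0 := hWl' hw
    have e3 : n w = 0 := hWn hw
    simp [hm, e1, e2, e3]
  by_contra hne
  have hm0 : m ≠ 0 := sub_ne_zero.2 hne
  have h1 := ker_eq_sup_span hW hm0 hWm hu hmu
  rw [ker_eq_sup_span hW hl hWl hu hlu] at h1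
  have h2 : u' ∈ LinearMap.ker l.toLinearMap := by rw [h1]; exact hmu'
  exact hlu' h2

end

namespace ConvexTiling

variable {d : ℕ} {P T : Set (RSpace d)}

lemma center_mem_interior (h : ConvexTiling P T) {e : RSpace d} (he : ∀ x ∈ P, e - x ∈ P) :
    (1 / 2 : ℝ) • e ∈ interior P := by
  obtain ⟨o, ho⟩ := h.int_nonempty
  have := h.convex.combo_interior_self_mem_interior ho (he o (interior_subset ho))
    (a := 1 / 2) (b := 1 / 2) (by norm_num) (by norm_num) (by norm_num)
  convert this using 1
  module

/-- Otherwise the centre of `r + P` would be a midpoint of two points of `s + P`, forcing `r = s`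
and then `s = t`. -/
lemma add_ne_add_self (h : ConvexTiling P T) {e : RSpace d} (he : ∀ x ∈ P, e - x ∈ P)
    {x s t r : RSpace d} (hs : s ∈ tilesAt P T x) (ht : t ∈ tilesAt P T x) (hr : r ∈ T)
    (hst : s ≠ t) : s + t ≠ r + r := by
  intro hrr
  have hrs : r = s := by
    refine h.eq_of_mem_interior (x := (1 / 2 : ℝ) • e + r) hr hs.1
      (by simpa using h.center_mem_interior he) ?_
    have := h.convex hs.2 (he _ ht.2) (a := 1 / 2) (b := 1 / 2) (by norm_num) (by norm_num)
      (by norm_num)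
    convert this using 1
    have hr' : r = (1 / 2 : ℝ) • (s + t) := by rw [hrr]; module
    rw [hr']
    module
  rw [hrs] at hrr
  exact hst (add_left_cancel hrr).symm

lemma le_ker_of_isNormal {x s t : RSpace d} (hs : s ∈ tilesAt P T x) (ht : t ∈ tilesAt P T x)
    {l : StrongDual ℝ (RSpace d)} (hl : IsNormal P (t - s) l) :
    vectorSpan ℝ (cellAt P T x) ≤ LinearMap.ker l.toLinearMap := by
  rw [← hl.ker]
  exact vectorSpan_cellAt_le hs ht

lemma exists_normal_of_tilesAt (h : ConvexTiling P T) {x s t : RSpace d}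
    (hs : s ∈ tilesAt P T x) (ht : t ∈ tilesAt P T x) (hst : IsNbr P (t - s)) :
    ∃ l, IsNormal P (t - s) l :=
  h.exists_isNormal hs.1 (by simpa using ht.1) hst

lemma exists_isEdge {x s t : RSpace d}
    (hx : finrank ℝ (vectorSpan ℝ (cellAt P T x)) + 2 = d) (hs : s ∈ tilesAt P T x)
    (ht : t ∈ tilesAt P T x) (hst : IsNbr P (t - s)) :
    ∃ u, IsEdge P (vectorSpan ℝ (cellAt P T x)) x s t u := by
  by_contra! hc
  have hmem := mem_contact_of_mem_tilesAt hs ht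
  have hle : vectorSpan ℝ (contact P (t - s)) ≤ vectorSpan ℝ (cellAt P T x) := by
    rw [vectorSpan_eq_span_vsub_set_right ℝ hmem, Submodule.span_le]
    rintro _ ⟨w, hw, rfl⟩
    by_contra hw'
    refine hc (w -ᵥ (x - s)) ⟨hw', ?_, ?_⟩
    · rw [vsub_eq_sub, show x + (w - (x - s)) - s = w by abel]; exact hw.1
    · rw [vsub_eq_sub, show x + (w - (x - s)) - t = w - (t - s) by abel]; exact hw.2
  have := Submodule.finrank_mono hle
  have := hst.2
  omega

lemma apply_edge_eq_zero {W : Submodule ℝ (RSpace d)} {x s t u : RSpace d}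
    (hs : s ∈ tilesAt P T x) (ht : t ∈ tilesAt P T x) {l : StrongDual ℝ (RSpace d)}
    (hl : IsNormal P (t - s) l) (hu : IsEdge P W x s t u) : l u = 0 := by
  have := vsub_mem_vectorSpan ℝ hu.mem_contact (mem_contact_of_mem_tilesAt hs ht)
  rw [hl.ker, vsub_eq_sub, add_sub_cancel_left] at this
  exact this

/-- Maximality of `l` gives `≤`. Equality would make two facets of `s + P` through `x` parallel,
hence equal. -/
lemma apply_edge_neg (h : ConvexTiling P T) {x s t r u : RSpace d}
    (hx : finrank ℝ (vectorSpan ℝ (cellAt P T x)) + 2 = d) (hs : s ∈ tilesAt P T x)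
    (ht : t ∈ tilesAt P T x) (hr : r ∈ tilesAt P T x) (htr : t ≠ r)
    {l l' : StrongDual ℝ (RSpace d)} (hl : IsNormal P (t - s) l) (hl' : IsNormal P (r - s) l')
    (hu : IsEdge P (vectorSpan ℝ (cellAt P T x)) x s r u) : l u < 0 := by
  have hmem := mem_contact_of_mem_tilesAt hs ht
  have hle : l u ≤ 0 := by
    have := ((hl.isMax _).1 hmem).2 (x - s + u) hu.mem_contact.1
    rw [map_add] at this
    linarith
  refine lt_of_le_of_ne hle fun h0 => htr ?_
  have h1 := ker_eq_sup_span hx hl.ne_zero (le_ker_of_isNormal hs ht hl) hu.1 h0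
  have h2 := ker_eq_sup_span hx hl'.ne_zero (le_ker_of_isNormal hs hr hl') hu.1
    (apply_edge_eq_zero hs hr hl' hu)
  have := hl.eq_of_ker_eq h hl' (by rw [← h1, ← h2]) hmem (mem_contact_of_mem_tilesAt hs hr)
  exact sub_left_injective this

/-- A tile has at most two neighbours around a ridge. -/
lemma not_three_nbrs (h : ConvexTiling P T) {x s t₁ t₂ t₃ : RSpace d}
    (hx : finrank ℝ (vectorSpan ℝ (cellAt P T x)) + 2 = d) (hs : s ∈ tilesAt P T x)
    (ht₁ : t₁ ∈ tilesAt P T x) (ht₂ : t₂ ∈ tilesAt P T x) (ht₃ : t₃ ∈ tilesAt P T x)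
    (h₁₂ : t₁ ≠ t₂) (h₁₃ : t₁ ≠ t₃) (h₂₃ : t₂ ≠ t₃) (hn₁ : IsNbr P (t₁ - s))
    (hn₂ : IsNbr P (t₂ - s)) (hn₃ : IsNbr P (t₃ - s)) : False := by
  obtain ⟨l₁, hl₁⟩ := h.exists_normal_of_tilesAt hs ht₁ hn₁
  obtain ⟨l₂, hl₂⟩ := h.exists_normal_of_tilesAt hs ht₂ hn₂
  obtain ⟨l₃, hl₃⟩ := h.exists_normal_of_tilesAt hs ht₃ hn₃
  obtain ⟨u₁, hu₁⟩ := exists_isEdge hx hs ht₁ hn₁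
  obtain ⟨u₂, hu₂⟩ := exists_isEdge hx hs ht₂ hn₂
  obtain ⟨u₃, hu₃⟩ := exists_isEdge hx hs ht₃ hn₃
  have e12 := h.apply_edge_neg hx hs ht₁ ht₂ h₁₂ hl₁ hl₂ hu₂
  have e13 := h.apply_edge_neg hx hs ht₁ ht₃ h₁₃ hl₁ hl₃ hu₃
  have e21 := h.apply_edge_neg hx hs ht₂ ht₁ h₁₂.symm hl₂ hl₁ hu₁
  have e23 := h.apply_edge_neg hx hs ht₂ ht₃ h₂₃ hl₂ hl₃ hu₃
  have e31 := h.apply_edge_neg hx hs ht₃ ht₁ h₁₃.symm hl₃ hl₁ hu₁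
  have e32 := h.apply_edge_neg hx hs ht₃ ht₂ h₂₃.symm hl₃ hl₂ hu₂
  have key := eq_add_smul_of_edges hx hl₁.ne_zero (le_ker_of_isNormal hs ht₁ hl₁)
    (le_ker_of_isNormal hs ht₂ hl₂) (le_ker_of_isNormal hs ht₃ hl₃) hu₁.1
    (apply_edge_eq_zero hs ht₁ hl₁ hu₁) e12.ne e21.ne (apply_edge_eq_zero hs ht₂ hl₂ hu₂)
  have h0 := apply_edge_eq_zero hs ht₃ hl₃ hu₃
  have hα : 0 < l₃ u₂ / l₁ u₂ := div_pos_of_neg_of_neg e32 e12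
  have hβ : 0 < l₃ u₁ / l₂ u₁ := div_pos_of_neg_of_neg e31 e21
  -- The third normal is a positive combination of the other two, both negative on the third edge,
  -- yet it vanishes there.
  have h3 : l₃ u₃ = l₃ u₂ / l₁ u₂ * l₁ u₃ + l₃ u₁ / l₂ u₁ * l₂ u₃ := by
    conv_lhs => rw [key]
    simp
  nlinarith

/-- A facet normal to a ridge is not strictly negative on both edges of a tile at this ridge. -/
lemma not_neg_on_edges (h : ConvexTiling P T) {x s t r u u' v : RSpace d}
    (hx : finrank ℝ (vectorSpan ℝ (cellAt P T x)) + 2 = d) (hs : s ∈ tilesAt P T x)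
    (ht : t ∈ tilesAt P T x) (hr : r ∈ tilesAt P T x) (htr : t ≠ r) (hnt : IsNbr P (t - s))
    (hnr : IsNbr P (r - s)) (hu : IsEdge P (vectorSpan ℝ (cellAt P T x)) x s t u)
    (hu' : IsEdge P (vectorSpan ℝ (cellAt P T x)) x s r u') {n : StrongDual ℝ (RSpace d)}
    (hn : IsNormal P v n) (hWn : vectorSpan ℝ (cellAt P T x) ≤ LinearMap.ker n.toLinearMap) :
    ¬ (n u < 0 ∧ n u' < 0) := by
  rintro ⟨hnu, hnu'⟩
  obtain ⟨l, hl⟩ := h.exists_normal_of_tilesAt hs ht hnt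
  obtain ⟨l', hl'⟩ := h.exists_normal_of_tilesAt hs hr hnr
  have e1 := h.apply_edge_neg hx hs ht hr htr hl hl' hu'
  have e2 := h.apply_edge_neg hx hs hr ht htr.symm hl' hl hu
  have key := eq_add_smul_of_edges hx hl.ne_zero (le_ker_of_isNormal hs ht hl)
    (le_ker_of_isNormal hs hr hl') hWn hu.1
    (apply_edge_eq_zero hs ht hl hu) e1.ne e2.ne (apply_edge_eq_zero hs hr hl' hu')
  set α := n u' / l u' with hα
  set β := n u / l' u with hβ
  have hα0 : 0 < α := div_pos_of_neg_of_neg hnu' e1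
  have hβ0 : 0 < β := div_pos_of_neg_of_neg hnu e2
  have hn' : ∀ y, n y = α * l y + β * l' y := fun y => by
    conv_lhs => rw [key]
    simp
  have hmt := (hl.isMax _).1 (mem_contact_of_mem_tilesAt hs ht)
  have hmr := (hl'.isMax _).1 (mem_contact_of_mem_tilesAt hs hr)
  -- Since `n` is a positive combination of `l` and `l'`, its maximal face lies in both facets at
  -- the ridge and is too small to be a facet.
  have hF : ∀ y ∈ contact P v, l y = l (x - s) ∧ l' y = l' (x - s) := by
    intro y hy
    have h1 := ((hn.isMax y).1 hy).2 (x - s) hmt.1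
    rw [hn', hn'] at h1
    have h2 := hmt.2 y hy.1
    have h3 := hmr.2 y hy.1
    constructor <;> nlinarith
  have hle : LinearMap.ker n.toLinearMap ≤ LinearMap.ker l.toLinearMap ⊓
      LinearMap.ker l'.toLinearMap := by
    rw [← hn.ker, vectorSpan_def, Submodule.span_le]
    rintro _ ⟨a, ha, b, hb, rfl⟩
    simp [hF a ha, hF b hb]
  have hk := finrank_ker_add_one hn.ne_zero
  have hkl := finrank_ker_add_one hl.ne_zero
  have heq := Submodule.eq_of_le_of_finrank_eq (hle.trans inf_le_left) (by omega)
  have : u ∈ LinearMap.ker l'.toLinearMap := (hle.trans inf_le_right)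
    (by rw [heq]; exact apply_edge_eq_zero hs ht hl hu)
  exact e2.ne this

/-- The neighbours along facets parallel to a ridge that is surrounded by three pairwise
neighbouring tiles. -/
lemma belt_of_three_tiles (h : ConvexTiling P T) {x s t r v : RSpace d}
    (hx : finrank ℝ (vectorSpan ℝ (cellAt P T x)) + 2 = d) (hs : s ∈ tilesAt P T x)
    (ht : t ∈ tilesAt P T x) (hr : r ∈ tilesAt P T x) (hst : IsNbr P (t - s))
    (hsr : IsNbr P (r - s)) (htr : IsNbr P (r - t)) {n : StrongDual ℝ (RSpace d)}
    (hn : IsNormal P v n) (hv : (contact P v).Nonempty)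
    (hWn : vectorSpan ℝ (cellAt P T x) ≤ LinearMap.ker n.toLinearMap) :
    v = t - s ∨ v = s - t ∨ v = r - s ∨ v = s - r ∨ v = r - t ∨ v = t - r := by
  have hst' := hst.neg
  have hsr' := hsr.neg
  have htr' := htr.neg
  rw [neg_sub] at hst' hsr' htr'
  have hne : ∀ {a b : RSpace d}, IsNbr P (a - b) → a ≠ b := fun hab h0 =>
    h.isNbr_ne_zero hab (sub_eq_zero.2 h0)
  obtain ⟨u₁, hu₁⟩ := exists_isEdge hx hs ht hst
  obtain ⟨u₂, hu₂⟩ := exists_isEdge hx hs hr hsr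
  obtain ⟨u₃, hu₃⟩ := exists_isEdge hx ht hr htr
  -- If `n` vanishes on an edge it is proportional to the normal of that facet, and the sign of the
  -- factor selects the facet or its opposite.
  have hzero : ∀ {a b u : RSpace d}, a ∈ tilesAt P T x → b ∈ tilesAt P T x → IsNbr P (b - a) →
      IsEdge P (vectorSpan ℝ (cellAt P T x)) x a b u → n u = 0 → v = b - a ∨ v = a - b := by
    intro a b u ha hb hab hu hnu
    obtain ⟨l, hl⟩ := h.exists_normal_of_tilesAt ha hb hab
    have h1 := ker_eq_sup_span hx hn.ne_zero hWn hu.1 hnu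
    rw [ker_eq_sup_span hx hl.ne_zero (le_ker_of_isNormal ha hb hl) hu.1
      (apply_edge_eq_zero ha hb hl hu)] at h1
    obtain ⟨κ, hκ⟩ := exists_eq_smul_of_ker_le hn.ne_zero h1.ge
    have hκ0 : κ ≠ 0 := by rintro rfl; exact hl.ne_zero (by simp [hκ])
    rcases lt_or_gt_of_ne hκ0 with h2 | h2
    · right
      have hl2 : IsNormal P (a - b) ((-κ) • n) := by
        have := hl.neg
        have hn' : (-κ) • n = -(κ • n) := by ext y; simp
        rw [hn']
        rwa [neg_sub, hκ] at this
      exact hn.eq_of_pos_smul h (by linarith) hl2 hv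
    · left
      exact hn.eq_of_pos_smul h h2 (hκ ▸ hl) hv
  by_cases h1 : n u₁ = 0
  · rcases hzero hs ht hst hu₁ h1 with h | h <;> simp [h]
  by_cases h2 : n u₂ = 0
  · rcases hzero hs hr hsr hu₂ h2 with h | h <;> simp [h]
  by_cases h3 : n u₃ = 0
  · rcases hzero ht hr htr hu₃ h3 with h | h <;> simp [h]
  have hWn' : vectorSpan ℝ (cellAt P T x) ≤ LinearMap.ker (-n).toLinearMap := fun w hw => by
    have : n w = 0 := hWn hw
    simp [this]
  -- Of three nonzero values of `n` on the edges, two have the same sign. Any two of the edges bound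
  -- one of the three tiles, which is excluded for both `n` and `-n`.
  have a1 := h.not_neg_on_edges hx hs ht hr (hne htr').symm.symm hst hsr hu₁ hu₂ hn hWn
  have a2 := h.not_neg_on_edges hx hs ht hr (hne htr') hst hsr hu₁ hu₂ hn.neg hWn'
  have b1 := h.not_neg_on_edges hx ht hs hr (hne hsr') hst' htr hu₁.symm hu₃ hn hWn
  have b2 := h.not_neg_on_edges hx ht hs hr (hne hsr') hst' htr hu₁.symm hu₃ hn.neg hWn'
  have c1 := h.not_neg_on_edges hx hr hs ht (hne hst') hsr' htr' hu₂.symm hu₃.symm hn hWn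
  have c2 := h.not_neg_on_edges hx hr hs ht (hne hst') hsr' htr' hu₂.symm hu₃.symm hn.neg hWn'
  simp only [neg_apply, neg_lt_zero] at a2 b2 c2
  rcases lt_or_gt_of_ne h1 with h1 | h1 <;> rcases lt_or_gt_of_ne h2 with h2 | h2 <;>
    rcases lt_or_gt_of_ne h3 with h3 | h3 <;> simp_all

end ConvexTiling

/-! ### Local potentials around ridges -/

namespace ConvexTiling

variable {d : ℕ} {P T : Set (RSpace d)} {a : RSpace d → RSpace d}

lemma isPot_congr {x y : RSpace d} (hxy : tilesAt P T y = tilesAt P T x) {p : RSpace d → RSpace d}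
    (hp : IsPot P T a {y} p) : IsPot P T a {x} p := by
  rintro _ rfl s hs t ht hst
  exact hp y rfl s (hxy ▸ hs) t (hxy ▸ ht) hst

/-- Two tiles that contain a ridge but not a common facet determine a central symmetry of the
system of tiles around this ridge. -/
lemma add_sub_mem_tilesAt (h : ConvexTiling P T) (h0 : (0 : RSpace d) ∈ T) {e : RSpace d}
    (he : ∀ x ∈ P, e - x ∈ P) {x s t r : RSpace d}
    (hx : finrank ℝ (vectorSpan ℝ (cellAt P T x)) + 2 = d) (hrel : RelInt (cellAt P T x) x)
    (hs : s ∈ tilesAt P T x) (ht : t ∈ tilesAt P T x) (hne : s ≠ t) (hn : ¬ IsNbr P (t - s))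
    (hr : r ∈ tilesAt P T x) : s + t - r ∈ tilesAt P T x := by
  have hmem := mem_contact_of_mem_tilesAt hs ht
  -- Not being neighbours, `s` and `t` share no more directions than the cell, so `x` is a relative
  -- interior point of their intersection.
  have hW : vectorSpan ℝ (cellAt P T x) = vectorSpan ℝ (contact P (t - s)) := by
    refine Submodule.eq_of_le_of_finrank_le (vectorSpan_cellAt_le hs ht) ?_
    have h1 := h.finrank_contact_lt hs.1 ht.1 hne
    have h2 : ¬ finrank ℝ (vectorSpan ℝ (contact P (t - s))) + 1 = d := fun h2 => hn ⟨⟨_, hmem⟩, h2⟩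
    omega
  have hG : RelInt {y | y - s ∈ P ∧ y - t ∈ P} x := by
    refine ⟨⟨hs.2, ht.2⟩, fun y hy => ?_⟩
    have hy' : y - s ∈ contact P (t - s) :=
      ⟨hy.1, by rw [show y - s - (t - s) = y - t by abel]; exact hy.2⟩
    have := vsub_mem_vectorSpan ℝ hmem hy'
    rw [← hW, vsub_eq_sub, sub_sub_sub_cancel_right] at this
    obtain ⟨ε, hε, hmem'⟩ := hrel.exists_add_smul_mem (h.cellAt_convex x) this
    exact ⟨ε, hε, hmem' s hs, hmem' t ht⟩
  -- The reflection `y ↦ e + s + t - y` swaps the tiles `s` and `t`, so the image of `x` lies in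
  -- their intersection and hence in the tile `r`. Reflecting back sends `r` to `s + t - r`.
  have h1 := h.mem_of_relInt hs.1 hr.1 (fun y hy => hy.1) hG hr.2 (y := e + s + t - x)
    ⟨by rw [show e + s + t - x - s = e - (x - t) by abel]; exact he _ ht.2,
      by rw [show e + s + t - x - t = e - (x - s) by abel]; exact he _ hs.2⟩
  refine ⟨h.sub_mem h0 (h.add_mem h0 hs.1 ht.1) hr.1, ?_⟩
  have := he _ h1
  rwa [show e - (e + s + t - x - r) = x - (s + t - r) by abel] at this

lemma exists_isPot_of_triples {x : RSpace d}
    (hnbr : ∀ s ∈ tilesAt P T x, ∀ t ∈ tilesAt P T x, s ≠ t → IsNbr P (t - s))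
    (hneg : ∀ s ∈ tilesAt P T x, ∀ t ∈ tilesAt P T x, IsNbr P (t - s) → a (s - t) = -a (t - s))
    (ha0 : a 0 = 0) (htri : ∀ s ∈ tilesAt P T x, ∀ t ∈ tilesAt P T x, ∀ r ∈ tilesAt P T x,
      IsNbr P (t - s) → IsNbr P (r - s) → IsNbr P (r - t) → a (r - s) = a (r - t) + a (t - s))
    (hne : (tilesAt P T x).Nonempty) : ∃ p, IsPot P T a {x} p := by
  obtain ⟨s, hs⟩ := hne
  refine ⟨fun t => a (t - s), ?_⟩
  rintro _ rfl t ht r hr htr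
  by_cases h1 : t = s
  · subst h1; simp [ha0]
  by_cases h2 : r = s
  · subst h2; simp [ha0, hneg t ht r hr htr]
  simp only [htri s hs t ht r hr (hnbr s hs t ht (Ne.symm h1)) (hnbr s hs r hr (Ne.symm h2)) htr,
    add_sub_cancel_right]

/-- Composing two of the symmetries of `add_sub_mem_tilesAt` gives a translation of a finite set, so
all non-neighbouring pairs have sum `s + t`. Any other tile `r` has a mirror image `r' = s + t - r`,
and the bound of two neighbours per tile leaves only `s, r, t, r'`. In this parallelogram `t - r =
r' - s` and `t - r' = r - s`, so odd increments close up. -/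
lemma exists_isPot_of_not_isNbr (h : ConvexTiling P T) (h0 : (0 : RSpace d) ∈ T) {e : RSpace d}
    (he : ∀ x ∈ P, e - x ∈ P) {x s t : RSpace d}
    (hx : finrank ℝ (vectorSpan ℝ (cellAt P T x)) + 2 = d) (hrel : RelInt (cellAt P T x) x)
    (hs : s ∈ tilesAt P T x) (ht : t ∈ tilesAt P T x) (hne : s ≠ t) (hn : ¬ IsNbr P (t - s))
    (hneg : ∀ s ∈ tilesAt P T x, ∀ t ∈ tilesAt P T x, IsNbr P (t - s) → a (s - t) = -a (t - s)) :
    ∃ p, IsPot P T a {x} p := by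
  classical
  have hsym : ∀ {b c : RSpace d}, IsNbr P (b - c) → IsNbr P (c - b) := fun hb => by
    simpa using hb.neg
  have hself : ∀ b : RSpace d, ¬ IsNbr P (b - b) := fun b hb => h.isNbr_ne_zero hb (sub_self b)
  have huniq : ∀ b ∈ tilesAt P T x, ∀ c ∈ tilesAt P T x, b ≠ c → ¬ IsNbr P (c - b) →
      b + c = s + t := by
    intro b hb c hc hbc hbn
    have := eq_zero_of_add_mem (S := tilesAt P T x) (w := s + t - (b + c))
      (h.tilesAt_finite x).isBounded ⟨s, hs⟩ fun y hy => ?_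
    · exact (sub_eq_zero.1 this).symm
    · have h1 := h.add_sub_mem_tilesAt h0 he hx hrel hb hc hbc hbn hy
      have h2 := h.add_sub_mem_tilesAt h0 he hx hrel hs ht hne hn h1
      rwa [show s + t - (b + c - y) = y + (s + t - (b + c)) by abel] at h2
  by_cases hr : ∃ r ∈ tilesAt P T x, r ≠ s ∧ r ≠ t
  swap
  · push Not at hr
    refine ⟨0, ?_⟩
    rintro _ rfl b hb c hc hbc
    by_cases hbs : b = s
    · subst hbs
      by_cases hcs : c = b
      · exact absurd (hcs ▸ hbc) (hself _)
      · exact absurd (hr c hc hcs ▸ hbc) hn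
    · have hbt := hr b hb hbs
      by_cases hcs : c = s
      · exact absurd (hcs ▸ hbt ▸ hbc) fun hc => hn (hsym hc)
      · exact absurd (hr c hc hcs ▸ hbt ▸ hbc) (hself _)
  obtain ⟨r, hr, hrs, hrt⟩ := hr
  obtain ⟨r', hr'def⟩ : ∃ r', r' = s + t - r := ⟨_, rfl⟩
  have hr' : r' ∈ tilesAt P T x := hr'def ▸ h.add_sub_mem_tilesAt h0 he hx hrel hs ht hne hn hr
  have hrr' : r ≠ r' := fun hrr => h.add_ne_add_self he hs ht hr.1 hne (by
    rwa [← hrr, eq_comm, sub_eq_iff_eq_add] at hr'def)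
  have hr's : r' ≠ s := fun h1 => hrt (by
    rw [hr'def, sub_eq_iff_eq_add] at h1; exact (add_left_cancel h1).symm)
  have hr't : r' ≠ t := fun h1 => hrs (by
    rw [hr'def, sub_eq_iff_eq_add, add_comm] at h1; exact (add_left_cancel h1).symm)
  have hnbr : ∀ b ∈ tilesAt P T x, ∀ c ∈ tilesAt P T x, b ≠ c → b + c ≠ s + t → IsNbr P (c - b) :=
    fun b hb c hc hbc hbc' => by
      by_contra hcon
      exact hbc' (huniq b hb c hc hbc hcon)
  have hsr := hnbr s hs r hr hrs.symm (by simpa using hrt)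
  have hsr' := hnbr s hs r' hr' hr's.symm (by simpa using hr't)
  have htr := hnbr r hr t ht hrt (by simpa using hrs)
  have hrn : ¬ IsNbr P (r' - r) := fun hrn =>
    h.not_three_nbrs hx hr hs ht hr' hne hr's.symm hr't.symm (hsym hsr) htr hrn
  have hall : ∀ b ∈ tilesAt P T x, b = s ∨ b = t ∨ b = r ∨ b = r' := by
    intro b hb
    by_contra! hb'
    exact h.not_three_nbrs hx hs hr hr' hb hrr' hb'.2.2.1.symm hb'.2.2.2.symm hsr hsr'
      (hnbr s hs b hb hb'.1.symm (by simpa using hb'.2.1))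
  have e1 : t - r = r' - s := by rw [hr'def]; abel
  have e2 : t - r' = r - s := by rw [hr'def]; abel
  obtain ⟨p, ps, pt, pr, pr'⟩ : ∃ p : RSpace d → RSpace d, p s = 0 ∧ p t = a (r - s) + a (r' - s) ∧
      p r = a (r - s) ∧ p r' = a (r' - s) :=
    ⟨fun y => if y = s then 0 else if y = t then a (r - s) + a (r' - s) else a (y - s),
      by simp, by simp [hne.symm], by simp [hrs, hrt], by simp [hr's, hr't]⟩
  have hrev : ∀ b ∈ tilesAt P T x, ∀ c ∈ tilesAt P T x, IsNbr P (c - b) → p b - p c = a (b - c) →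
      p c - p b = a (c - b) := by
    intro b hb c hc hbc hp
    rw [hneg b hb c hc hbc, ← neg_sub, neg_inj] at hp
    exact hp
  have g1 : p r - p s = a (r - s) := by rw [pr, ps, sub_zero]
  have g2 : p r' - p s = a (r' - s) := by rw [pr', ps, sub_zero]
  have g3 : p t - p r = a (t - r) := by rw [pt, pr, e1]; abel
  have g4 : p t - p r' = a (t - r') := by rw [pt, pr', e2]; abel
  refine ⟨p, fun y hy b hb c hc hbc => ?_⟩
  rw [show y = x from hy] at hb hc
  rcases hall b hb with rfl | rfl | rfl | rfl <;> rcases hall c hc with h2 | h2 | h2 | h2 <;>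
    rw [h2] at hbc hc ⊢
  · exact absurd hbc (hself _)
  · exact absurd hbc hn
  · exact g1
  · exact g2
  · exact absurd (hsym hbc) hn
  · exact absurd hbc (hself _)
  · exact hrev _ hb _ hc hbc g3
  · exact hrev _ hb _ hc hbc g4
  · exact hrev _ hb _ hc hbc g1
  · exact g3
  · exact absurd hbc (hself _)
  · exact absurd hbc hrn
  · exact hrev _ hb _ hc hbc g2
  · exact g4
  · exact absurd (hsym hbc) hrn
  · exact absurd hbc (hself _)

lemma exists_isPot_local (h : ConvexTiling P T) (h0 : (0 : RSpace d) ∈ T) {e : RSpace d}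
    (he : ∀ x ∈ P, e - x ∈ P) (ha0 : a 0 = 0)
    (hneg : ∀ v ∈ T, IsNbr P v → a (-v) = -a v)
    (htri : ∀ x, finrank ℝ (vectorSpan ℝ (cellAt P T x)) + 2 = d →
      ∀ s ∈ tilesAt P T x, ∀ t ∈ tilesAt P T x, ∀ r ∈ tilesAt P T x,
      IsNbr P (t - s) → IsNbr P (r - s) → IsNbr P (r - t) → a (r - s) = a (r - t) + a (t - s))
    {x : RSpace d} (hx : x ∉ skel P T 3) : ∃ p, IsPot P T a {x} p := by
  have hneg' : ∀ y, ∀ s ∈ tilesAt P T y, ∀ t ∈ tilesAt P T y, IsNbr P (t - s) →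
      a (s - t) = -a (t - s) := fun y s hs t ht hst => by
    rw [← hneg _ (h.sub_mem h0 ht.1 hs.1) hst, neg_sub]
  by_cases hx2 : x ∈ skel P T 2
  · have hx2' : finrank ℝ (vectorSpan ℝ (cellAt P T x)) + 2 = d := by
      have h1 : finrank ℝ (vectorSpan ℝ (cellAt P T x)) + 2 ≤ d := hx2
      have h2 : ¬ finrank ℝ (vectorSpan ℝ (cellAt P T x)) + 3 ≤ d := hx
      omega
    by_cases hn : ∀ s ∈ tilesAt P T x, ∀ t ∈ tilesAt P T x, s ≠ t → IsNbr P (t - s)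
    · exact exists_isPot_of_triples hn (hneg' x) ha0 (htri x hx2') (h.tilesAt_nonempty x)
    · push Not at hn
      obtain ⟨s, hs, t, ht, hne, hn⟩ := hn
      obtain ⟨y, hy, hrel⟩ := h.exists_relInt_tilesAt_eq x
      have hc : cellAt P T y = cellAt P T x := by simp only [cellAt, hy]
      obtain ⟨p, hp⟩ := h.exists_isPot_of_not_isNbr (a := a) h0 he (by rwa [hc]) (by rwa [hc])
        (hy ▸ hs) (hy ▸ ht) hne hn (hneg' y)
      exact ⟨p, isPot_congr hy hp⟩
  -- In codimension at most one the triangle condition is vacuous: the cell spans the kernel of each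
  -- facet normal, so two neighbours of one tile coincide.
  · refine exists_isPot_of_triples
      (fun s hs t ht hne => h.isNbr_of_notMem_skel hx2 hs ht hne) (hneg' x) ha0 ?_
      (h.tilesAt_nonempty x)
    intro s hs t ht r hr hst hsr htr
    exfalso
    obtain ⟨l, hl⟩ := h.exists_normal_of_tilesAt hs ht hst
    obtain ⟨l', hl'⟩ := h.exists_normal_of_tilesAt hs hr hsr
    have hk : ∀ {m : StrongDual ℝ (RSpace d)}, m ≠ 0 →
        vectorSpan ℝ (cellAt P T x) ≤ LinearMap.ker m.toLinearMap →
        vectorSpan ℝ (cellAt P T x) = LinearMap.ker m.toLinearMap := fun hm hle => by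
      refine Submodule.eq_of_le_of_finrank_le hle ?_
      have h1 := finrank_ker_add_one hm
      have h2 : ¬ finrank ℝ (vectorSpan ℝ (cellAt P T x)) + 2 ≤ d := hx2
      omega
    have := hl.eq_of_ker_eq h hl' (by
      rw [← hk hl.ne_zero (le_ker_of_isNormal hs ht hl),
        ← hk hl'.ne_zero (le_ker_of_isNormal hs hr hl')])
      (mem_contact_of_mem_tilesAt hs ht) (mem_contact_of_mem_tilesAt hs hr)
    exact h.isNbr_ne_zero htr (by rw [sub_left_injective this, sub_self])

end ConvexTiling

/-! ### Belts, antipodal pairs and the Venkov graph -/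

lemma ncard_six_vectors {d : ℕ} {p q : RSpace d} (h1 : p ≠ 0) (h2 : q ≠ 0) (h3 : p ≠ q)
    (h4 : p + q ≠ 0) (h5 : q ≠ p + p) (h6 : p ≠ q + q) :
    ({p, -p, q, -q, q - p, p - q} : Set (RSpace d)).ncard = 6 := by
  have g1 : p ≠ -p := fun h => h1 (by linear_combination (norm := module) (1 / 2 : ℝ) • h)
  have g2 : q ≠ -q := fun h => h2 (by linear_combination (norm := module) (1 / 2 : ℝ) • h)
  have g3 : q - p ≠ p - q := fun h => h3 (by linear_combination (norm := module) (-1 / 2 : ℝ) • h)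
  have g4 : p ≠ -q := fun h => h4 (by linear_combination (norm := module) (1 : ℝ) • h)
  have g5 : p ≠ q - p := fun h => h5 (by linear_combination (norm := module) (-1 : ℝ) • h)
  have g6 : p ≠ p - q := fun h => h2 (by linear_combination (norm := module) (1 : ℝ) • h)
  have g7 : -p ≠ q := fun h => h4 (by linear_combination (norm := module) (-1 : ℝ) • h)
  have g8 : -p ≠ -q := fun h => h3 (by linear_combination (norm := module) (-1 : ℝ) • h)
  have g9 : -p ≠ q - p := fun h => h2 (by linear_combination (norm := module) (-1 : ℝ) • h)
  have g10 : -p ≠ p - q := fun h => h5 (by linear_combination (norm := module) (1 : ℝ) • h)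
  have g11 : q ≠ q - p := fun h => h1 (by linear_combination (norm := module) (1 : ℝ) • h)
  have g12 : q ≠ p - q := fun h => h6 (by linear_combination (norm := module) (-1 : ℝ) • h)
  have g13 : -q ≠ q - p := fun h => h6 (by linear_combination (norm := module) (1 : ℝ) • h)
  have g14 : -q ≠ p - q := fun h => h1 (by linear_combination (norm := module) (-1 : ℝ) • h)
  rw [Set.ncard_insert_of_notMem, Set.ncard_insert_of_notMem, Set.ncard_insert_of_notMem,
      Set.ncard_insert_of_notMem, Set.ncard_pair g3]
  all_goals simp only [Set.mem_insert_iff, Set.mem_singleton_iff, not_or]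
  · exact ⟨g13, g14⟩
  · exact ⟨g2, g11, g12⟩
  · exact ⟨g7, g8, g9, g10⟩
  · exact ⟨g1, h3, g4, g5, g6⟩

namespace ConvexTiling

variable {d : ℕ} {P T : Set (RSpace d)}

lemma eq_of_contact_eq (h : ConvexTiling P T) (h0 : (0 : RSpace d) ∈ T) {v v' : RSpace d}
    (hvT : v ∈ T) (hv : IsNbr P v) (hvT' : v' ∈ T) (hv' : IsNbr P v')
    (hc : contact P v = contact P v') : v = v' := by
  obtain ⟨l, hl⟩ := h.exists_isNormal h0 (by simpa using hvT) hv
  obtain ⟨l', hl'⟩ := h.exists_isNormal h0 (by simpa using hvT') hv'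
  obtain ⟨x, hx⟩ := hv.1
  exact hl.eq_of_ker_eq h hl' (by rw [← hl.ker, ← hl'.ker, hc]) hx (hc ▸ hx)

lemma isFacetVector_iff (h : ConvexTiling P T) (h0 : (0 : RSpace d) ∈ T) {F : Set (RSpace d)}
    {v : RSpace d} : IsFacetVector P T F v ↔ v ∈ T ∧ IsNbr P v ∧ contact P v = F := by
  rw [IsFacetVector, inter_vadd_eq_contact]
  constructor
  · rintro ⟨hF, hv, rfl⟩
    exact ⟨hv, hF.2, rfl⟩
  · rintro ⟨hv, hn, rfl⟩
    obtain ⟨l, hl⟩ := h.exists_isNormal h0 (by simpa using hv) hn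
    exact ⟨hn.isFacet hl, hv, rfl⟩

lemma image_contact {e : RSpace d} (he : ∀ x ∈ P, e - x ∈ P) (v : RSpace d) :
    (fun x => e - x) '' contact P v = contact P (-v) := by
  have hsub : ∀ w, ∀ x ∈ contact P w, e - x ∈ contact P (-w) := fun w x hx =>
    ⟨he _ hx.1, by rw [show e - x - -w = e - (x - w) by abel]; exact he _ hx.2⟩
  ext x
  constructor
  · rintro ⟨y, hy, rfl⟩
    exact hsub v y hy
  · intro hx
    exact ⟨e - x, by simpa using hsub _ x hx, by simp⟩

lemma pointReflection_half (e : RSpace d) :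
    ⇑(AffineEquiv.pointReflection ℝ ((1 / 2 : ℝ) • e)) = fun x => e - x := by
  ext1 x
  rw [AffineEquiv.pointReflection_apply, vsub_eq_sub, vadd_eq_add]
  module

lemma areAntipodal_contact (h : ConvexTiling P T) (h0 : (0 : RSpace d) ∈ T) {e : RSpace d}
    (he : ∀ x ∈ P, e - x ∈ P) {v : RSpace d} (hvT : v ∈ T) (hv : IsNbr P v) :
    AreAntipodal P (contact P v) (contact P (-v)) := by
  have hneg : -v ∈ T := by simpa using h.sub_mem h0 h0 hvT
  refine ⟨((h.isFacetVector_iff h0).2 ⟨hvT, hv, rfl⟩).1,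
    ((h.isFacetVector_iff h0).2 ⟨hneg, hv.neg, rfl⟩).1, (1 / 2 : ℝ) • e, ?_, ?_⟩
  · rw [pointReflection_half]
    ext x
    constructor
    · rintro ⟨y, hy, rfl⟩
      exact he y hy
    · exact fun hx => ⟨e - x, he x hx, by simp⟩
  · rw [pointReflection_half, image_contact he]

/-- The centre of symmetry is unique, since composing two point reflections that preserve `P` gives
a translation preserving `P`. -/
lemma eq_image_of_areAntipodal (h : ConvexTiling P T) {e : RSpace d} (he : ∀ x ∈ P, e - x ∈ P)
    {F F' : Set (RSpace d)} (hF : AreAntipodal P F F') : F' = (fun x => e - x) '' F := by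
  obtain ⟨-, -, c, hc, rfl⟩ := hF
  have h2 : ∀ x, AffineEquiv.pointReflection ℝ c x = c + c - x := fun x => by
    rw [AffineEquiv.pointReflection_apply, vsub_eq_sub, vadd_eq_add]; abel
  have : e - (c + c) = 0 := by
    refine eq_zero_of_add_mem h.compact.isBounded
      (h.int_nonempty.mono interior_subset) fun y hy => ?_
    have h1 : AffineEquiv.pointReflection ℝ c y ∈ P := hc ▸ Set.mem_image_of_mem _ hy
    rw [h2] at h1
    have := he _ h1
    rwa [show e - (c + c - y) = y + (e - (c + c)) by abel] at this
  rw [sub_eq_zero] at this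
  rw [this]
  congr 1
  ext1 x
  exact h2 x

lemma venkovVertex_eq (h : ConvexTiling P T) {e : RSpace d} (he : ∀ x ∈ P, e - x ∈ P)
    (w : VenkovVertex P) {v : RSpace d} (hv : contact P v ∈ w.1) :
    w.1 = s(contact P v, contact P (-v)) := by
  obtain ⟨_, F, F', hF, rfl⟩ := w
  rcases Sym2.mem_iff.1 hv with rfl | rfl
  · change s(contact P v, F') = _
    rw [h.eq_image_of_areAntipodal he hF, image_contact he]
  · have : F = contact P (-v) := by
      rw [← image_contact he, h.eq_image_of_areAntipodal he hF, Set.image_image]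
      simp
    change s(F, contact P v) = _
    rw [this, Sym2.eq_swap]

lemma exists_venkovVertex (h : ConvexTiling P T) (h0 : (0 : RSpace d) ∈ T) {e : RSpace d}
    (he : ∀ x ∈ P, e - x ∈ P) {v : RSpace d} (hvT : v ∈ T) (hv : IsNbr P v) :
    ∃ w : VenkovVertex P, contact P v ∈ w.1 :=
  ⟨⟨_, _, _, h.areAntipodal_contact h0 he hvT hv, rfl⟩, Sym2.mem_mk_left _ _⟩

/-- Three pairwise neighbouring tiles around a ridge belong to a belt of six facets. -/
lemma exists_belt (h : ConvexTiling P T) (h0 : (0 : RSpace d) ∈ T) {e : RSpace d}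
    (he : ∀ x ∈ P, e - x ∈ P) {x s t r : RSpace d}
    (hx : finrank ℝ (vectorSpan ℝ (cellAt P T x)) + 2 = d) (hs : s ∈ tilesAt P T x)
    (ht : t ∈ tilesAt P T x) (hr : r ∈ tilesAt P T x) (hst : IsNbr P (t - s))
    (hsr : IsNbr P (r - s)) (htr : IsNbr P (r - t)) :
    ∃ E, IsRidge P E ∧ (belt P E).ncard = 6 ∧ ∀ a ∈ ({s, t, r} : Set (RSpace d)),
      ∀ b ∈ ({s, t, r} : Set (RSpace d)), a ≠ b → contact P (b - a) ∈ belt P E := by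
  have hsym : ∀ {b c : RSpace d}, IsNbr P (b - c) → IsNbr P (c - b) := fun hb => by
    simpa using hb.neg
  -- The ridge is the intersection of two facets of one tile. Its directions contain those of the
  -- cell and lie in two distinct hyperplanes, so the dimension is forced.
  have hE : vectorSpan ℝ (contact P (t - s) ∩ contact P (r - s)) =
      vectorSpan ℝ (cellAt P T x) := by
    obtain ⟨l, hl⟩ := h.exists_normal_of_tilesAt hs ht hst
    obtain ⟨l', hl'⟩ := h.exists_normal_of_tilesAt hs hr hsr
    have h1 : vectorSpan ℝ (cellAt P T x) ≤
        vectorSpan ℝ (contact P (t - s) ∩ contact P (r - s)) := by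
      rw [← vectorSpan_preimage_add (contact P (t - s) ∩ contact P (r - s)) (-s)]
      refine vectorSpan_mono ℝ fun y hy => ?_
      refine ⟨⟨?_, ?_⟩, ⟨?_, ?_⟩⟩
      · simpa [sub_eq_add_neg] using hy s hs
      · rw [show y + -s - (t - s) = y - t by abel]; exact hy t ht
      · simpa [sub_eq_add_neg] using hy s hs
      · rw [show y + -s - (r - s) = y - r by abel]; exact hy r hr
    have h2 : vectorSpan ℝ (contact P (t - s) ∩ contact P (r - s)) ≤
        LinearMap.ker l.toLinearMap ⊓ LinearMap.ker l'.toLinearMap :=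
      le_inf (hl.ker ▸ vectorSpan_mono ℝ Set.inter_subset_left)
        (hl'.ker ▸ vectorSpan_mono ℝ Set.inter_subset_right)
    have h3 : LinearMap.ker l.toLinearMap ⊓ LinearMap.ker l'.toLinearMap <
        LinearMap.ker l.toLinearMap := by
      refine lt_of_le_of_ne inf_le_left fun h4 => ?_
      have := hl.eq_of_ker_eq h hl' (inf_eq_left.1 h4) (mem_contact_of_mem_tilesAt hs ht)
        (mem_contact_of_mem_tilesAt hs hr)
      exact h.isNbr_ne_zero htr (by rw [sub_left_injective this, sub_self])
    have h4 := Submodule.finrank_mono h2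
    have h5 := Submodule.finrank_lt_finrank_of_lt h3
    have h6 := finrank_ker_add_one hl.ne_zero
    exact (Submodule.eq_of_le_of_finrank_le h1 (by omega)).symm
  have hnbr : ∀ a ∈ ({s, t, r} : Set (RSpace d)), ∀ b ∈ ({s, t, r} : Set (RSpace d)), a ≠ b →
      a ∈ tilesAt P T x ∧ b ∈ tilesAt P T x ∧ IsNbr P (b - a) := by
    rintro a (rfl | rfl | rfl) b (rfl | rfl | rfl) hab <;>
      first
        | exact absurd rfl hab
        | exact ⟨by assumption, by assumption, by assumption⟩
        | exact ⟨by assumption, by assumption, hsym (by assumption)⟩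
  have hfv : ∀ a ∈ ({s, t, r} : Set (RSpace d)), ∀ b ∈ ({s, t, r} : Set (RSpace d)), a ≠ b →
      IsFacetVector P T (contact P (b - a)) (b - a) := fun a ha b hb hab =>
    (h.isFacetVector_iff h0).2 ⟨h.sub_mem h0 (hnbr a ha b hb hab).2.1.1 (hnbr a ha b hb hab).1.1,
      (hnbr a ha b hb hab).2.2, rfl⟩
  have hmem : ∀ a ∈ ({s, t, r} : Set (RSpace d)), ∀ b ∈ ({s, t, r} : Set (RSpace d)), a ≠ b →
      contact P (b - a) ∈ belt P (contact P (t - s) ∩ contact P (r - s)) := fun a ha b hb hab =>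
    ⟨(hfv a ha b hb hab).1,
      hE ▸ vectorSpan_cellAt_le (hnbr a ha b hb hab).1 (hnbr a ha b hb hab).2.1⟩
  have hne : ∀ {a b : RSpace d}, IsNbr P (b - a) → a ≠ b := fun hab h1 =>
    h.isNbr_ne_zero hab (sub_eq_zero.2 h1.symm)
  have n1 := hne hst
  have n2 := hne hsr
  have n3 := hne htr
  refine ⟨_, ⟨(hfv s (by simp) t (by simp) n1).1.1.inter (hfv s (by simp) r (by simp) n2).1.1,
    ⟨x - s, mem_contact_of_mem_tilesAt hs ht, mem_contact_of_mem_tilesAt hs hr⟩,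
    by rw [hE]; exact hx⟩, ?_, hmem⟩
  have hbelt : belt P (contact P (t - s) ∩ contact P (r - s)) =
      contact P '' {t - s, s - t, r - s, s - r, r - t, t - r} := by
    ext F
    constructor
    · rintro ⟨hF, hle⟩
      obtain ⟨v, hvT, hv, rfl⟩ := hF.exists_nbr h h0
      obtain ⟨n, hn⟩ := h.exists_isNormal h0 hvT hv
      exact ⟨v, h.belt_of_three_tiles hx hs ht hr hst hsr htr hn hv.1 (by rwa [← hE, ← hn.ker]),
        rfl⟩
    · rintro ⟨v, rfl | rfl | rfl | rfl | rfl | rfl, rfl⟩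
      · exact hmem s (by simp) t (by simp) n1
      · exact hmem t (by simp) s (by simp) n1.symm
      · exact hmem s (by simp) r (by simp) n2
      · exact hmem r (by simp) s (by simp) n2.symm
      · exact hmem t (by simp) r (by simp) n3
      · exact hmem r (by simp) t (by simp) n3.symm
  rw [hbelt, Set.InjOn.ncard_image]
  -- Besides coinciding tiles, two of the six vectors could agree only if one of `s, t, r` were the
  -- midpoint of the other two.
  · have e1 := h.add_ne_add_self he hs ht hr.1 n1
    have e2 := h.add_ne_add_self he hs hr ht.1 n2
    have e3 := h.add_ne_add_self he ht hr hs.1 n3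
    rw [show ({t - s, s - t, r - s, s - r, r - t, t - r} : Set (RSpace d)) =
      {t - s, -(t - s), r - s, -(r - s), (r - s) - (t - s), (t - s) - (r - s)} by
        rw [neg_sub, neg_sub, sub_sub_sub_cancel_right, sub_sub_sub_cancel_right]]
    refine ncard_six_vectors (h.isNbr_ne_zero hst) (h.isNbr_ne_zero hsr)
      (fun h1 => n3 (sub_left_injective h1)) (fun h1 => e3 ?_) (fun h1 => e2 ?_) fun h1 => e1 ?_
    · linear_combination (norm := module) (1 : ℝ) • h1
    · linear_combination (norm := module) (1 : ℝ) • h1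
    · linear_combination (norm := module) (1 : ℝ) • h1
  · have hv : ∀ v ∈ ({t - s, s - t, r - s, s - r, r - t, t - r} : Set (RSpace d)),
        v ∈ T ∧ IsNbr P v := by
      rintro v (rfl | rfl | rfl | rfl | rfl | rfl)
      · exact ⟨h.sub_mem h0 ht.1 hs.1, hst⟩
      · exact ⟨h.sub_mem h0 hs.1 ht.1, hsym hst⟩
      · exact ⟨h.sub_mem h0 hr.1 hs.1, hsr⟩
      · exact ⟨h.sub_mem h0 hs.1 hr.1, hsym hsr⟩
      · exact ⟨h.sub_mem h0 hr.1 ht.1, htr⟩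
      · exact ⟨h.sub_mem h0 ht.1 hr.1, hsym htr⟩
    intro v hv1 v' hv2 hvv
    exact h.eq_of_contact_eq h0 (hv v hv1).1 (hv v hv1).2 (hv v' hv2).1 (hv v' hv2).2 hvv

/-- The vectors of `T` along which `Φ` increases by `κ` times the vector form a group, so it
suffices to know this on generators. -/
lemma add_smul_of_mem_span (h : ConvexTiling P T) (h0 : (0 : RSpace d) ∈ T)
    {Φ : RSpace d → RSpace d} {κ : ℝ} {S : Set (RSpace d)}
    (hS : ∀ v ∈ S, v ∈ T ∧ ∀ t ∈ T, Φ (t + v) = Φ t + κ • v) {x : RSpace d}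
    (hx : x ∈ Submodule.span ℤ S) : x ∈ T ∧ ∀ t ∈ T, Φ (t + x) = Φ t + κ • x := by
  let G : AddSubgroup (RSpace d) :=
    { carrier := {v | v ∈ T ∧ ∀ t ∈ T, Φ (t + v) = Φ t + κ • v}
      zero_mem' := ⟨h0, fun t _ => by simp⟩
      add_mem' := fun {v w} hv hw => ⟨h.add_mem h0 hv.1 hw.1, fun t ht => by
        rw [← add_assoc, hw.2 _ (h.add_mem h0 ht hv.1), hv.2 t ht, smul_add, add_assoc]⟩
      neg_mem' := fun {v} hv => ⟨by simpa using h.sub_mem h0 h0 hv.1, fun t ht => by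
        have := hv.2 _ (h.sub_mem h0 ht hv.1)
        rw [sub_add_cancel] at this
        rw [this, smul_neg, add_neg_cancel_right, sub_eq_add_neg]⟩ }
  have : Submodule.span ℤ S ≤ AddSubgroup.toIntSubmodule G := Submodule.span_le.2 hS
  exact this hx

end ConvexTiling

/-! ### The direct sum decomposition -/

lemma IsParallelohedron.convexTiling {d : ℕ} {P T : Set (RSpace d)} (hP : IsParallelohedron P)
    (hT : IsFaceToFaceTiling P T) : ConvexTiling P T := by
  obtain ⟨⟨⟨S, hS, rfl⟩, hint⟩, -⟩ := hP
  exact ⟨convex_convexHull ℝ S, hS.isCompact_convexHull ℝ, hint, hT⟩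

theorem mainTheorem3 (d : ℕ) (P : Set (RSpace d)) (hP : IsParallelohedron P)
    (T : Set (RSpace d)) (hT : IsFaceToFaceTiling P T) (h0 : (0 : RSpace d) ∈ T)
    (A₁ A₂ : Set (VenkovVertex P)) (hdisj : Disjoint A₁ A₂) (hunion : A₁ ∪ A₂ = Set.univ)
    (hred : ∀ v ∈ A₁, ∀ w ∈ A₂, ¬ (redVenkovGraph P).Adj v w) :
    facetLattice P T = facetSublattice P T A₁ ⊔ facetSublattice P T A₂ ∧
      Disjoint (facetSublattice P T A₁) (facetSublattice P T A₂) := by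
  classical
  have h := hP.convexTiling hT
  obtain ⟨e, he⟩ := h.exists_symm h0
  set I : Set (VenkovVertex P) → Set (RSpace d) :=
    fun A => {t | ∃ v ∈ A, ∃ F ∈ v.1, IsFacetVector P T F t} with hI
  have hImem : ∀ {A v}, v ∈ I A → v ∈ T ∧ IsNbr P v ∧ ∃ w ∈ A, contact P v ∈ w.1 := by
    rintro A v ⟨w, hw, F, hF, hv⟩
    obtain ⟨h1, h2, rfl⟩ := (h.isFacetVector_iff h0).1 hv
    exact ⟨h1, h2, w, hw, hF⟩
  have hcover : ∀ v ∈ T, IsNbr P v → v ∈ I A₁ ∨ v ∈ I A₂ := by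
    intro v hvT hv
    obtain ⟨w, hw⟩ := h.exists_venkovVertex h0 he hvT hv
    rcases (hunion ▸ Set.mem_univ w : w ∈ A₁ ∪ A₂) with hA | hA
    · exact .inl ⟨w, hA, _, hw, (h.isFacetVector_iff h0).2 ⟨hvT, hv, rfl⟩⟩
    · exact .inr ⟨w, hA, _, hw, (h.isFacetVector_iff h0).2 ⟨hvT, hv, rfl⟩⟩
  have hIneg : ∀ {A v}, v ∈ I A → -v ∈ I A := by
    intro A v hv
    obtain ⟨hvT, hvn, w, hw, hvw⟩ := hImem hv
    refine ⟨w, hw, contact P (-v), ?_, (h.isFacetVector_iff h0).2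
      ⟨by simpa using h.sub_mem h0 h0 hvT, hvn.neg, rfl⟩⟩
    rw [h.venkovVertex_eq he w hvw]
    exact Sym2.mem_mk_right _ _
  have hIdisj : ∀ v ∈ I A₁, v ∉ I A₂ := by
    intro v hv1 hv2
    obtain ⟨-, -, w1, hw1, hvw1⟩ := hImem hv1
    obtain ⟨-, -, w2, hw2, hvw2⟩ := hImem hv2
    have : w1 = w2 := Subtype.ext
      ((h.venkovVertex_eq he w1 hvw1).trans (h.venkovVertex_eq he w2 hvw2).symm)
    exact Set.disjoint_left.1 hdisj hw1 (this ▸ hw2)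
  have hbelt : ∀ E, IsRidge P E → (belt P E).ncard = 6 → ∀ v w, contact P v ∈ belt P E →
      contact P (-v) ∈ belt P E → contact P w ∈ belt P E → contact P (-w) ∈ belt P E →
      v ∈ I A₁ → w ∉ I A₂ := by
    intro E hE h6 v w hv hv' hw hw' hvI hwI
    obtain ⟨-, -, w1, hw1, hvw1⟩ := hImem hvI
    obtain ⟨-, -, w2, hw2, hvw2⟩ := hImem hwI
    refine hred w1 hw1 w2 hw2 ⟨?_, E, hE, h6, ?_, ?_⟩
    · rintro rfl
      exact Set.disjoint_left.1 hdisj hw1 hw2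
    · rw [h.venkovVertex_eq he w1 hvw1]
      simp [hv, hv']
    · rw [h.venkovVertex_eq he w2 hvw2]
      simp [hw, hw']
  -- The prospective projection to the first summand, prescribed on facet vectors only.
  set a : RSpace d → RSpace d := fun v => if v ∈ I A₁ then v else 0 with ha
  have ha1 : ∀ v ∈ I A₁, a v = v := fun v hv => if_pos hv
  have ha2 : ∀ v ∈ I A₂, a v = 0 := fun v hv => if_neg fun hv1 => hIdisj v hv1 hv
  have ha0 : a 0 = 0 := ite_self _
  have hneg : ∀ v ∈ T, IsNbr P v → a (-v) = -a v := by
    intro v hvT hv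
    rcases hcover v hvT hv with hI | hI
    · rw [ha1 _ hI, ha1 _ (hIneg hI)]
    · rw [ha2 _ hI, ha2 _ (hIneg hI), neg_zero]
  obtain ⟨Φ, hΦ⟩ := h.exists_potential (a := a) h0 fun x hx =>
    h.exists_isPot_local h0 he ha0 hneg (fun x hx s hs t ht r hr hst hsr htr => by
      obtain ⟨E, hE, h6, hEb⟩ := h.exists_belt h0 he hx hs ht hr hst hsr htr
      have hne : ∀ {a b : RSpace d}, IsNbr P (b - a) → a ≠ b := fun hab h1 =>
        h.isNbr_ne_zero hab (sub_eq_zero.2 h1.symm)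
      have n1 := hne hst
      have n2 := hne hsr
      have n3 := hne htr
      have b1 := hEb s (by simp) t (by simp) n1
      have b2 := hEb s (by simp) r (by simp) n2
      have b3 := hEb t (by simp) r (by simp) n3
      have b1' := hEb t (by simp) s (by simp) n1.symm
      have b2' := hEb r (by simp) s (by simp) n2.symm
      have b3' := hEb r (by simp) t (by simp) n3.symm
      rw [← neg_sub] at b1' b2' b3'
      -- All three facet vectors share a belt of six, so they lie in the class of `t - s`; there `a`
      -- is the identity or zero and the triangle relation is trivial.
      rcases hcover _ (h.sub_mem h0 ht.1 hs.1) hst with hI1 | hI1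
      · have hI2 := (hcover _ (h.sub_mem h0 hr.1 hs.1) hsr).resolve_right
          (hbelt E hE h6 _ _ b1 b1' b2 b2' hI1)
        have hI3 := (hcover _ (h.sub_mem h0 hr.1 ht.1) htr).resolve_right
          (hbelt E hE h6 _ _ b1 b1' b3 b3' hI1)
        rw [ha1 _ hI1, ha1 _ hI2, ha1 _ hI3, sub_add_sub_cancel]
      · have hI2 := (hcover _ (h.sub_mem h0 hr.1 hs.1) hsr).resolve_left
          fun hc => hbelt E hE h6 _ _ b2 b2' b1 b1' hc hI1
        have hI3 := (hcover _ (h.sub_mem h0 hr.1 ht.1) htr).resolve_left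
          fun hc => hbelt E hE h6 _ _ b3 b3' b1 b1' hc hI1
        rw [ha2 _ hI1, ha2 _ hI2, ha2 _ hI3, add_zero]) hx
  have hstep : ∀ {A v}, v ∈ I A → ∀ t ∈ T, Φ (t + v) = Φ t + a v := by
    intro A v hv t ht
    have := hΦ t ht (t + v) (h.add_mem h0 ht (hImem hv).1) (by simpa using (hImem hv).2.1)
    rw [add_sub_cancel_left] at this
    rw [← this]
    abel
  constructor
  · apply le_antisymm
    · refine Submodule.span_le.2 ?_
      rintro v ⟨F, hF⟩
      obtain ⟨hvT, hv, -⟩ := (h.isFacetVector_iff h0).1 hF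
      rcases hcover v hvT hv with hI | hI
      · exact Submodule.mem_sup_left (Submodule.subset_span hI)
      · exact Submodule.mem_sup_right (Submodule.subset_span hI)
    · refine sup_le (Submodule.span_mono ?_) (Submodule.span_mono ?_) <;>
      · rintro v ⟨w, -, F, -, hF⟩
        exact ⟨F, hF⟩
  · rw [Submodule.disjoint_def]
    intro x hx1 hx2
    -- Evaluate `Φ x` from `0` in two ways: slope `1` along the first sublattice, slope `0` along
    -- the second.
    have h1 := (h.add_smul_of_mem_span h0 (Φ := Φ) (κ := 1) (fun v hv => ⟨(hImem hv).1,
      fun t ht => by rw [hstep hv t ht, ha1 v hv, one_smul]⟩) hx1).2 0 h0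
    have h2 := (h.add_smul_of_mem_span h0 (Φ := Φ) (κ := 0) (fun v hv => ⟨(hImem hv).1,
      fun t ht => by rw [hstep hv t ht, ha2 v hv, zero_smul]⟩) hx2).2 0 h0
    rw [h1, zero_smul, one_smul] at h2
    exact add_left_cancel h2
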